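/- Let $n\ge 1$ be an integer and $0<s<\frac n2$. For $f\in L^{\frac{2n}{n+2s}}(\mathbb R^n)$ let $(-\Delta)^{-s/2}f$ denote the Riesz potential $$(-\Delta)^{-s/2}f(x)=\frac{\Gamma(\frac{n-s}{2})}{2^{s}\pi^{n/2}\Gamma(\frac s2)}\int_{\mathbb R^n}\frac{f(y)}{|x-y|^{n-s}}\,dy ,$$ and let $$\mathcal M_{HLS}=\Big\{\,cF\Big(\frac{\cdot-x_0}{a}\Big):\ c\in\mathbb R,\ x_0\in\mathbb R^n,\ a>0\Big\},\qquad F(x)=(1+|x|^2)^{-\frac{n+2s}{2}} .$$ Let $0\le g\in L^{\frac{2n}{n+2s}}(\mathbb R^n)$ and suppose that $g=\phi_1+r_1=\phi_2+r_2$, where for $i=1,2$ we have $\phi_i\in\mathcal M_{HLS}$ and $$\|(-\Delta)^{-s/2}(g-\phi_i)\|_2=\inf_{h\in\mathcal M_{HLS}}\|(-\Delta)^{-s/2}(g-h)\|_2 .$$ Then $$b_{n,s}^{-1}\,\|r_1\|_{\frac{2n}{n+2s}}\le\|r_2\|_{\frac{2n}{n+2s}}\le b_{n,s}\,\|r_1\|_{\frac{2n}{n+2s}},\qquad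 b_{n,s}=1+2^{1+\frac sn}\sqrt{\frac{n+2s}{n-2s}} .$$ -/

import Mathlib

open MeasureTheory

namespace HLS

/-- The exponent `2n/(n+2s)`, as an extended nonnegative real. -/
noncomputable def hlsExponent (n : ℕ) (s : ℝ) : ENNReal :=
  ENNReal.ofReal (2 * n / (n + 2 * s))

/-- The operator `(-Δ)^{-s/2}` on `ℝⁿ`, `0 < s < n`, i.e. the Riesz potential of order `s`,
`((-Δ)^{-s/2} f)(x) = Γ((n-s)/2) / (2^s π^{n/2} Γ(s/2)) * ∫ f(y) / |x-y|^{n-s} dy`.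
For `0 < s < n/2` and `f ∈ L^{2n/(n+2s)}` the integral converges absolutely for almost every `x`. -/
noncomputable def rieszPotential (n : ℕ) (s : ℝ) (f : EuclideanSpace ℝ (Fin n) → ℝ) :
    EuclideanSpace ℝ (Fin n) → ℝ := fun x =>
  Real.Gamma ((n - s) / 2) / ((2 : ℝ) ^ s * Real.pi ^ ((n : ℝ) / 2) * Real.Gamma (s / 2)) *
    ∫ y, f y / ‖x - y‖ ^ ((n : ℝ) - s)

/-- The norm `‖(-Δ)^{-s/2} f‖₂`. -/
noncomputable def negSobolevNorm (n : ℕ) (s : ℝ) (f : EuclideanSpace ℝ (Fin n) → ℝ) : ENNReal :=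
  eLpNorm (rieszPotential n s f) 2 volume

/-- The standard bubble `F(x) = (1+|x|²)^{-(n+2s)/2}`. -/
noncomputable def bubble (n : ℕ) (s : ℝ) (x : EuclideanSpace ℝ (Fin n)) : ℝ :=
  (1 + ‖x‖ ^ 2) ^ (-((n + 2 * s) / 2))

/-- The set `M_HLS` of all functions `x ↦ c F((x - x₀)/a)` with `c ∈ ℝ`, `x₀ ∈ ℝⁿ`, `a > 0`. -/
def optimizers (n : ℕ) (s : ℝ) : Set (EuclideanSpace ℝ (Fin n) → ℝ) :=
  {h | ∃ (c : ℝ) (x₀ : EuclideanSpace ℝ (Fin n)) (a : ℝ), 0 < a ∧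
    h = fun x => c * bubble n s (a⁻¹ • (x - x₀))}

/-- `g = φ + r` (almost everywhere) with `φ ∈ M_HLS` a nearest point to `g` in the norm
`‖(-Δ)^{-s/2} ·‖₂`. -/
structure IsDecomposition (n : ℕ) (s : ℝ) (g φ r : EuclideanSpace ℝ (Fin n) → ℝ) : Prop where
  mem_optimizers : φ ∈ optimizers n s
  eq_add : g =ᵐ[volume] φ + r
  dist_eq_iInf : negSobolevNorm n s (g - φ) = ⨅ h ∈ optimizers n s, negSobolevNorm n s (g - h)

end HLS

/-! Put `α = n/2 - s` and `p = 2n/(n+2s) = n/(n-α)`. Two Riesz kernels compose to a multiple of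
`|x-y|^(-2α)`, so the squared negative Sobolev norm is a constant times `energy α f f`, and nearest
points can be studied with this quadratic form alone.

Let all bubbles `b` be normalized so that they have the same energy `ε`. Minimality of `φ = c • b`
along its own ray gives `energy g b = c ε`. Hence `c ≥ 0` because `g ≥ 0`, and the squared distance
is `energy g g - c² ε`. Two nearest points therefore carry the same coefficient, and `φ₁ - φ₂ = c •
(b₁ - b₂)`. For such differences the sharp Hardy-Littlewood-Sobolev inequality can be reversed up to
a constant (`integral_sub_conformalBubble_le`). Together with `energy (φ₁ - φ₂) ≤ 4 energy (g - φ₁)`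
and the sharp inequality for `g - φ₁`, this bounds `‖φ₁ - φ₂‖` by a multiple of `‖r₁‖`. The triangle
inequality concludes.

The reverse inequality comes from two facts. The first variation of the sharp inequality at the
extremal `b₁` bounds `energy b₁ b₂` by a multiple of `∫ b₁^(p-1) b₂`. The duality map `b ↦ b^(p-1)`
of `L^p` is quantitatively monotone.

The sharp inequality with the bubbles as extremals (`energy_le_sharpConst_mul`,
`energy_conformalBubble`) is proved by second variation, without rearrangement and without existence
of maximizers. A near-maximizer `f` is centred by a conformal map, so that `f^p` is orthogonal to
the coordinates `ω_j` of the sphere, and `f (1 ± t ω_j)` is tested. Summed over `j`, this makes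
`(n-α) ∑ energy(f ω_j) - α energy f` almost nonpositive. A spectral inequality on the sphere shows
that this quantity controls the part of the energy not due to the mean of `f`, and the mean is
handled by Hölder's inequality.

The spectral inequality avoids spherical harmonics: `(1-r)^(-α)`, `r = u(x)·u(y)`, is expanded in
powers of `r`, and only two properties of the moments are used, namely positivity and the recurrence
`sphereMoment_recurrence`. -/

open MeasureTheory Filter Topology
namespace HLS

/-! ### Positivity properties of the moments of a density on the sphere. -/

section Sphere

/-- The infinitesimal rotation in the plane of the `i`-th and `j`-th coordinates. -/
def planeRotation {N : ℕ} (i j : Fin N) (v : Fin N → ℝ) : Fin N → ℝ :=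
  Pi.single i (v j) - Pi.single j (v i)

/-- The derivative of the monomial `∏ m, v (a m)` in the direction `v'`. -/
def monomialDeriv {N k : ℕ} (v v' : Fin N → ℝ) (a : Fin k → Fin N) : ℝ :=
  ∑ m, (∏ l ∈ Finset.univ.erase m, v (a l)) * v' (a m)

lemma hasDerivAt_monomial {N k : ℕ} (v v' : Fin N → ℝ) (a : Fin k → Fin N) :
    HasDerivAt (fun τ : ℝ => ∏ m, (v (a m) + τ * v' (a m))) (monomialDeriv v v' a) 0 := by
  have h : ∀ m ∈ (Finset.univ : Finset (Fin k)),
      HasDerivAt (fun τ : ℝ => v (a m) + τ * v' (a m)) (v' (a m)) 0 := by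
    intro m _
    simpa using ((hasDerivAt_id (0 : ℝ)).mul_const (v' (a m))).const_add (v (a m))
  have := HasDerivAt.fun_finsetProd h
  simpa [monomialDeriv] using this

lemma sum_prod_mul_prod {N k : ℕ} (v w : Fin N → ℝ) :
    ∑ a : Fin k → Fin N, (∏ m, v (a m)) * ∏ m, w (a m) = (v ⬝ᵥ w) ^ k := by
  have := Finset.prod_univ_sum (fun _ : Fin k => (Finset.univ : Finset (Fin N)))
    (fun _ i => v i * w i)
  simp only [Finset.prod_const, Finset.card_univ, Fintype.card_fin] at this
  rw [dotProduct, this]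
  simp [Finset.prod_mul_distrib]

/-- The identity for `(v·w)^k` is differentiated once in `v` along `v'` and once in `w` along `w'`;
uniqueness of derivatives compares the two sides. -/
lemma sum_monomialDeriv_mul {N k : ℕ} (v v' w w' : Fin N → ℝ) :
    ∑ a : Fin k → Fin N, monomialDeriv v v' a * monomialDeriv w w' a =
      k * (v ⬝ᵥ w) ^ (k - 1) * (v' ⬝ᵥ w') +
        k * (k - 1 : ℕ) * (v ⬝ᵥ w) ^ (k - 2) * (v' ⬝ᵥ w) * (v ⬝ᵥ w') := by
  have h1 : ∀ w : Fin N → ℝ, ∑ a : Fin k → Fin N, monomialDeriv v v' a * ∏ m, w (a m) =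
      k * (v ⬝ᵥ w) ^ (k - 1) * (v' ⬝ᵥ w) := by
    intro w
    have hl : HasDerivAt (fun τ : ℝ => ∑ a : Fin k → Fin N,
        (∏ m, (v (a m) + τ * v' (a m))) * ∏ m, w (a m))
        (∑ a : Fin k → Fin N, monomialDeriv v v' a * ∏ m, w (a m)) 0 :=
      HasDerivAt.fun_sum fun a _ => (hasDerivAt_monomial v v' a).mul_const _
    have hr : HasDerivAt (fun τ : ℝ => (v ⬝ᵥ w + τ * (v' ⬝ᵥ w)) ^ k)
        (k * (v ⬝ᵥ w) ^ (k - 1) * (v' ⬝ᵥ w)) 0 := by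
      have := (((hasDerivAt_id (0 : ℝ)).mul_const (v' ⬝ᵥ w)).const_add (v ⬝ᵥ w)).fun_pow k
      simpa using this
    refine hl.unique (hr.congr_of_eventuallyEq (Filter.Eventually.of_forall fun τ => ?_))
    have := sum_prod_mul_prod (k := k) (v + τ • v') w
    simpa [add_dotProduct] using this
  have hl : HasDerivAt (fun τ : ℝ => ∑ a : Fin k → Fin N, monomialDeriv v v' a *
      ∏ m, (w (a m) + τ * w' (a m)))
      (∑ a : Fin k → Fin N, monomialDeriv v v' a * monomialDeriv w w' a) 0 :=
    HasDerivAt.fun_sum fun a _ => (hasDerivAt_monomial w w' a).const_mul _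
  have hr : HasDerivAt (fun τ : ℝ => k * (v ⬝ᵥ w + τ * (v ⬝ᵥ w')) ^ (k - 1) *
      (v' ⬝ᵥ w + τ * (v' ⬝ᵥ w')))
      (k * (v ⬝ᵥ w) ^ (k - 1) * (v' ⬝ᵥ w') +
        k * (k - 1 : ℕ) * (v ⬝ᵥ w) ^ (k - 2) * (v' ⬝ᵥ w) * (v ⬝ᵥ w')) 0 := by
    have e1 := ((((hasDerivAt_id (0 : ℝ)).mul_const (v ⬝ᵥ w')).const_add
      (v ⬝ᵥ w)).fun_pow (k - 1)).const_mul (k : ℝ)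
    have e2 := ((hasDerivAt_id (0 : ℝ)).mul_const (v' ⬝ᵥ w')).const_add (v' ⬝ᵥ w)
    have := e1.fun_mul e2
    refine this.congr_deriv ?_
    simp [Nat.sub_sub]
    ring
  refine hl.unique (hr.congr_of_eventuallyEq (Filter.Eventually.of_forall fun τ => ?_))
  have := h1 (w + τ • w')
  simpa using this

lemma sum_planeRotation_dotProduct {N : ℕ} (v w : Fin N → ℝ) :
    ∑ i, ∑ j, planeRotation i j v ⬝ᵥ planeRotation i j w = 2 * (N - 1) * (v ⬝ᵥ w) := by
  have h : ∀ i j, planeRotation i j v ⬝ᵥ planeRotation i j w =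
      v j * w j + v i * w i - 2 * (if i = j then v i * w i else 0) := by
    intro i j
    simp only [planeRotation, sub_dotProduct, dotProduct_sub, single_dotProduct]
    by_cases hij : i = j
    · subst hij; simp; ring
    · simp [hij, Ne.symm hij]
  simp only [h, Finset.sum_sub_distrib, Finset.sum_add_distrib, ← Finset.mul_sum,
    Finset.sum_ite_eq, Finset.sum_const, Finset.card_univ, Fintype.card_fin, nsmul_eq_mul,
    Finset.mem_univ, if_true]
  simp only [dotProduct, Finset.mul_sum, ← Finset.sum_sub_distrib, ← Finset.sum_add_distrib]
  exact Finset.sum_congr rfl fun i _ => by ring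

lemma planeRotation_dotProduct {N : ℕ} (i j : Fin N) (v w : Fin N → ℝ) :
    planeRotation i j v ⬝ᵥ w = v j * w i - v i * w j := by
  simp [planeRotation, sub_dotProduct, single_dotProduct]

lemma sum_planeRotation_mul {N : ℕ} (v w : Fin N → ℝ) :
    ∑ i, ∑ j, (planeRotation i j v ⬝ᵥ w) * (v ⬝ᵥ planeRotation i j w) =
      2 * ((v ⬝ᵥ w) ^ 2 - (v ⬝ᵥ v) * (w ⬝ᵥ w)) := by
  have h : ∀ i j, (planeRotation i j v ⬝ᵥ w) * (v ⬝ᵥ planeRotation i j w) =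
      (v i * w i) * (v j * w j) + (v i * w i) * (v j * w j)
        - (v i * v i) * (w j * w j) - (w i * w i) * (v j * v j) := by
    intro i j
    rw [dotProduct_comm v, planeRotation_dotProduct, planeRotation_dotProduct]
    ring
  simp only [h, Finset.sum_sub_distrib, Finset.sum_add_distrib, ← Finset.mul_sum,
    ← Finset.sum_mul]
  simp only [dotProduct]
  ring

variable {Ω : Type*} [MeasurableSpace Ω] (μ : Measure Ω)

/-- The source of all positivity on the sphere: a kernel of the form `∑ g i ⊗ g i` is positive
semidefinite. -/
lemma integral_kernel_sum_eq [SFinite μ] {ι : Type*} [Fintype ι] (H : Ω → ℝ) (g : ι → Ω → ℝ)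
    (hg : ∀ i, Integrable (fun x => H x * g i x) μ) :
    ∫ z : Ω × Ω, H z.1 * H z.2 * ∑ i, g i z.1 * g i z.2 ∂(μ.prod μ) =
      ∑ i, (∫ x, H x * g i x ∂μ) ^ 2 := by
  have : ∀ z : Ω × Ω, H z.1 * H z.2 * ∑ i, g i z.1 * g i z.2 =
      ∑ i, (H z.1 * g i z.1) * (H z.2 * g i z.2) := by
    intro z
    rw [Finset.mul_sum]
    exact Finset.sum_congr rfl fun i _ => by ring
  simp only [this]
  rw [integral_finsetSum _ fun i _ => (hg i).mul_prod (hg i)]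
  refine Finset.sum_congr rfl fun i _ => ?_
  rw [integral_prod_mul (fun x => H x * g i x) (fun x => H x * g i x), sq]

/-- The moment `∬ H(x) H(y) (u(x)·u(y))ᵏ`. -/
noncomputable def sphereMoment {N : ℕ} (H : Ω → ℝ) (u : Ω → Fin N → ℝ) (k : ℕ) : ℝ :=
  ∫ z : Ω × Ω, H z.1 * H z.2 * (u z.1 ⬝ᵥ u z.2) ^ k ∂(μ.prod μ)

variable {N : ℕ} {H : Ω → ℝ} {u : Ω → Fin N → ℝ}

lemma abs_coord_le_one {v : Fin N → ℝ} (h : v ⬝ᵥ v = 1) (i : Fin N) : |v i| ≤ 1 := by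
  have h1 : v i * v i ≤ v ⬝ᵥ v :=
    Finset.single_le_sum (f := fun i => v i * v i) (fun j _ => mul_self_nonneg _)
      (Finset.mem_univ i)
  rw [h] at h1
  exact abs_le_one_iff_mul_self_le_one.2 h1

lemma abs_dotProduct_le_one {v w : Fin N → ℝ} (hv : v ⬝ᵥ v = 1) (hw : w ⬝ᵥ w = 1) :
    |v ⬝ᵥ w| ≤ 1 := by
  have e1 : 0 ≤ (v - w) ⬝ᵥ (v - w) := Finset.sum_nonneg fun i _ => mul_self_nonneg _
  have e2 : 0 ≤ (v + w) ⬝ᵥ (v + w) := Finset.sum_nonneg fun i _ => mul_self_nonneg _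
  simp only [sub_dotProduct, dotProduct_sub, add_dotProduct, dotProduct_add, hv, hw,
    dotProduct_comm w v] at e1 e2
  exact abs_le.2 ⟨by linarith, by linarith⟩

lemma measurable_dotProduct (hu : Measurable u) :
    Measurable fun z : Ω × Ω => u z.1 ⬝ᵥ u z.2 := by
  simp only [dotProduct]
  fun_prop

lemma integrable_moment (hH : Integrable H μ) (hu : Measurable u) (h1 : ∀ x, u x ⬝ᵥ u x = 1)
    (k : ℕ) :
    Integrable (fun z : Ω × Ω => H z.1 * H z.2 * (u z.1 ⬝ᵥ u z.2) ^ k) (μ.prod μ) := by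
  refine (hH.mul_prod hH).mul_bdd (c := 1)
    ((measurable_dotProduct hu).pow_const k).aestronglyMeasurable
    (Filter.Eventually.of_forall fun z => ?_)
  rw [norm_pow]
  exact pow_le_one₀ (norm_nonneg _) (abs_dotProduct_le_one (h1 _) (h1 _))

lemma integrable_mul_monomialDeriv (hH : Integrable H μ) (hu : Measurable u)
    (h1 : ∀ x, u x ⬝ᵥ u x = 1) {k : ℕ} (i j : Fin N) (a : Fin k → Fin N) :
    Integrable (fun x => H x * monomialDeriv (u x) (planeRotation i j (u x)) a) μ := by
  have hm : Measurable fun x => monomialDeriv (u x) (planeRotation i j (u x)) a := by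
    simp only [monomialDeriv, planeRotation, Pi.sub_apply, Pi.single_apply]
    refine Finset.measurable_sum _ fun m _ => Measurable.mul ?_ ?_
    · exact Finset.measurable_prod _ fun l _ => (measurable_pi_apply _).comp hu
    · refine Measurable.sub ?_ ?_ <;> split_ifs <;> fun_prop
  refine hH.mul_bdd (c := ∑ m : Fin k, 1 * (1 + 1)) hm.aestronglyMeasurable
    (Filter.Eventually.of_forall fun x => ?_)
  refine (norm_sum_le _ _).trans (Finset.sum_le_sum fun m _ => ?_)
  have hc := abs_coord_le_one (h1 x)
  rw [norm_mul]
  refine mul_le_mul ?_ ?_ (norm_nonneg _) zero_le_one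
  · rw [norm_prod]
    exact Finset.prod_le_one (fun _ _ => norm_nonneg _) fun l _ => hc _
  · simp only [planeRotation, Pi.sub_apply, Pi.single_apply]
    refine (norm_sub_le _ _).trans (add_le_add ?_ ?_) <;> split_ifs <;> simp [hc]

/-- The kernel `(u·v)^k` is the Gram kernel of the degree `k` monomials. -/
lemma sphereMoment_nonneg [SFinite μ] (hH : Integrable H μ) (hu : Measurable u) (h1 : ∀ x, u x ⬝ᵥ u x = 1)
    (k : ℕ) : 0 ≤ sphereMoment μ H u k := by
  have := integral_kernel_sum_eq μ H (fun (a : Fin k → Fin N) x => ∏ m, u x (a m)) fun a => by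
    refine hH.mul_bdd (c := 1)
      (Finset.measurable_prod _ fun l _ => (measurable_pi_apply (a l)).comp hu).aestronglyMeasurable
      (Filter.Eventually.of_forall fun x => ?_)
    rw [norm_prod]
    exact Finset.prod_le_one (fun _ _ => norm_nonneg _) fun l _ => abs_coord_le_one (h1 x) _
  simp only [sum_prod_mul_prod] at this
  rw [sphereMoment, this]
  positivity

lemma sphereMoment_zero [SFinite μ] : sphereMoment μ H u 0 = (∫ x, H x ∂μ) ^ 2 := by
  simp [sphereMoment, integral_prod_mul, sq]

/-- The Laplace-Beltrami operator of the sphere, applied to `(u·v)ᵏ`, gives a positive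
semidefinite kernel. -/
lemma sphereMoment_recurrence [SFinite μ] (hH : Integrable H μ) (hu : Measurable u)
    (h1 : ∀ x, u x ⬝ᵥ u x = 1) (k : ℕ) :
    (k + 1 : ℝ) * sphereMoment μ H u k ≤ (N + k) * sphereMoment μ H u (k + 2) := by
  have key := integral_kernel_sum_eq μ H
    (fun (q : (Fin N × Fin N) × (Fin (k + 2) → Fin N)) x =>
      monomialDeriv (u x) (planeRotation q.1.1 q.1.2 (u x)) q.2)
    fun q => integrable_mul_monomialDeriv μ hH hu h1 _ _ _
  -- The Gram kernel of the rotational derivatives of the monomials of degree `k+2`. For unit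
  -- vectors with `r = u·v` the two sums over planes are `2(N-1) r` and `2(r²-1)`; ordered pairs
  -- count each plane twice, which only contributes the harmless factor 2.
  have hker : ∀ z : Ω × Ω, ∑ q : (Fin N × Fin N) × (Fin (k + 2) → Fin N),
      monomialDeriv (u z.1) (planeRotation q.1.1 q.1.2 (u z.1)) q.2 *
        monomialDeriv (u z.2) (planeRotation q.1.1 q.1.2 (u z.2)) q.2 =
      2 * (k + 2) * ((N + k) * (u z.1 ⬝ᵥ u z.2) ^ (k + 2) - (k + 1) * (u z.1 ⬝ᵥ u z.2) ^ k) := by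
    intro z
    rw [Fintype.sum_prod_type, Fintype.sum_prod_type]
    simp only [sum_monomialDeriv_mul, Finset.sum_add_distrib, ← Finset.mul_sum, mul_assoc,
      sum_planeRotation_dotProduct, sum_planeRotation_mul, h1]
    simp only [show k + 2 - 1 = k + 1 by omega, show k + 2 - 2 = k by omega]
    push_cast
    ring
  simp only [hker] at key
  have hint := integrable_moment μ hH hu h1
  have e : ∀ z : Ω × Ω, H z.1 * H z.2 * (2 * (k + 2) * ((N + k) * (u z.1 ⬝ᵥ u z.2) ^ (k + 2) -
      (k + 1) * (u z.1 ⬝ᵥ u z.2) ^ k)) = 2 * (k + 2) * (N + k) * (H z.1 * H z.2 *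
      (u z.1 ⬝ᵥ u z.2) ^ (k + 2)) - 2 * (k + 2) * (k + 1) * (H z.1 * H z.2 *
      (u z.1 ⬝ᵥ u z.2) ^ k) := fun z => by ring
  simp only [e] at key
  rw [integral_sub ((hint _).const_mul _) ((hint _).const_mul _), integral_const_mul,
    integral_const_mul] at key
  have hpos : 0 ≤ (2 * (k + 2) : ℝ) * ((N + k) * sphereMoment μ H u (k + 2) -
      (k + 1) * sphereMoment μ H u k) := by
    have h0 : (0:ℝ) ≤ ∑ q : (Fin N × Fin N) × (Fin (k + 2) → Fin N), (∫ x, H x *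
      monomialDeriv (u x) (planeRotation q.1.1 q.1.2 (u x)) q.2 ∂μ) ^ 2 := by positivity
    rw [← key] at h0
    simp only [sphereMoment]
    linarith
  have := nonneg_of_mul_nonneg_right hpos (by positivity)
  linarith

end Sphere

end HLS
namespace HLS

/-! ### The spectral inequality for abstract moment sequences. -/

section Series

lemma hasSum_of_eq {f g : ℕ → ℝ} {a : ℝ} (h : ∀ k, f k = g k) (hg : HasSum g a) : HasSum f a := by
  rwa [funext h]

/-- The coefficients `(α)ₖ / k!` of the binomial series of `(1 - x)^(-α)`. -/
noncomputable def binomCoeff (α : ℝ) : ℕ → ℝ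
  | 0 => 1
  | k + 1 => binomCoeff α k * ((α + k) / (k + 1))

lemma binomCoeff_pos {α : ℝ} (hα : 0 < α) (k : ℕ) : 0 < binomCoeff α k := by
  induction k with
  | zero => simp [binomCoeff]
  | succ k ih => rw [binomCoeff]; positivity

lemma binomCoeff_succ (α : ℝ) (k : ℕ) :
    (k + 1) * binomCoeff α (k + 1) = (α + k) * binomCoeff α k := by
  rw [binomCoeff]; field_simp

lemma choose_eq_binomCoeff (α : ℝ) (k : ℕ) : Ring.choose (α + k - 1) k = binomCoeff α k := by
  have h : ∀ k : ℕ, (k.factorial : ℝ) * Ring.multichoose α k = (ascPochhammer ℝ k).eval α := by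
    intro k
    rw [← nsmul_eq_mul, Ring.factorial_nsmul_multichoose_eq_ascPochhammer,
      Polynomial.ascPochhammer_smeval_eq_eval]
  have h' : ∀ k : ℕ, (ascPochhammer ℝ k).eval α = k.factorial * binomCoeff α k := by
    intro k
    induction k with
    | zero => simp [binomCoeff]
    | succ k ih =>
      rw [ascPochhammer_succ_eval, ih, Nat.factorial_succ]
      push_cast
      linear_combination (-(k.factorial : ℝ)) * binomCoeff_succ α k
  rw [Ring.choose]
  have h0 : (k.factorial : ℝ) ≠ 0 := by positivity
  have := (h k).trans (h' k)
  rw [show α + k - 1 - k + 1 = α by ring]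
  exact mul_left_cancel₀ h0 this

lemma hasSum_binomCoeff (α : ℝ) {x : ℝ} (hx : |x| < 1) :
    HasSum (fun k => binomCoeff α k * x ^ k) ((1 - x) ^ (-α)) := by
  have := (Real.one_div_one_sub_rpow_hasFPowerSeriesOnBall_zero α).hasSum (y := x) (by
    simpa [enorm_eq_nnnorm] using! hx)
  have hx' : 0 ≤ 1 - x := by linarith [(abs_lt.1 hx).2]
  simpa [FormalMultilinearSeries.ofScalars_apply_eq, choose_eq_binomCoeff, Real.rpow_neg hx',
    mul_comm] using this

/-- A sequence with the positivity properties of the moments of a density on the unit sphere of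
`ℝ^(n+1)`. -/
structure IsMomentSeq (n : ℕ) (M : ℕ → ℝ) : Prop where
  nonneg : ∀ k, 0 ≤ M k
  recurrence : ∀ k : ℕ, (k + 1 : ℝ) * M k ≤ (n + 1 + k) * M (k + 2)

/-- The combination of consecutive moments controlled by `IsMomentSeq`. -/
noncomputable def momentGap (n : ℕ) (M : ℕ → ℝ) (k : ℕ) : ℝ :=
  (n + k) * M (k + 1) - k * M (k - 1)

lemma IsMomentSeq.momentGap_nonneg {n : ℕ} {M : ℕ → ℝ} (hM : IsMomentSeq n M) (k : ℕ) :
    0 ≤ momentGap n M k := by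
  rcases k with _ | k
  · simp only [momentGap, Nat.cast_zero, add_zero, zero_mul, sub_zero]
    exact mul_nonneg (by positivity) (hM.nonneg _)
  · have := hM.recurrence k
    simp only [momentGap, Nat.add_sub_cancel]
    push_cast
    linarith

/-- Summation by parts, using `(k+1) b_{k+1} = (α+k) b_k`. It turns the deficit `(n-α) E' - α E`
into a weighted sum of the nonnegative gaps, up to a boundary term. -/
lemma sum_momentGap {n : ℕ} (α : ℝ) (M : ℕ → ℝ) (K : ℕ) :
    ∑ k ∈ Finset.range K, binomCoeff α k * momentGap n M k =
      ∑ k ∈ Finset.range K, binomCoeff α k * ((n - α) * M (k + 1) - α * M k) +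
        K * binomCoeff α K * (M K + M (K - 1)) := by
  induction K with
  | zero => simp
  | succ K ih =>
    rw [Finset.sum_range_succ, Finset.sum_range_succ, ih]
    have := binomCoeff_succ α K
    simp only [Nat.add_sub_cancel, momentGap]
    push_cast
    linear_combination (-(M (K + 1) + M K)) * this

lemma summable_shift {α : ℝ} (hα : 0 < α) {M : ℕ → ℝ} (h0 : ∀ k, 0 ≤ M k)
    (hs : Summable fun k => binomCoeff α k * M k) :
    Summable fun k => binomCoeff α k * M (k + 1) := by
  have hs' := ((summable_nat_add_iff 1).2 hs).mul_left (max 1 α⁻¹)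
  refine Summable.of_nonneg_of_le (fun k => mul_nonneg (binomCoeff_pos hα k).le (h0 _))
    (fun k => ?_) hs'
  rw [← mul_assoc]
  refine mul_le_mul_of_nonneg_right ?_ (h0 _)
  have h1 := binomCoeff_succ α k
  have hb := binomCoeff_pos hα k
  have hb' := binomCoeff_pos hα (k + 1)
  have hk : (0 : ℝ) ≤ k := k.cast_nonneg
  have h2 : (k + 1 : ℝ) ≤ max 1 α⁻¹ * (α + k) := by
    have e1 : α⁻¹ * α ≤ max 1 α⁻¹ * α := mul_le_mul_of_nonneg_right (le_max_right _ _) hα.le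
    rw [inv_mul_cancel₀ hα.ne'] at e1
    have e2 : 1 * (k : ℝ) ≤ max 1 α⁻¹ * k := mul_le_mul_of_nonneg_right (le_max_left _ _) hk
    linarith
  have h3 : (k + 1 : ℝ) * binomCoeff α k ≤ (k + 1) * (max 1 α⁻¹ * binomCoeff α (k + 1)) := by
    calc (k + 1 : ℝ) * binomCoeff α k ≤ max 1 α⁻¹ * (α + k) * binomCoeff α k :=
          mul_le_mul_of_nonneg_right h2 hb.le
      _ = _ := by rw [mul_assoc, ← h1]; ring
  exact le_of_mul_le_mul_left h3 (by positivity)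

/-- A boundary term in a summation by parts is arbitrarily small infinitely often. -/
lemma exists_boundary_lt {α : ℝ} (hα : 0 < α) {M : ℕ → ℝ} (h0 : ∀ k, 0 ≤ M k)
    (hs : Summable fun k => binomCoeff α k * M k) {ε : ℝ} (hε : 0 < ε) (K₀ : ℕ) :
    ∃ K ≥ K₀, K * binomCoeff α K * (M K + M (K - 1)) < ε := by
  by_contra! hcon
  have hs1 : Summable fun k => binomCoeff α (k + 1) * (M (k + 1) + M k) := by
    have e1 := (summable_nat_add_iff 1).2 hs
    have e2 : Summable fun k => binomCoeff α (k + 1) * M k := by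
      refine Summable.of_nonneg_of_le (fun k => mul_nonneg (binomCoeff_pos hα _).le (h0 _))
        (fun k => ?_) (hs.mul_left (α + 1))
      rw [← mul_assoc]
      refine mul_le_mul_of_nonneg_right ?_ (h0 _)
      have h1 := binomCoeff_succ α k
      have hb := binomCoeff_pos hα k
      refine le_of_mul_le_mul_left (a := (k + 1 : ℝ)) ?_ (by positivity)
      rw [h1, ← mul_assoc]
      refine mul_le_mul_of_nonneg_right ?_ hb.le
      have hk : (0 : ℝ) ≤ k := k.cast_nonneg
      nlinarith
    simpa [mul_add] using e1.add e2
  -- If the boundary terms stayed above `ε`, the summands of a convergent series would dominate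
  -- `ε/k`, against the divergence of the harmonic series.
  have hs2 : Summable fun k : ℕ => ε * (1 / ((k + 1 : ℕ) : ℝ)) := by
    refine summable_of_isBigO_nat hs1 ?_
    refine Asymptotics.IsBigO.of_bound 1 (eventually_atTop.2 ⟨K₀, fun k hk => ?_⟩)
    have := hcon (k + 1) (by omega)
    simp only [Nat.add_sub_cancel] at this
    have hb : 0 ≤ binomCoeff α (k + 1) * (M (k + 1) + M k) :=
      mul_nonneg (binomCoeff_pos hα _).le (add_nonneg (h0 _) (h0 _))
    rw [Real.norm_of_nonneg (by positivity), Real.norm_of_nonneg hb, one_mul, mul_one_div,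
      div_le_iff₀ (by positivity)]
    linarith
  have hs3 : Summable fun k : ℕ => 1 / ((k + 1 : ℕ) : ℝ) := (summable_mul_left_iff hε.ne').1 hs2
  exact Real.not_summable_one_div_natCast ((summable_nat_add_iff 1).1 hs3)

/-- All gaps are nonnegative, so a single one is at most the whole sum; the boundary term disappears
along a subsequence. -/
lemma IsMomentSeq.momentGap_le {n : ℕ} {M : ℕ → ℝ} (hM : IsMomentSeq n M) {α : ℝ} (hα : 0 < α)
    {E E' : ℝ} (hE : HasSum (fun k => binomCoeff α k * M k) E)
    (hE' : HasSum (fun k => binomCoeff α k * M (k + 1)) E') (j : ℕ) :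
    binomCoeff α j * momentGap n M j ≤ (n - α) * E' - α * E := by
  have hT : HasSum (fun k => binomCoeff α k * ((n - α) * M (k + 1) - α * M k))
      ((n - α) * E' - α * E) := by
    refine hasSum_of_eq (fun k => ?_) ((hE'.mul_left (n - α)).sub (hE.mul_left α))
    ring
  refine le_of_forall_pos_le_add fun ε hε => ?_
  have hlim := hT.tendsto_sum_nat
  obtain ⟨K₁, hK₁⟩ := eventually_atTop.1 (hlim.eventually_lt_const
    (show (n - α) * E' - α * E < (n - α) * E' - α * E + ε / 2 by linarith))
  obtain ⟨K, hK, hlt⟩ := exists_boundary_lt hα hM.nonneg hE.summable (half_pos hε)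
    (max K₁ (j + 1))
  have h1 := hK₁ K (le_trans (le_max_left _ _) hK)
  have h2 := sum_momentGap (n := n) α M K
  have h3 : binomCoeff α j * momentGap n M j ≤
      ∑ k ∈ Finset.range K, binomCoeff α k * momentGap n M k :=
    Finset.single_le_sum (f := fun k => binomCoeff α k * momentGap n M k)
      (fun k _ => mul_nonneg (binomCoeff_pos hα k).le (hM.momentGap_nonneg k))
      (Finset.mem_range.2 (by have := le_trans (le_max_right _ _) hK; omega))
  linarith

/-- The deficit bounds each gap, and `(n+k) M_{k+1}` is the gap plus `k M_{k-1}`. Induction in steps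
of two starts from `M 0 = 0` and from the gap of index 0, which is `n M_1`. -/
lemma exists_moment_bound {n : ℕ} (hn : 0 < n) {α : ℝ} (hα : 0 < α) (k : ℕ) :
    ∃ A : ℝ, 0 ≤ A ∧ ∀ (M : ℕ → ℝ) (E E' : ℝ), IsMomentSeq n M → M 0 = 0 →
      HasSum (fun k => binomCoeff α k * M k) E →
      HasSum (fun k => binomCoeff α k * M (k + 1)) E' → M k ≤ A * ((n - α) * E' - α * E) := by
  have hn' : (0 : ℝ) < n := by exact_mod_cast hn
  induction k using Nat.twoStepInduction with
  | zero => exact ⟨0, le_rfl, fun M E E' _ h0 _ _ => by simp [h0]⟩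
  | one =>
    refine ⟨1 / n, by positivity, fun M E E' hM h0 hE hE' => ?_⟩
    have := hM.momentGap_le hα hE hE' 0
    simp only [binomCoeff, momentGap, Nat.cast_zero, add_zero, one_mul, zero_mul, sub_zero,
      zero_add] at this
    rw [one_div, ← div_eq_inv_mul, le_div_iff₀ hn']
    linarith
  | more k ih _ =>
    obtain ⟨A, hA, h⟩ := ih
    have hb := binomCoeff_pos hα (k + 1)
    refine ⟨(1 / binomCoeff α (k + 1) + (k + 1) * A) / (n + (k + 1)), by positivity,
      fun M E E' hM h0 hE hE' => ?_⟩
    have h1 := h M E E' hM h0 hE hE'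
    have h2 := hM.momentGap_le hα hE hE' (k + 1)
    simp only [momentGap, Nat.add_sub_cancel] at h2
    push_cast at h2
    rw [mul_comm, ← le_div_iff₀ hb] at h2
    rw [div_mul_eq_mul_div, le_div_iff₀ (by positivity)]
    have h3 : (k + 1 : ℝ) * M k ≤ (k + 1) * (A * ((n - α) * E' - α * E)) :=
      mul_le_mul_of_nonneg_left h1 (by positivity)
    calc M (k + 1 + 1) * (n + (k + 1)) ≤ ((n - α) * E' - α * E) / binomCoeff α (k + 1)
          + (k + 1) * M k := by linarith
      _ ≤ _ := by
        refine (add_le_add_right h3 _).trans_eq ?_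
        ring

/-- The constants of `exists_moment_bound` depend on `k` and need not be summable against `b_k`.
They are used for finitely many `k` only. In the tail the deficit dominates term by term, since
`b_{k+1}/b_k → 1` and `n - α > α`. -/
lemma exists_tsum_moment_bound {n : ℕ} {α : ℝ} (hα : 0 < α) (hαn : 2 * α < n) :
    ∃ A : ℝ, 0 ≤ A ∧ ∀ (M : ℕ → ℝ) (E E' : ℝ), IsMomentSeq n M → M 0 = 0 →
      HasSum (fun k => binomCoeff α k * M k) E →
      HasSum (fun k => binomCoeff α k * M (k + 1)) E' → E ≤ A * ((n - α) * E' - α * E) := by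
  have hn : 0 < n := by
    rcases Nat.eq_zero_or_pos n with h | h
    · subst h; norm_num at hαn; linarith
    · exact h
  choose A hA h using exists_moment_bound hn hα
  -- Half of the room in `n - α = α + 2s`: one `s` absorbs the ratio of consecutive coefficients,
  -- the other remains as the coercivity constant of the tail.
  set s : ℝ := (n - 2 * α) / 2 with hs
  have hs0 : 0 < s := by rw [hs]; linarith
  obtain ⟨J, hJ⟩ := exists_nat_ge ((α + s) * α / s)
  set e : ℕ → ℝ := fun k => (n - α) * binomCoeff α k - α * binomCoeff α (k + 1)
  set d : ℕ → ℝ := fun k => |e k| + s * binomCoeff α (k + 1)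
  have hd : ∀ k, 0 ≤ d k := fun k =>
    add_nonneg (abs_nonneg _) (mul_nonneg hs0.le (binomCoeff_pos hα _).le)
  have hlarge : ∀ k, J ≤ k → s * binomCoeff α (k + 1) ≤ e k := by
    intro k hk
    have hk' : (α + s) * α ≤ s * k := by
      have : (J : ℝ) ≤ k := by exact_mod_cast hk
      have := hJ.trans this
      rwa [div_le_iff₀ hs0, mul_comm (k : ℝ)] at this
    have hb := binomCoeff_pos hα k
    have h1 := binomCoeff_succ α k
    suffices (α + s) * ((k + 1) * binomCoeff α (k + 1)) ≤ (k + 1) * ((n - α) * binomCoeff α k) by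
      have h2 : (k + 1 : ℝ) * ((α + s) * binomCoeff α (k + 1)) ≤
          (k + 1) * ((n - α) * binomCoeff α k) := by linarith
      have := le_of_mul_le_mul_left h2 (by positivity)
      simp only [e]
      linarith
    rw [h1, ← mul_assoc, ← mul_assoc]
    refine mul_le_mul_of_nonneg_right ?_ hb.le
    have : (n : ℝ) - α = α + 2 * s := by rw [hs]; ring
    rw [this]
    nlinarith
  refine ⟨(1 + ∑ k ∈ Finset.range J, d k * A (k + 1)) / s, div_nonneg (add_nonneg zero_le_one
    (Finset.sum_nonneg fun k _ => mul_nonneg (hd k) (hA _))) hs0.le, fun M E E' hM h0 hE hE' => ?_⟩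
  set T := (n - α) * E' - α * E with hT
  have hE1 : HasSum (fun k => binomCoeff α (k + 1) * M (k + 1)) E := by
    have := (hasSum_nat_add_iff' (f := fun k => binomCoeff α k * M k) 1).2 hE
    simpa [h0] using this
  -- Because `M 0 = 0`, the series of `E` may be shifted by one and paired with that of `E'` moment
  -- by moment.
  have hTs : HasSum (fun k => e k * M (k + 1)) T := by
    refine hasSum_of_eq (fun k => ?_) ((hE'.mul_left (n - α)).sub (hE1.mul_left α))
    simp only [e]
    ring
  have hfin : HasSum (fun k => if k ∈ Finset.range J then d k * M (k + 1) else 0)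
      (∑ k ∈ Finset.range J, d k * M (k + 1)) := by
    have := hasSum_sum_of_ne_finset_zero (L := .unconditional ℕ) (s := Finset.range J)
      (f := fun k => if k ∈ Finset.range J then d k * M (k + 1) else 0)
      (fun b hb => if_neg hb)
    rwa [Finset.sum_congr rfl (fun k hk => if_pos hk)] at this
  have hle : s * E ≤ T + ∑ k ∈ Finset.range J, d k * M (k + 1) := by
    refine hasSum_le (fun k => ?_) (hE1.mul_left s) (hTs.add hfin)
    have hMk := hM.nonneg (k + 1)
    by_cases hk : k ∈ Finset.range J
    · simp only [hk, if_true]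
      rw [← mul_assoc, ← add_mul]
      refine mul_le_mul_of_nonneg_right ?_ hMk
      have := neg_abs_le (e k)
      simp only [d]
      linarith
    · simp only [hk, if_false, add_zero]
      rw [← mul_assoc]
      exact mul_le_mul_of_nonneg_right (hlarge k (by simpa using hk)) hMk
  have hle2 : ∑ k ∈ Finset.range J, d k * M (k + 1) ≤
      (∑ k ∈ Finset.range J, d k * A (k + 1)) * T := by
    rw [Finset.sum_mul]
    refine Finset.sum_le_sum fun k _ => ?_
    rw [mul_assoc]
    exact mul_le_mul_of_nonneg_left (h (k + 1) M E E' hM h0 hE hE') (hd k)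
  rw [div_mul_eq_mul_div, le_div_iff₀ hs0]
  linarith

/-- The moments of the normalized uniform measure of the unit sphere of `ℝ^(n+1)`. -/
noncomputable def uniformMoment (n : ℕ) : ℕ → ℝ
  | 0 => 1
  | 1 => 0
  | k + 2 => (k + 1) / (n + 1 + k) * uniformMoment n k

lemma uniformMoment_nonneg (n k : ℕ) : 0 ≤ uniformMoment n k := by
  induction k using Nat.twoStepInduction with
  | zero => simp [uniformMoment]
  | one => simp [uniformMoment]
  | more k ih _ => rw [uniformMoment]; positivity

/-- The uniform moments satisfy the recurrence with equality, so subtracting the contribution of the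
mean preserves it. The recurrence then propagates nonnegativity from the indices 0 and 1. -/
lemma IsMomentSeq.sub_uniformMoment {n : ℕ} {M : ℕ → ℝ} (hM : IsMomentSeq n M) :
    IsMomentSeq n fun k => M k - uniformMoment n k * M 0 := by
  have hrec : ∀ k : ℕ, (k + 1 : ℝ) * (M k - uniformMoment n k * M 0) ≤
      (n + 1 + k) * (M (k + 2) - uniformMoment n (k + 2) * M 0) := by
    intro k
    have h1 := hM.recurrence k
    have h2 : (n + 1 + k : ℝ) * uniformMoment n (k + 2) = (k + 1) * uniformMoment n k := by
      rw [uniformMoment]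
      field_simp
    linear_combination h1 + M 0 * h2
  refine ⟨fun k => ?_, hrec⟩
  induction k using Nat.twoStepInduction with
  | zero => simp [uniformMoment]
  | one => simpa [uniformMoment] using hM.nonneg 1
  | more k ih _ =>
    have := (mul_nonneg (by positivity) ih).trans (hrec k)
    exact nonneg_of_mul_nonneg_right this (by positivity)

/-- The mean of `(1 - r)^(-α)` over the unit sphere of `ℝ^(n+1)`, where `r` is a coordinate. -/
noncomputable def uniformEnergy (n : ℕ) (α : ℝ) : ℝ :=
  ∑' k, binomCoeff α k * uniformMoment n k

lemma uniformEnergy_nonneg (n : ℕ) {α : ℝ} (hα : 0 < α) : 0 ≤ uniformEnergy n α :=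
  tsum_nonneg fun k => mul_nonneg (binomCoeff_pos hα k).le (uniformMoment_nonneg n k)

/-- `uniformEnergy` is a `tsum` whose convergence has not been shown. If `M 0 ≠ 0` it converges by
comparison with `E`; if `M 0 = 0` its value does not matter. -/
lemma hasSum_sub_uniformMoment {n : ℕ} {M : ℕ → ℝ} (hM : IsMomentSeq n M) {α : ℝ} (hα : 0 < α)
    {E : ℝ} (hE : HasSum (fun k => binomCoeff α k * M k) E) :
    HasSum (fun k => binomCoeff α k * (M k - uniformMoment n k * M 0))
      (E - uniformEnergy n α * M 0) := by
  have hs : Summable fun k => binomCoeff α k * uniformMoment n k * M 0 := by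
    refine Summable.of_nonneg_of_le (fun k => mul_nonneg (mul_nonneg (binomCoeff_pos hα k).le
      (uniformMoment_nonneg n k)) (hM.nonneg 0)) (fun k => ?_) hE.summable
    have := hM.sub_uniformMoment.nonneg k
    rw [mul_assoc]
    exact mul_le_mul_of_nonneg_left (by linarith) (binomCoeff_pos hα k).le
  have := hE.sub hs.hasSum
  rw [tsum_mul_right] at this
  refine hasSum_of_eq (fun k => ?_) this
  ring

lemma IsMomentSeq.uniformEnergy_le {n : ℕ} {M : ℕ → ℝ} (hM : IsMomentSeq n M) {α : ℝ}
    (hα : 0 < α) {E : ℝ} (hE : HasSum (fun k => binomCoeff α k * M k) E) :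
    uniformEnergy n α * M 0 ≤ E := by
  have := (hasSum_sub_uniformMoment hM hα hE).nonneg fun k =>
    mul_nonneg (binomCoeff_pos hα k).le (hM.sub_uniformMoment.nonneg k)
  linarith

lemma isMomentSeq_uniformMoment (n : ℕ) : IsMomentSeq n (uniformMoment n) := by
  refine ⟨uniformMoment_nonneg n, fun k => le_of_eq ?_⟩
  rw [uniformMoment]
  field_simp

/-- The case `M 0 = 0` is applied to `M` minus its uniform part. The deficit of the uniform sequence
is itself nonnegative, so restoring it only enlarges the right-hand side. -/
lemma exists_energy_bound {n : ℕ} {α : ℝ} (hα : 0 < α) (hαn : 2 * α < n) :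
    ∃ A : ℝ, 0 ≤ A ∧ ∀ (M : ℕ → ℝ) (E E' : ℝ), IsMomentSeq n M →
      HasSum (fun k => binomCoeff α k * M k) E →
      HasSum (fun k => binomCoeff α k * M (k + 1)) E' →
      E ≤ uniformEnergy n α * M 0 + A * ((n - α) * E' - α * E) := by
  obtain ⟨A, hA, h⟩ := exists_tsum_moment_bound hα hαn
  refine ⟨A, hA, fun M E E' hM hE hE' => ?_⟩
  by_cases h0 : M 0 = 0
  · simpa [h0] using h M E E' hM h0 hE hE'
  have hsub := hasSum_sub_uniformMoment hM hα hE
  have hs : Summable fun k => binomCoeff α k * uniformMoment n k := by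
    have := hE.summable.sub hsub.summable
    refine (summable_mul_right_iff h0).1 (this.congr fun k => ?_)
    ring
  have hm := isMomentSeq_uniformMoment n
  have hs' := summable_shift hα hm.nonneg hs
  have hT := hm.momentGap_le hα hs.hasSum hs'.hasSum 0
  have hgap := mul_nonneg (binomCoeff_pos hα 0).le (hm.momentGap_nonneg 0)
  have hsub' : HasSum (fun k => binomCoeff α k * (M (k + 1) - uniformMoment n (k + 1) * M 0))
      (E' - (∑' k, binomCoeff α k * uniformMoment n (k + 1)) * M 0) := by
    refine hasSum_of_eq (fun k => ?_) (hE'.sub (hs'.hasSum.mul_right (M 0)))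
    ring
  have key := h _ _ _ hM.sub_uniformMoment (by simp [uniformMoment]) hsub hsub'
  have h1 : A * (M 0 * ((n - α) * (∑' k, binomCoeff α k * uniformMoment n (k + 1)) -
      α * ∑' k, binomCoeff α k * uniformMoment n k)) ≥ 0 :=
    mul_nonneg hA (mul_nonneg (hM.nonneg 0) (hgap.trans hT))
  rw [uniformEnergy] at *
  linarith

end Series

end HLS
namespace HLS

/-! ### From moments to the energy with kernel `(1 - u·v)^(-α)`. -/

section SphereEnergy

/-- Abel's theorem for a series with nonnegative terms. -/
lemma hasSum_of_tendsto_abel {a : ℕ → ℝ} (ha : ∀ k, 0 ≤ a k) {ρ : ℕ → ℝ} (h0 : ∀ i, 0 ≤ ρ i)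
    (h1 : ∀ i, ρ i ≤ 1) (hρ : Tendsto ρ atTop (𝓝 1)) {F : ℕ → ℝ} {L : ℝ}
    (hF : ∀ i, HasSum (fun k => a k * ρ i ^ k) (F i)) (hL : Tendsto F atTop (𝓝 L)) :
    HasSum a L := by
  have hsum : Summable a := by
    refine summable_of_sum_range_le (c := L) ha fun K => ?_
    have hl : Tendsto (fun i => ∑ k ∈ Finset.range K, a k * ρ i ^ k) atTop
        (𝓝 (∑ k ∈ Finset.range K, a k)) := by
      refine tendsto_finsetSum _ fun k _ => ?_
      simpa using (hρ.pow k).const_mul (a k)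
    refine le_of_tendsto_of_tendsto' hl hL fun i => ?_
    exact sum_le_hasSum _ (fun k _ => mul_nonneg (ha k) (pow_nonneg (h0 i) k)) (hF i)
  have ht : Tendsto (fun i => ∑' k, a k * ρ i ^ k) atTop (𝓝 (∑' k, a k)) := by
    refine tendsto_tsum_of_dominated_convergence hsum (fun k => ?_)
      (Eventually.of_forall fun i k => ?_)
    · simpa using (hρ.pow k).const_mul (a k)
    · rw [Real.norm_of_nonneg (mul_nonneg (ha k) (pow_nonneg (h0 i) k))]
      exact mul_le_of_le_one_right (ha k) (pow_le_one₀ (h0 i) (h1 i))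
  have : F = fun i => ∑' k, a k * ρ i ^ k := funext fun i => (hF i).tsum_eq.symm
  rw [this] at hL
  rw [tendsto_nhds_unique hL ht]
  exact hsum.hasSum

variable {Ω : Type*} [MeasurableSpace Ω] (μ : Measure Ω)
variable {N : ℕ} {H : Ω → ℝ} {u : Ω → Fin N → ℝ}

/-- The domination needed for Abel summation: `1 - ρ r ≥ (1-r)/2`, uniformly in `ρ`. -/
lemma one_sub_mul_rpow_le {α r ρ : ℝ} (hα : 0 < α) (hr : r < 1) (hr' : |r| ≤ 1) (h0 : 0 ≤ ρ)
    (h1 : ρ < 1) : (1 - ρ * r) ^ (-α) ≤ 2 ^ α * (1 - r) ^ (-α) := by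
  have hlow := (abs_le.1 hr').1
  have h2 : (1 - r) / 2 ≤ 1 - ρ * r := by nlinarith
  calc (1 - ρ * r) ^ (-α) ≤ ((1 - r) / 2) ^ (-α) :=
        Real.rpow_le_rpow_of_nonpos (by linarith) h2 (by linarith)
    _ = _ := by
        rw [Real.div_rpow (by linarith) (by norm_num), Real.rpow_neg (by norm_num : (0:ℝ) ≤ 2)]
        field_simp

/-- Expansion of the energy `∬ H(x) H(y) r^j (1 - r)^(-α)`, `r = u(x)·u(y)`, in moments. -/
lemma hasSum_sphereMoment [SFinite μ] (hH : Integrable H μ) (hu : Measurable u)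
    (h1 : ∀ x, u x ⬝ᵥ u x = 1) {α : ℝ} (hα : 0 < α)
    (hr : ∀ᵐ z ∂μ.prod μ, u z.1 ⬝ᵥ u z.2 < 1)
    (hE : Integrable (fun z : Ω × Ω => H z.1 * H z.2 * (1 - u z.1 ⬝ᵥ u z.2) ^ (-α)) (μ.prod μ))
    (j : ℕ) :
    HasSum (fun k => binomCoeff α k * sphereMoment μ H u (k + j))
      (∫ z : Ω × Ω, H z.1 * H z.2 * (u z.1 ⬝ᵥ u z.2) ^ j * (1 - u z.1 ⬝ᵥ u z.2) ^ (-α)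
        ∂(μ.prod μ)) := by
  have hrm := measurable_dotProduct hu
  -- The function `H` may change sign, so sum and integral cannot be exchanged directly. For `ρ < 1`
  -- the exchange is absolutely convergent, and Abel's theorem applies in the limit because the
  -- moments, unlike the integrands, are nonnegative.
  set ρ : ℕ → ℝ := fun i => 1 - 1 / ((i : ℝ) + 1) with hρ
  have hρ0 : ∀ i, 0 ≤ ρ i := fun i => by
    simp only [hρ, sub_nonneg]
    rw [div_le_one (by positivity)]
    linarith [(Nat.cast_nonneg i : (0:ℝ) ≤ i)]
  have hρ1 : ∀ i, ρ i < 1 := fun i => by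
    simp only [hρ]
    have : 0 < 1 / ((i : ℝ) + 1) := by positivity
    linarith
  have hρl : Tendsto ρ atTop (𝓝 1) := by
    simpa [hρ] using (tendsto_one_div_add_atTop_nhds_zero_nat (𝕜 := ℝ)).const_sub 1
  have habs : ∀ z : Ω × Ω, |u z.1 ⬝ᵥ u z.2| ≤ 1 := fun z =>
    abs_dotProduct_le_one (h1 _) (h1 _)
  refine hasSum_of_tendsto_abel (ρ := ρ) (F := fun i => ∫ z : Ω × Ω, H z.1 * H z.2 *
    (u z.1 ⬝ᵥ u z.2) ^ j * (1 - ρ i * (u z.1 ⬝ᵥ u z.2)) ^ (-α) ∂(μ.prod μ))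
    (fun k => mul_nonneg (binomCoeff_pos hα k).le (sphereMoment_nonneg μ hH hu h1 _)) hρ0
    (fun i => (hρ1 i).le) hρl (fun i => ?_) ?_
  · have hρabs : |ρ i| < 1 := by rw [abs_of_nonneg (hρ0 i)]; exact hρ1 i
    have hint : ∀ k : ℕ, Integrable (fun z : Ω × Ω => binomCoeff α k * ρ i ^ k *
        (H z.1 * H z.2 * (u z.1 ⬝ᵥ u z.2) ^ (k + j))) (μ.prod μ) := fun k =>
      (integrable_moment μ hH hu h1 (k + j)).const_mul _
    have hsum : Summable fun k : ℕ => ∫ z : Ω × Ω, ‖binomCoeff α k * ρ i ^ k *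
        (H z.1 * H z.2 * (u z.1 ⬝ᵥ u z.2) ^ (k + j))‖ ∂(μ.prod μ) := by
      refine Summable.of_nonneg_of_le (fun k => integral_nonneg fun z => norm_nonneg _)
        (fun k => ?_) ((hasSum_binomCoeff α hρabs).summable.mul_right
          (∫ z : Ω × Ω, ‖H z.1 * H z.2‖ ∂(μ.prod μ)))
      rw [← integral_const_mul]
      refine integral_mono (hint k).norm ((hH.mul_prod hH).norm.const_mul _) fun z => ?_
      have hb : 0 ≤ binomCoeff α k * ρ i ^ k :=
        mul_nonneg (binomCoeff_pos hα k).le (pow_nonneg (hρ0 i) k)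
      simp only [norm_mul (binomCoeff α k * ρ i ^ k), Real.norm_of_nonneg hb]
      refine mul_le_mul_of_nonneg_left ?_ hb
      rw [norm_mul, norm_pow]
      exact mul_le_of_le_one_right (norm_nonneg _) (pow_le_one₀ (norm_nonneg _) (habs z))
    have := hasSum_integral_of_summable_integral_norm hint hsum
    have hval : ∀ k : ℕ, ∫ z : Ω × Ω, binomCoeff α k * ρ i ^ k *
        (H z.1 * H z.2 * (u z.1 ⬝ᵥ u z.2) ^ (k + j)) ∂(μ.prod μ) =
        binomCoeff α k * sphereMoment μ H u (k + j) * ρ i ^ k := fun k => by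
      rw [integral_const_mul, sphereMoment]; ring
    simp only [hval] at this
    suffices hI : ∫ z : Ω × Ω, H z.1 * H z.2 * (u z.1 ⬝ᵥ u z.2) ^ j *
        (1 - ρ i * (u z.1 ⬝ᵥ u z.2)) ^ (-α) ∂(μ.prod μ) = ∫ z : Ω × Ω, ∑' k, binomCoeff α k *
          ρ i ^ k * (H z.1 * H z.2 * (u z.1 ⬝ᵥ u z.2) ^ (k + j)) ∂(μ.prod μ) by rwa [hI]
    refine integral_congr_ae (Eventually.of_forall fun z => ?_)
    have hlt : |ρ i * (u z.1 ⬝ᵥ u z.2)| < 1 := by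
      rw [abs_mul]
      exact mul_lt_one_of_nonneg_of_lt_one_left (abs_nonneg _) hρabs (habs z)
    have hs := ((hasSum_binomCoeff α hlt).mul_left
      (H z.1 * H z.2 * (u z.1 ⬝ᵥ u z.2) ^ j)).tsum_eq
    simp only
    rw [← hs]
    refine tsum_congr fun k => ?_
    rw [mul_pow, pow_add]
    ring
  · refine tendsto_integral_of_dominated_convergence
      (fun z => 2 ^ α * ‖H z.1 * H z.2 * (1 - u z.1 ⬝ᵥ u z.2) ^ (-α)‖) (fun i => ?_)
      (hE.norm.const_mul _) (fun i => ?_) ?_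
    · refine ((hH.mul_prod hH).aestronglyMeasurable.mul
        (hrm.pow_const j).aestronglyMeasurable).mul ?_
      exact ((measurable_const.sub (hrm.const_mul _)).pow_const _).aestronglyMeasurable
    · filter_upwards [hr] with z hz
      have e1 := one_sub_mul_rpow_le hα hz (habs z) (hρ0 i) (hρ1 i)
      have e2 : 0 ≤ 1 - ρ i * (u z.1 ⬝ᵥ u z.2) := by nlinarith [hρ0 i, hρ1 i, habs z, abs_le.1 (habs z)]
      rw [norm_mul, norm_mul _ ((_ : ℝ) ^ (-α)), norm_mul _ ((_ : ℝ) ^ j), norm_pow,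
        Real.norm_of_nonneg (Real.rpow_nonneg e2 _),
        Real.norm_of_nonneg (Real.rpow_nonneg (sub_nonneg.2 hz.le) _)]
      have e3 : ‖u z.1 ⬝ᵥ u z.2‖ ^ j ≤ 1 := pow_le_one₀ (norm_nonneg _) (habs z)
      calc ‖H z.1 * H z.2‖ * ‖u z.1 ⬝ᵥ u z.2‖ ^ j * (1 - ρ i * (u z.1 ⬝ᵥ u z.2)) ^ (-α)
          ≤ ‖H z.1 * H z.2‖ * 1 * (2 ^ α * (1 - u z.1 ⬝ᵥ u z.2) ^ (-α)) := by gcongr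
        _ = _ := by ring
    · filter_upwards [hr] with z hz
      refine Tendsto.const_mul _ ?_
      have : Tendsto (fun i => 1 - ρ i * (u z.1 ⬝ᵥ u z.2)) atTop (𝓝 (1 - 1 * (u z.1 ⬝ᵥ u z.2))) :=
        (hρl.mul_const _).const_sub 1
      rw [one_mul] at this
      exact this.rpow_const (Or.inl (sub_pos.2 hz).ne')

lemma isMomentSeq_sphereMoment [SFinite μ] {n : ℕ} {u : Ω → Fin (n + 1) → ℝ}
    (hH : Integrable H μ) (hu : Measurable u) (h1 : ∀ x, u x ⬝ᵥ u x = 1) :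
    IsMomentSeq n (sphereMoment μ H u) :=
  ⟨sphereMoment_nonneg μ hH hu h1, fun k => by
    simpa using sphereMoment_recurrence μ hH hu h1 k⟩

lemma uniformEnergy_mul_le [SFinite μ] {n : ℕ} {u : Ω → Fin (n + 1) → ℝ}
    (hH : Integrable H μ) (hu : Measurable u) (h1 : ∀ x, u x ⬝ᵥ u x = 1) {α : ℝ} (hα : 0 < α)
    (hr : ∀ᵐ z ∂μ.prod μ, u z.1 ⬝ᵥ u z.2 < 1)
    (hE : Integrable (fun z : Ω × Ω => H z.1 * H z.2 * (1 - u z.1 ⬝ᵥ u z.2) ^ (-α)) (μ.prod μ)) :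
    uniformEnergy n α * (∫ x, H x ∂μ) ^ 2 ≤
      ∫ z : Ω × Ω, H z.1 * H z.2 * (1 - u z.1 ⬝ᵥ u z.2) ^ (-α) ∂(μ.prod μ) := by
  have h := hasSum_sphereMoment μ hH hu h1 hα hr hE 0
  simp only [add_zero, pow_zero, mul_one] at h
  simpa [sphereMoment_zero] using (isMomentSeq_sphereMoment μ hH hu h1).uniformEnergy_le hα h

lemma exists_sphereEnergy_bound {n : ℕ} {α : ℝ} (hα : 0 < α) (hαn : 2 * α < n) :
    ∃ A : ℝ, 0 ≤ A ∧ ∀ {Ω : Type} [MeasurableSpace Ω] (μ : Measure Ω) [SFinite μ] {H : Ω → ℝ}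
      {u : Ω → Fin (n + 1) → ℝ}, Integrable H μ → Measurable u → (∀ x, u x ⬝ᵥ u x = 1) →
      (∀ᵐ z ∂μ.prod μ, u z.1 ⬝ᵥ u z.2 < 1) →
      Integrable (fun z : Ω × Ω => H z.1 * H z.2 * (1 - u z.1 ⬝ᵥ u z.2) ^ (-α)) (μ.prod μ) →
      ∫ z : Ω × Ω, H z.1 * H z.2 * (1 - u z.1 ⬝ᵥ u z.2) ^ (-α) ∂(μ.prod μ) ≤
        uniformEnergy n α * (∫ x, H x ∂μ) ^ 2 + A * ((n - α) *
          (∫ z : Ω × Ω, H z.1 * H z.2 * (u z.1 ⬝ᵥ u z.2) * (1 - u z.1 ⬝ᵥ u z.2) ^ (-α)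
            ∂(μ.prod μ)) -
          α * ∫ z : Ω × Ω, H z.1 * H z.2 * (1 - u z.1 ⬝ᵥ u z.2) ^ (-α) ∂(μ.prod μ)) := by
  obtain ⟨A, hA, h⟩ := exists_energy_bound hα hαn
  refine ⟨A, hA, fun {Ω} _ μ _ {H u} hH hu h1 hr hE => ?_⟩
  have e0 := hasSum_sphereMoment μ hH hu h1 hα hr hE 0
  have e1 := hasSum_sphereMoment μ hH hu h1 hα hr hE 1
  simp only [add_zero, pow_zero, mul_one] at e0
  simp only [pow_one] at e1
  have := h _ _ _ (isMomentSeq_sphereMoment μ hH hu h1) e0 e1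
  rwa [sphereMoment_zero] at this

end SphereEnergy

end HLS
namespace HLS

/-! ### A non-sharp Hardy-Littlewood-Sobolev inequality, for finiteness of the energies. -/

section Riesz

variable {n : ℕ}

local notation "V" => EuclideanSpace ℝ (Fin n)

lemma lintegral_comp_smul_pos {t : ℝ} (ht : 0 < t) (f : V → ENNReal) (hf : Measurable f) :
    ∫⁻ x, f x = ENNReal.ofReal (t ^ n) * ∫⁻ x, f (t • x) := by
  have h := Measure.map_addHaar_smul (volume : Measure V) ht.ne'
  have h2 : ∫⁻ x, f (t • x) = ∫⁻ x, f x ∂(Measure.map (t • ·) (volume : Measure V)) :=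
    (lintegral_map hf (measurable_const_smul t)).symm
  rw [h2, h, lintegral_smul_measure, smul_eq_mul, ← mul_assoc, ← ENNReal.ofReal_mul (by positivity)]
  simp only [finrank_euclideanSpace, Fintype.card_fin]
  rw [abs_of_pos (by positivity), mul_inv_cancel₀ (by positivity)]
  simp

lemma lintegral_homogeneous {γ : ℝ} (S : ℝ → Set ℝ) (hS : ∀ R, MeasurableSet (S R))
    (hS' : ∀ R t : ℝ, 0 < R → (R * t ∈ S R ↔ t ∈ S 1)) {R : ℝ} (hR : 0 < R) :
    ∫⁻ x : V, (S R).indicator (fun t => ENNReal.ofReal (t ^ (-γ))) ‖x‖ =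
      ENNReal.ofReal (R ^ (n - γ)) *
        ∫⁻ x : V, (S 1).indicator (fun t => ENNReal.ofReal (t ^ (-γ))) ‖x‖ := by
  have hm : ∀ R, Measurable fun x : V =>
      (S R).indicator (fun t => ENNReal.ofReal (t ^ (-γ))) ‖x‖ := fun R =>
    (Measurable.indicator (by fun_prop) (hS R)).comp measurable_norm
  rw [lintegral_comp_smul_pos hR _ (hm R)]
  have : ∀ x : V, (S R).indicator (fun t => ENNReal.ofReal (t ^ (-γ))) ‖R • x‖ =
      ENNReal.ofReal (R ^ (-γ)) * (S 1).indicator (fun t => ENNReal.ofReal (t ^ (-γ))) ‖x‖ := by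
    intro x
    rw [norm_smul, Real.norm_of_nonneg hR.le]
    by_cases hx : ‖x‖ ∈ S 1
    · rw [Set.indicator_of_mem hx, Set.indicator_of_mem ((hS' R _ hR).2 hx),
        Real.mul_rpow hR.le (norm_nonneg _), ENNReal.ofReal_mul (by positivity)]
    · rw [Set.indicator_of_notMem hx, Set.indicator_of_notMem (fun h => hx ((hS' R _ hR).1 h)),
        mul_zero]
  simp only [this]
  rw [lintegral_const_mul _ (hm 1), ← mul_assoc,
    ← ENNReal.ofReal_mul (by positivity), sub_eq_add_neg, Real.rpow_add hR, Real.rpow_natCast]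

lemma lintegral_norm_rpow_lt_top {γ : ℝ} (hn : 0 < n) (s : Set ℝ) (hs : MeasurableSet s)
    (hint : IntegrableOn (fun y : ℝ => y ^ (n - 1 - γ)) (s ∩ Set.Ioi 0)) :
    ∫⁻ x : V, s.indicator (fun t => ENNReal.ofReal (t ^ (-γ))) ‖x‖ < ⊤ := by
  have : Nonempty (Fin n) := ⟨⟨0, hn⟩⟩
  have h : Integrable (fun x : V => s.indicator (fun t => t ^ (-γ)) ‖x‖) := by
    rw [integrable_fun_norm_addHaar (volume : Measure V) (f := s.indicator (fun t => t ^ (-γ)))]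
    have h1 : IntegrableOn (s.indicator fun y : ℝ => y ^ (n - 1 - γ)) (Set.Ioi 0) := by
      rw [IntegrableOn, integrable_indicator_iff hs]
      rwa [IntegrableOn, Measure.restrict_restrict hs]
    refine h1.congr_fun (fun y hy => ?_) measurableSet_Ioi
    have hy' : (0 : ℝ) < y := hy
    simp only [finrank_euclideanSpace, Fintype.card_fin]
    by_cases hys : y ∈ s
    · rw [Set.indicator_of_mem hys, Set.indicator_of_mem hys, smul_eq_mul, ← Real.rpow_natCast, ← Real.rpow_add hy', Nat.cast_sub hn]
      push_cast
      ring_nf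
    · simp [hys]
  have h2 := h.lintegral_lt_top
  refine lt_of_le_of_lt (le_of_eq (lintegral_congr fun x => ?_)) h2
  by_cases hx : ‖x‖ ∈ s <;> simp [hx]

lemma exists_lintegral_ball (hn : 0 < n) {γ : ℝ} (hγ : γ < n) :
    ∃ C : ℝ, 0 ≤ C ∧ ∀ R : ℝ, 0 < R →
      ∫⁻ x : V, (Set.Iio R).indicator (fun t => ENNReal.ofReal (t ^ (-γ))) ‖x‖ =
        ENNReal.ofReal (C * R ^ (n - γ)) := by
  have hfin := lintegral_norm_rpow_lt_top (γ := γ) hn (Set.Iio 1) measurableSet_Iio (by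
    rw [Set.inter_comm, Set.Ioi_inter_Iio, intervalIntegral.integrableOn_Ioo_rpow_iff one_pos]
    linarith)
  refine ⟨(∫⁻ x : V, (Set.Iio 1).indicator (fun t => ENNReal.ofReal (t ^ (-γ))) ‖x‖).toReal,
    ENNReal.toReal_nonneg, fun R hR => ?_⟩
  rw [lintegral_homogeneous Set.Iio (fun _ => measurableSet_Iio) (fun R t hR => by
    simp only [Set.mem_Iio]; exact mul_lt_iff_lt_one_right hR) hR, mul_comm (ENNReal.toReal _),
    ENNReal.ofReal_mul (by positivity), ENNReal.ofReal_toReal hfin.ne]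

lemma exists_lintegral_compl_ball (hn : 0 < n) {γ : ℝ} (hγ : n < γ) :
    ∃ C : ℝ, 0 ≤ C ∧ ∀ R : ℝ, 0 < R →
      ∫⁻ x : V, (Set.Ici R).indicator (fun t => ENNReal.ofReal (t ^ (-γ))) ‖x‖ =
        ENNReal.ofReal (C * R ^ (n - γ)) := by
  have hfin := lintegral_norm_rpow_lt_top (γ := γ) hn (Set.Ici 1) measurableSet_Ici (by
    rw [Set.inter_eq_left.2 (Set.Ici_subset_Ioi.2 one_pos), integrableOn_Ici_iff_integrableOn_Ioi,
      integrableOn_Ioi_rpow_iff one_pos]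
    linarith)
  refine ⟨(∫⁻ x : V, (Set.Ici 1).indicator (fun t => ENNReal.ofReal (t ^ (-γ))) ‖x‖).toReal,
    ENNReal.toReal_nonneg, fun R hR => ?_⟩
  rw [lintegral_homogeneous Set.Ici (fun _ => measurableSet_Ici) (fun R t hR => by
    simp only [Set.mem_Ici]; exact le_mul_iff_one_le_right hR) hR, mul_comm (ENNReal.toReal _),
    ENNReal.ofReal_mul (by positivity), ENNReal.ofReal_toReal hfin.ne]

/-- The kernel `|x - y|^(-2α)` integrated against the part of `f` that lies below `σ`. -/
lemma exists_truncated_potential_bound (hn : 0 < n) {α : ℝ} (hα : 0 < α) (hαn : 2 * α < n) :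
    ∃ C : ℝ, 0 ≤ C ∧ ∀ f : V → ENNReal, Measurable f →
      ∫⁻ x, f x ^ (n / (n - α)) ≤ 1 → ∀ (x : V) (σ : ℝ), 0 < σ →
      ∫⁻ y, (if f y ≤ ENNReal.ofReal σ then f y * ENNReal.ofReal (‖x - y‖ ^ (-(2 * α))) else 0) ≤
        ENNReal.ofReal (C * σ ^ (α / (n - α))) := by
  have hn' : (0 : ℝ) < n := by exact_mod_cast hn
  have hβ : 0 < n - α := by linarith
  obtain ⟨C₁, hC₁, h₁⟩ := exists_lintegral_ball hn hαn
  obtain ⟨C₂, hC₂, h₂⟩ := exists_lintegral_compl_ball (γ := 2 * n) hn (by linarith)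
  refine ⟨C₁ + C₂ ^ (α / n), by positivity, fun f hf hf1 x σ hσ => ?_⟩
  -- This radius balances the near part, `σ R^(n-2α)`, where `f ≤ σ` is used, against the far part,
  -- `R^(-α)`, which comes from Hölder's inequality and `‖f‖_p ≤ 1`.
  set R : ℝ := σ ^ (-(1 / (n - α))) with hRdef
  have hR : 0 < R := by positivity
  have hk : Measurable fun t : ℝ => ENNReal.ofReal (t ^ (-(2 * α))) := by fun_prop
  have hsub : Measurable fun y : V => ‖x - y‖ := by fun_prop
  have hkn : Measurable fun y : V =>
      (Set.Iio R).indicator (fun t => ENNReal.ofReal (t ^ (-(2 * α)))) ‖x - y‖ :=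
    (hk.indicator measurableSet_Iio).comp hsub
  have hkf : Measurable fun y : V =>
      (Set.Ici R).indicator (fun t => ENNReal.ofReal (t ^ (-(2 * α)))) ‖x - y‖ :=
    (hk.indicator measurableSet_Ici).comp hsub
  have hpt : ∀ y, (if f y ≤ ENNReal.ofReal σ then f y * ENNReal.ofReal (‖x - y‖ ^ (-(2 * α)))
      else 0) ≤ ENNReal.ofReal σ *
        (Set.Iio R).indicator (fun t => ENNReal.ofReal (t ^ (-(2 * α)))) ‖x - y‖ +
      f y * (Set.Ici R).indicator (fun t => ENNReal.ofReal (t ^ (-(2 * α)))) ‖x - y‖ := by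
    intro y
    split_ifs with hy
    · rcases lt_or_ge ‖x - y‖ R with h | h
      · rw [Set.indicator_of_mem (show ‖x - y‖ ∈ Set.Iio R from h)]
        exact le_add_right (mul_le_mul_left hy _)
      · rw [Set.indicator_of_mem (show ‖x - y‖ ∈ Set.Ici R from h)]
        exact le_add_left le_rfl
    · exact zero_le
  have hnear : ∫⁻ y, ENNReal.ofReal σ *
      (Set.Iio R).indicator (fun t => ENNReal.ofReal (t ^ (-(2 * α)))) ‖x - y‖ =
      ENNReal.ofReal (C₁ * σ ^ (α / (n - α))) := by
    rw [lintegral_const_mul _ hkn, lintegral_sub_left_eq_self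
      (fun y => (Set.Iio R).indicator (fun t => ENNReal.ofReal (t ^ (-(2 * α)))) ‖y‖) x, h₁ R hR,
      ← ENNReal.ofReal_mul hσ.le]
    congr 1
    rw [hRdef, ← Real.rpow_mul hσ.le, mul_left_comm]
    congr 1
    nth_rewrite 1 [← Real.rpow_one σ]
    rw [← Real.rpow_add hσ]
    congr 1
    field_simp
    ring
  have hpq : Real.HolderConjugate (n / (n - α)) (n / α) := by
    refine Real.holderConjugate_iff.2 ⟨?_, ?_⟩
    · rw [one_lt_div hβ]; linarith
    · field_simp; ring
  have hfar : ∫⁻ y, f y * (Set.Ici R).indicator (fun t => ENNReal.ofReal (t ^ (-(2 * α)))) ‖x - y‖ ≤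
      ENNReal.ofReal (C₂ ^ (α / n) * σ ^ (α / (n - α))) := by
    refine (ENNReal.lintegral_mul_le_Lp_mul_Lq volume hpq hf.aemeasurable
      hkf.aemeasurable).trans ?_
    have e1 : (∫⁻ x, f x ^ (n / (n - α))) ^ (1 / (n / (n - α))) ≤ 1 :=
      ENNReal.rpow_le_one hf1 (by positivity)
    have e2 : ∫⁻ y, ((Set.Ici R).indicator (fun t => ENNReal.ofReal (t ^ (-(2 * α)))) ‖x - y‖) ^
        (n / α) = ENNReal.ofReal (C₂ * R ^ (n - 2 * n : ℝ)) := by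
      rw [← h₂ R hR, ← lintegral_sub_left_eq_self
        (fun y => (Set.Ici R).indicator (fun t => ENNReal.ofReal (t ^ (-(2 * n : ℝ)))) ‖y‖) x]
      refine lintegral_congr fun y => ?_
      by_cases hy : ‖x - y‖ ∈ Set.Ici R
      · rw [Set.indicator_of_mem hy, Set.indicator_of_mem hy, ENNReal.ofReal_rpow_of_nonneg
          (by positivity) (by positivity), ← Real.rpow_mul (norm_nonneg _)]
        congr 2
        field_simp
      · rw [Set.indicator_of_notMem hy, Set.indicator_of_notMem hy, ENNReal.zero_rpow_of_pos
          (by positivity)]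
    refine (mul_le_mul' e1 (le_of_eq (congrArg (· ^ (1 / (n / α))) e2))).trans ?_
    rw [one_mul, ENNReal.ofReal_rpow_of_nonneg (by positivity) (by positivity)]
    refine ENNReal.ofReal_le_ofReal (le_of_eq ?_)
    rw [Real.mul_rpow hC₂ (by positivity), one_div_div]
    congr 1
    rw [hRdef, ← Real.rpow_mul hσ.le, ← Real.rpow_mul hσ.le]
    congr 1
    field_simp
    ring
  calc _ ≤ _ := lintegral_mono hpt
    _ = _ := lintegral_add_left (measurable_const.mul hkn) _
    _ ≤ _ := add_le_add hnear.le hfar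
    _ = _ := by rw [← ENNReal.ofReal_add (by positivity) (by positivity), add_mul]

/-- The Hardy-Littlewood-Sobolev inequality with some constant. -/
lemma exists_hls_bound (hn : 0 < n) {α : ℝ} (hα : 0 < α) (hαn : 2 * α < n) :
    ∃ C : ℝ, 0 ≤ C ∧ ∀ f : V → ENNReal, Measurable f → ∫⁻ x, f x ^ (n / (n - α)) ≤ 1 →
      ∫⁻ x, ∫⁻ y, f x * f y * ENNReal.ofReal (‖x - y‖ ^ (-(2 * α))) ≤ ENNReal.ofReal C := by
  obtain ⟨C, hC, h⟩ := exists_truncated_potential_bound hn hα hαn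
  have hn' : (0 : ℝ) < n := by exact_mod_cast hn
  have hβ : 0 < n - α := by linarith
  refine ⟨2 * C, by positivity, fun f hf hf1 => ?_⟩
  -- By symmetry it suffices to integrate over `f y ≤ f x`. There the truncated bound with `σ = f x`
  -- makes the inner integral at most `C f(x)^(α/(n-α))`, and `1 + α/(n-α) = n/(n-α)`.
  set G : V → V → ENNReal := fun x y =>
    f x * (if f y ≤ f x then f y * ENNReal.ofReal (‖x - y‖ ^ (-(2 * α))) else 0) with hG
  have hGm : Measurable (Function.uncurry G) := by
    refine (hf.comp measurable_fst).mul (Measurable.ite (measurableSet_le (hf.comp measurable_snd)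
      (hf.comp measurable_fst)) ((hf.comp measurable_snd).mul ?_) measurable_const)
    fun_prop
  have hae : ∀ᵐ x, f x ^ (n / (n - α)) < ⊤ := ae_lt_top (hf.pow_const _)
    (ne_of_lt (lt_of_le_of_lt hf1 ENNReal.one_lt_top))
  have hGle : ∫⁻ x, ∫⁻ y, G x y ≤ ENNReal.ofReal C := by
    calc ∫⁻ x, ∫⁻ y, G x y ≤ ∫⁻ x, ENNReal.ofReal C * f x ^ (n / (n - α)) := by
          refine lintegral_mono_ae ?_
          filter_upwards [hae] with x hx
          have hxt : f x ≠ ⊤ := fun h0 => by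
            rw [h0, ENNReal.top_rpow_of_pos (by positivity)] at hx
            exact lt_irrefl _ hx
          by_cases hx0 : f x = 0
          · simp [hG, hx0]
          have hσ : 0 < (f x).toReal := ENNReal.toReal_pos hx0 hxt
          have hfx : ENNReal.ofReal (f x).toReal = f x := ENNReal.ofReal_toReal hxt
          have := h f hf hf1 x _ hσ
          rw [hfx] at this
          simp only [hG]
          rw [lintegral_const_mul' _ _ hxt]
          refine (mul_le_mul_right this _).trans (le_of_eq ?_)
          rw [ENNReal.ofReal_mul hC, ← ENNReal.ofReal_rpow_of_pos hσ, hfx, mul_left_comm]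
          congr 1
          nth_rewrite 1 [← ENNReal.rpow_one (f x)]
          rw [← ENNReal.rpow_add _ _ hx0 hxt]
          congr 1
          field_simp
          ring
      _ ≤ ENNReal.ofReal C * 1 := by
          rw [lintegral_const_mul _ (hf.pow_const _)]
          exact mul_le_mul_right hf1 _
      _ = _ := mul_one _
  have hpt : ∀ x y, f x * f y * ENNReal.ofReal (‖x - y‖ ^ (-(2 * α))) ≤ G x y + G y x := by
    intro x y
    rcases le_total (f y) (f x) with hxy | hxy
    · simp only [hG, if_pos hxy, mul_assoc]
      exact le_add_right le_rfl
    · simp only [hG, if_pos hxy, norm_sub_rev y x, mul_left_comm (f y), mul_assoc]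
      exact le_add_left le_rfl
  have hswap : ∫⁻ x, ∫⁻ y, G y x = ∫⁻ x, ∫⁻ y, G x y :=
    lintegral_lintegral_swap (f := fun x y => G y x) (hGm.comp measurable_swap).aemeasurable
  calc _ ≤ ∫⁻ x, ∫⁻ y, (G x y + G y x) := lintegral_mono fun x => lintegral_mono fun y => hpt x y
    _ = ∫⁻ x, ((∫⁻ y, G x y) + ∫⁻ y, G y x) := lintegral_congr fun x =>
        lintegral_add_left (hGm.of_uncurry_left) _
    _ = (∫⁻ x, ∫⁻ y, G x y) + ∫⁻ x, ∫⁻ y, G y x := lintegral_add_left hGm.lintegral_prod_right' _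
    _ ≤ ENNReal.ofReal C + ENNReal.ofReal C := by rw [hswap]; exact add_le_add hGle hGle
    _ = _ := by rw [← ENNReal.ofReal_add hC hC, two_mul]

end Riesz

end HLS
namespace HLS

/-! ### The composition of two Riesz kernels. -/

section Composition

variable {n : ℕ}

local notation "V" => EuclideanSpace ℝ (Fin n)

/-- The convolution of the kernel `|x|^(-a)` with itself. -/
noncomputable def kernelConv (n : ℕ) (a : ℝ) (v : EuclideanSpace ℝ (Fin n)) : ENNReal :=
  ∫⁻ x, ENNReal.ofReal (‖x‖ ^ (-a) * ‖x - v‖ ^ (-a))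

lemma lintegral_kernel_mul_kernel (a : ℝ) (y y' : V) :
    ∫⁻ x : V, ENNReal.ofReal (‖x - y‖ ^ (-a) * ‖x - y'‖ ^ (-a)) = kernelConv n a (y' - y) := by
  rw [kernelConv, ← lintegral_sub_right_eq_self
    (fun x : V => ENNReal.ofReal (‖x‖ ^ (-a) * ‖x - (y' - y)‖ ^ (-a))) y]
  simp only [sub_sub_sub_cancel_right]

lemma kernelConv_smul (a : ℝ) {t : ℝ} (ht : 0 < t) (v : V) :
    kernelConv n a (t • v) = ENNReal.ofReal (t ^ (n - 2 * a)) * kernelConv n a v := by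
  rw [kernelConv, lintegral_comp_smul_pos ht _ (by fun_prop), kernelConv]
  have : ∀ x : V, ENNReal.ofReal (‖t • x‖ ^ (-a) * ‖t • x - t • v‖ ^ (-a)) =
      ENNReal.ofReal (t ^ (-2 * a)) * ENNReal.ofReal (‖x‖ ^ (-a) * ‖x - v‖ ^ (-a)) := by
    intro x
    rw [← smul_sub, norm_smul, norm_smul, Real.norm_of_nonneg ht.le,
      Real.mul_rpow ht.le (norm_nonneg _), Real.mul_rpow ht.le (norm_nonneg _),
      ← ENNReal.ofReal_mul (by positivity), show -2 * a = -a + -a by ring, Real.rpow_add ht]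
    congr 1
    ring
  simp only [this]
  rw [lintegral_const_mul _ (by fun_prop), ← mul_assoc, ← ENNReal.ofReal_mul (by positivity),
    ← Real.rpow_natCast, ← Real.rpow_add ht]
  congr 3
  ring

/-- A reflection exchanges two vectors of equal norm. With homogeneity this determines the
convolution up to its value at one unit vector. -/
lemma kernelConv_eq_of_norm_eq (a : ℝ) {v w : V} (h : ‖v‖ = ‖w‖) :
    kernelConv n a v = kernelConv n a w := by
  set T := Submodule.reflection (ℝ ∙ (v - w))ᗮ with hT
  have hTv : T v = w := Submodule.reflection_sub h
  rw [kernelConv, kernelConv, ← T.measurePreserving.lintegral_comp_emb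
    T.toHomeomorph.measurableEmbedding (fun x : V => ENNReal.ofReal (‖x‖ ^ (-a) * ‖x - w‖ ^ (-a)))]
  refine lintegral_congr fun x => ?_
  rw [← hTv, ← map_sub, LinearIsometryEquiv.norm_map, LinearIsometryEquiv.norm_map]

/-- One of `‖x‖`, `‖x - v‖` is at least `1/2`. The singularities need `a < n`, the decay at infinity
`n < 2a`; the majorant `G` is evaluated at the smaller of the two norms. -/
lemma kernelConv_lt_top (hn : 0 < n) {a : ℝ} (han : a < n) (han' : n < 2 * a) {v : V}
    (hv : ‖v‖ = 1) : kernelConv n a v < ⊤ := by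
  obtain ⟨C₁, -, h₁⟩ := exists_lintegral_ball (n := n) hn han
  obtain ⟨C₂, -, h₂⟩ := exists_lintegral_compl_ball (n := n) hn han'
  have hm₁ : Measurable fun x : V =>
      (Set.Iio (1 / 2)).indicator (fun t : ℝ => ENNReal.ofReal (t ^ (-a))) ‖x‖ :=
    (Measurable.indicator (by fun_prop) measurableSet_Iio).comp measurable_norm
  have hm₂ : Measurable fun x : V =>
      (Set.Ici (1 / 2)).indicator (fun t : ℝ => ENNReal.ofReal (t ^ (-(2 * a)))) ‖x‖ :=
    (Measurable.indicator (by fun_prop) measurableSet_Ici).comp measurable_norm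
  set G : V → ENNReal := fun x => ENNReal.ofReal (2 ^ a) *
    (Set.Iio (1 / 2)).indicator (fun t : ℝ => ENNReal.ofReal (t ^ (-a))) ‖x‖ +
    (Set.Ici (1 / 2)).indicator (fun t : ℝ => ENNReal.ofReal (t ^ (-(2 * a)))) ‖x‖ with hG
  have hm₃ := hm₁.const_mul (ENNReal.ofReal (2 ^ a))
  have hGm : Measurable G := hm₃.add hm₂
  have hGfin : ∫⁻ x, G x < ⊤ := by
    simp only [hG]
    rw [lintegral_add_left hm₃, lintegral_const_mul _ hm₁,
      h₁ _ (by norm_num), h₂ _ (by norm_num)]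
    exact ENNReal.add_lt_top.2 ⟨ENNReal.mul_lt_top ENNReal.ofReal_lt_top ENNReal.ofReal_lt_top,
      ENNReal.ofReal_lt_top⟩
  have hhalf : ∀ t : ℝ, 1 / 2 ≤ t → t ^ (-a) ≤ 2 ^ a := by
    intro t ht
    calc t ^ (-a) ≤ (1 / 2) ^ (-a) :=
          Real.rpow_le_rpow_of_nonpos (by norm_num) ht (by linarith)
      _ = 2 ^ a := by rw [one_div, Real.inv_rpow (by norm_num), Real.rpow_neg (by norm_num), inv_inv]
  have hle : ∀ x y : V, 1 ≤ ‖x‖ + ‖y‖ → ENNReal.ofReal (‖x‖ ^ (-a) * ‖y‖ ^ (-a)) ≤ G x + G y := by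
    intro x y hxy
    wlog hle : ‖x‖ ≤ ‖y‖ generalizing x y with H
    · rw [mul_comm, add_comm]
      exact H y x (by linarith) (by linarith)
    have hy : 1 / 2 ≤ ‖y‖ := by linarith
    refine le_trans ?_ (le_add_right le_rfl)
    rcases lt_or_ge ‖x‖ (1 / 2) with hx | hx
    · simp only [hG]
      rw [Set.indicator_of_mem (show ‖x‖ ∈ Set.Iio (1 / 2) from hx), mul_comm,
        ENNReal.ofReal_mul (by positivity)]
      exact le_add_right (mul_le_mul_left (ENNReal.ofReal_le_ofReal (hhalf _ hy)) _)
    · simp only [hG]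
      rw [Set.indicator_of_mem (show ‖x‖ ∈ Set.Ici (1 / 2) from hx)]
      refine le_add_left (ENNReal.ofReal_le_ofReal ?_)
      have hx0 : 0 < ‖x‖ := by linarith
      rw [show -(2 * a) = -a + -a by ring, Real.rpow_add hx0]
      exact mul_le_mul_of_nonneg_left (Real.rpow_le_rpow_of_nonpos hx0 hle (by linarith))
        (by positivity)
  calc kernelConv n a v ≤ ∫⁻ x, (G x + G (x - v)) := by
        refine lintegral_mono fun x => hle x (x - v) ?_
        have := norm_sub_le x (x - v)
        rwa [sub_sub_cancel, hv] at this
    _ = (∫⁻ x, G x) + ∫⁻ x, G x := by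
        rw [lintegral_add_left hGm, lintegral_sub_right_eq_self]
    _ < ⊤ := ENNReal.add_lt_top.2 ⟨hGfin, hGfin⟩

lemma kernelConv_pos (a : ℝ) (v : V) (hn : 0 < n) : 0 < kernelConv n a v := by
  have : Nonempty (Fin n) := ⟨⟨0, hn⟩⟩
  rw [kernelConv, lintegral_pos_iff_support (by fun_prop)]
  refine lt_of_lt_of_le (b := volume (({0, v} : Set V)ᶜ)) ?_ (measure_mono fun x hx => ?_)
  · have : volume ({0, v} : Set V) = 0 := (Set.toFinite _).measure_zero _
    rw [measure_compl (Set.toFinite _).measurableSet (by simp [this]), this, tsub_zero]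
    simp
  · simp only [Set.mem_compl_iff, Set.mem_insert_iff, Set.mem_singleton_iff, not_or] at hx
    have h1 : 0 < ‖x‖ := norm_pos_iff.2 hx.1
    have h2 : 0 < ‖x - v‖ := norm_pos_iff.2 (sub_ne_zero.2 hx.2)
    simp only [Function.mem_support, ne_eq, ENNReal.ofReal_eq_zero, not_le]
    positivity

/-- The composition of two Riesz kernels is a Riesz kernel. -/
lemma exists_kernel_composition (hn : 0 < n) {a : ℝ} (han : a < n)
    (han' : n < 2 * a) :
    ∃ C : ℝ, 0 < C ∧ ∀ y y' : V, y ≠ y' →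
      Integrable (fun x : V => ‖x - y‖ ^ (-a) * ‖x - y'‖ ^ (-a)) ∧
      ∫ x : V, ‖x - y‖ ^ (-a) * ‖x - y'‖ ^ (-a) = C * ‖y - y'‖ ^ (n - 2 * a) := by
  have : Nonempty (Fin n) := ⟨⟨0, hn⟩⟩
  obtain ⟨e, he⟩ := exists_norm_eq V zero_le_one
  have hfin := kernelConv_lt_top hn han han' he
  refine ⟨(kernelConv n a e).toReal, ENNReal.toReal_pos (kernelConv_pos a e hn).ne' hfin.ne,
    fun y y' hyy => ?_⟩
  have hpos : 0 < ‖y - y'‖ := norm_pos_iff.2 (sub_ne_zero.2 hyy)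
  have hval : ∫⁻ x : V, ENNReal.ofReal (‖x - y‖ ^ (-a) * ‖x - y'‖ ^ (-a)) =
      ENNReal.ofReal (‖y - y'‖ ^ (n - 2 * a)) * kernelConv n a e := by
    rw [lintegral_kernel_mul_kernel, ← kernelConv_smul a hpos]
    refine kernelConv_eq_of_norm_eq a ?_
    rw [norm_smul, he, norm_norm, mul_one, norm_sub_rev]
  have hmeas : AEStronglyMeasurable (fun x : V => ‖x - y‖ ^ (-a) * ‖x - y'‖ ^ (-a)) volume :=
    Measurable.aestronglyMeasurable (by fun_prop)
  have hnn : 0 ≤ᵐ[volume] fun x : V => ‖x - y‖ ^ (-a) * ‖x - y'‖ ^ (-a) :=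
    Eventually.of_forall fun x => mul_nonneg (by positivity) (by positivity)
  refine ⟨(lintegral_ofReal_ne_top_iff_integrable hmeas hnn).1 ?_, ?_⟩
  · rw [hval]
    exact (ENNReal.mul_lt_top ENNReal.ofReal_lt_top hfin).ne
  · rw [integral_eq_lintegral_of_nonneg_ae hnn hmeas, hval, ENNReal.toReal_mul,
      ENNReal.toReal_ofReal (by positivity), mul_comm]

end Composition

/-! ### The energy as a bilinear form on `L^p`. -/

section Energy

variable {n : ℕ}

local notation "V" => EuclideanSpace ℝ (Fin n)

/-- The bilinear form `∬ f(x) g(y) |x - y|^(-2α)`. -/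
noncomputable def energy {n : ℕ} (α : ℝ) (f g : EuclideanSpace ℝ (Fin n) → ℝ) : ℝ :=
  ∫ z : EuclideanSpace ℝ (Fin n) × EuclideanSpace ℝ (Fin n),
    f z.1 * g z.2 * ‖z.1 - z.2‖ ^ (-(2 * α))

lemma energy_comm (α : ℝ) (f g : V → ℝ) : energy α f g = energy α g f := by
  rw [energy, Measure.volume_eq_prod, ← integral_prod_swap, energy, Measure.volume_eq_prod]
  refine integral_congr_ae (Eventually.of_forall fun z => ?_)
  simp only [Prod.fst_swap, Prod.snd_swap, norm_sub_rev z.2, mul_comm (f z.2)]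

lemma ae_fst_ne_snd (hn : 0 < n) : ∀ᵐ z : V × V, z.1 ≠ z.2 := by
  have : Nonempty (Fin n) := ⟨⟨0, hn⟩⟩
  rw [Measure.volume_eq_prod, ae_iff]
  simp only [not_not]
  refine Measure.measure_prod_null_of_ae_null
    (measurableSet_eq_fun measurable_fst measurable_snd) (Eventually.of_forall fun x => ?_)
  have : (Prod.mk x ⁻¹' {a : V × V | a.1 = a.2}) = {x} := by ext y; simp [eq_comm]
  simp [this]

/-- The bound is quadratic, so `f` is rescaled by `(I+1)^(-1/p)`, where the `+1` avoids a separate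
case `I = 0`. -/
lemma lintegral_energy_lt_top (hn : 0 < n) {α : ℝ} (hα : 0 < α) (hαn : 2 * α < n)
    {f : V → ENNReal} (hf : Measurable f) (hfin : ∫⁻ x, f x ^ (n / (n - α)) ≠ ⊤) :
    ∫⁻ x, ∫⁻ y, f x * f y * ENNReal.ofReal (‖x - y‖ ^ (-(2 * α))) < ⊤ := by
  obtain ⟨C, hC, h⟩ := exists_hls_bound (n := n) hn hα hαn
  have hβ : 0 < n - α := by linarith
  have hp : 0 < n / (n - α) := by have : (0:ℝ) < n := (by exact_mod_cast hn); positivity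
  set I := (∫⁻ x, f x ^ (n / (n - α))).toReal with hI
  have hI0 : 0 ≤ I := ENNReal.toReal_nonneg
  set t : ℝ := (I + 1) ^ (-(1 / (n / (n - α)))) with ht
  have ht0 : 0 < t := by positivity
  have key := h (fun x => ENNReal.ofReal t * f x) (measurable_const.mul hf) (by
    simp only [ENNReal.mul_rpow_of_nonneg _ _ hp.le]
    rw [lintegral_const_mul _ (hf.pow_const _), ENNReal.ofReal_rpow_of_pos ht0, ht,
      ← Real.rpow_mul (by positivity), neg_mul, one_div_mul_cancel hp.ne',
      ← ENNReal.ofReal_toReal hfin, ← ENNReal.ofReal_mul (by positivity), ENNReal.ofReal_le_one,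
      Real.rpow_neg_one, inv_mul_le_one₀ (by positivity)]
    linarith)
  have e : ∀ x y, ENNReal.ofReal t * f x * (ENNReal.ofReal t * f y) *
      ENNReal.ofReal (‖x - y‖ ^ (-(2 * α))) = ENNReal.ofReal (t * t) *
      (f x * f y * ENNReal.ofReal (‖x - y‖ ^ (-(2 * α)))) := by
    intro x y
    rw [ENNReal.ofReal_mul ht0.le]
    ring
  simp only [e] at key
  simp only [lintegral_const_mul' _ _ ENNReal.ofReal_ne_top] at key
  by_contra hcon
  rw [not_lt, top_le_iff] at hcon
  rw [hcon, ENNReal.mul_top (ENNReal.ofReal_pos.2 (mul_pos ht0 ht0)).ne'] at key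
  exact ENNReal.ofReal_ne_top (top_le_iff.1 key)

lemma integrable_energy_self (hn : 0 < n) {α : ℝ} (hα : 0 < α) (hαn : 2 * α < n) {f : V → ℝ}
    (hf : MemLp f (ENNReal.ofReal (n / (n - α)))) :
    Integrable fun z : V × V => f z.1 * f z.2 * ‖z.1 - z.2‖ ^ (-(2 * α)) := by
  wlog hm : Measurable f generalizing f with H
  · have hmk := hf.1.ae_eq_mk
    have := H (hf.ae_eq hmk) hf.1.measurable_mk
    refine this.congr ?_
    rw [Measure.volume_eq_prod]
    filter_upwards [Measure.quasiMeasurePreserving_fst.ae_eq_comp hmk,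
      Measure.quasiMeasurePreserving_snd.ae_eq_comp hmk] with z h1 h2
    simp only [Function.comp] at h1 h2
    rw [h1, h2]
  have hβ : 0 < n - α := by linarith
  have hp : 0 < n / (n - α) := by have : (0:ℝ) < n := (by exact_mod_cast hn); positivity
  have hmeas : Measurable fun z : V × V => f z.1 * f z.2 * ‖z.1 - z.2‖ ^ (-(2 * α)) := by fun_prop
  refine ⟨hmeas.aestronglyMeasurable, ?_⟩
  have h2 := lintegral_rpow_enorm_lt_top_of_eLpNorm_lt_top (by simpa using hp)
    ENNReal.ofReal_ne_top hf.2
  rw [ENNReal.toReal_ofReal hp.le] at h2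
  have := lintegral_energy_lt_top hn hα hαn hm.enorm h2.ne
  rw [hasFiniteIntegral_iff_enorm, Measure.volume_eq_prod, lintegral_prod _ hmeas.enorm.aemeasurable]
  refine lt_of_le_of_lt (le_of_eq ?_) this
  refine lintegral_congr fun x => lintegral_congr fun y => ?_
  rw [enorm_mul, enorm_mul, Real.enorm_of_nonneg (Real.rpow_nonneg (norm_nonneg (x - y)) _)]

/-- The mixed integrand is dominated by the diagonal one of `|f| + |g|`. -/
lemma integrable_energy (hn : 0 < n) {α : ℝ} (hα : 0 < α) (hαn : 2 * α < n) {f g : V → ℝ}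
    (hf : MemLp f (ENNReal.ofReal (n / (n - α)))) (hg : MemLp g (ENNReal.ofReal (n / (n - α)))) :
    Integrable fun z : V × V => f z.1 * g z.2 * ‖z.1 - z.2‖ ^ (-(2 * α)) := by
  have h := integrable_energy_self hn hα hαn (hf.norm.add hg.norm)
  refine h.mono' ?_ (Eventually.of_forall fun z => ?_)
  · refine AEStronglyMeasurable.mul (AEStronglyMeasurable.mul ?_ ?_)
      (Measurable.aestronglyMeasurable (by fun_prop))
    · exact hf.1.comp_quasiMeasurePreserving Measure.quasiMeasurePreserving_fst
    · exact hg.1.comp_quasiMeasurePreserving Measure.quasiMeasurePreserving_snd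
  · rw [norm_mul, norm_mul, Real.norm_of_nonneg (Real.rpow_nonneg (norm_nonneg _) _)]
    simp only [Pi.add_apply]
    gcongr
    · exact le_add_of_nonneg_right (norm_nonneg _)
    · exact le_add_of_nonneg_left (norm_nonneg _)

lemma exists_energy_le (hn : 0 < n) {α : ℝ} (hα : 0 < α) (hαn : 2 * α < n) :
    ∃ C : ℝ, 0 ≤ C ∧ ∀ f : V → ℝ, Measurable f → (∀ x, 0 ≤ f x) →
      Integrable (fun x => f x ^ (n / (n - α) : ℝ)) → ∫ x, f x ^ (n / (n - α) : ℝ) ≤ 1 →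
      energy α f f ≤ C := by
  obtain ⟨C, hC, h⟩ := exists_hls_bound (n := n) hn hα hαn
  have hβ : 0 < n - α := by linarith
  have hp : 0 < n / (n - α) := by have : (0:ℝ) < n := (by exact_mod_cast hn); positivity
  refine ⟨C, hC, fun f hf h0 hi hf1 => ?_⟩
  have key := h (fun x => ENNReal.ofReal (f x)) (by fun_prop) (by
    simp only [ENNReal.ofReal_rpow_of_nonneg (h0 _) hp.le]
    rw [← ofReal_integral_eq_lintegral_ofReal hi
      (Eventually.of_forall fun x => Real.rpow_nonneg (h0 x) _)]
    exact ENNReal.ofReal_le_one.2 hf1)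
  have hmeas : Measurable fun z : V × V => f z.1 * f z.2 * ‖z.1 - z.2‖ ^ (-(2 * α)) := by fun_prop
  have hnn : ∀ z : V × V, 0 ≤ f z.1 * f z.2 * ‖z.1 - z.2‖ ^ (-(2 * α)) := fun z =>
    mul_nonneg (mul_nonneg (h0 _) (h0 _)) (by positivity)
  rw [energy, integral_eq_lintegral_of_nonneg_ae (Eventually.of_forall hnn)
    hmeas.aestronglyMeasurable]
  refine ENNReal.toReal_le_of_le_ofReal hC ?_
  rw [Measure.volume_eq_prod, lintegral_prod _ hmeas.ennreal_ofReal.aemeasurable]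
  refine le_trans (le_of_eq ?_) key
  refine lintegral_congr fun x => lintegral_congr fun y => ?_
  rw [ENNReal.ofReal_mul (mul_nonneg (h0 _) (h0 _)), ENNReal.ofReal_mul (h0 _)]

lemma energy_add_left (hn : 0 < n) {α : ℝ} (hα : 0 < α) (hαn : 2 * α < n) {f g h : V → ℝ}
    (hf : MemLp f (ENNReal.ofReal (n / (n - α)))) (hg : MemLp g (ENNReal.ofReal (n / (n - α))))
    (hh : MemLp h (ENNReal.ofReal (n / (n - α)))) :
    energy α (f + g) h = energy α f h + energy α g h := by
  rw [energy, energy, energy, ← integral_add (integrable_energy hn hα hαn hf hh)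
    (integrable_energy hn hα hαn hg hh)]
  refine integral_congr_ae (Eventually.of_forall fun z => ?_)
  simp only [Pi.add_apply]
  ring

lemma energy_smul_left (α c : ℝ) (f h : V → ℝ) :
    energy α (c • f) h = c * energy α f h := by
  rw [energy, energy, ← integral_const_mul]
  refine integral_congr_ae (Eventually.of_forall fun z => ?_)
  simp only [Pi.smul_apply, smul_eq_mul]
  ring

lemma energy_add_smul_self (hn : 0 < n) {α : ℝ} (hα : 0 < α) (hαn : 2 * α < n) {f g : V → ℝ}
    (hf : MemLp f (ENNReal.ofReal (n / (n - α)))) (hg : MemLp g (ENNReal.ofReal (n / (n - α))))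
    (t : ℝ) :
    energy α (f + t • g) (f + t • g) =
      energy α f f + 2 * t * energy α f g + t ^ 2 * energy α g g := by
  have htg := hg.const_smul t
  have hs := hf.add htg
  rw [energy_add_left hn hα hαn hf htg hs, energy_smul_left, energy_comm α f,
    energy_comm α g, energy_add_left hn hα hαn hf htg hf, energy_add_left hn hα hαn hf htg hg,
    energy_smul_left, energy_smul_left, energy_comm α g f]
  ring

end Energy

/-! ### The negative Sobolev norm in terms of the energy. -/

section NegSobolev

variable {n : ℕ}

local notation "V" => EuclideanSpace ℝ (Fin n)

lemma hlsExponent_eq (n : ℕ) (s : ℝ) :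
    hlsExponent n s = ENNReal.ofReal (n / (n - (n / 2 - s))) := by
  rw [hlsExponent]
  congr 1
  rw [show (n : ℝ) - (n / 2 - s) = (n + 2 * s) / 2 by ring, div_div_eq_mul_div, mul_comm]

/-- Fubini in `(x, y, y')` and the composition of kernels with `a = n - s`. Positivity of the energy
form will follow, since the left-hand side is the integral of a square. -/
lemma exists_integral_potential_sq (hn : 0 < n) {s : ℝ} (hs : 0 < s) (hsn : s < (n : ℝ) / 2) :
    ∃ C : ℝ, 0 < C ∧ ∀ f : V → ℝ, MemLp f (hlsExponent n s) →
      Integrable (fun x : V => (∫ y, f y / ‖x - y‖ ^ ((n : ℝ) - s)) ^ 2) ∧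
      ∫ x : V, (∫ y, f y / ‖x - y‖ ^ ((n : ℝ) - s)) ^ 2 = C * energy (n / 2 - s) f f := by
  obtain ⟨C, hC, h⟩ := exists_kernel_composition (n := n) (a := n - s) hn
    (by linarith) (by linarith)
  refine ⟨C, hC, fun f hf => ?_⟩
  rw [hlsExponent_eq] at hf
  have hen := integrable_energy hn (α := n / 2 - s) (by linarith) (by linarith) hf hf
  set T : V × (V × V) → ℝ := fun q => f q.2.1 * f q.2.2 *
    (‖q.1 - q.2.1‖ ^ (-(n - s : ℝ)) * ‖q.1 - q.2.2‖ ^ (-(n - s : ℝ))) with hT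
  have hpow : (n : ℝ) - 2 * (n - s) = -(2 * (n / 2 - s)) := by ring
  have hTm : AEStronglyMeasurable T (volume.prod volume) := by
    refine AEStronglyMeasurable.mul ?_ (Measurable.aestronglyMeasurable (by fun_prop))
    have : AEStronglyMeasurable (fun z : V × V => f z.1 * f z.2) volume :=
      (hf.1.comp_quasiMeasurePreserving Measure.quasiMeasurePreserving_fst).mul
        (hf.1.comp_quasiMeasurePreserving Measure.quasiMeasurePreserving_snd)
    exact this.comp_quasiMeasurePreserving Measure.quasiMeasurePreserving_snd
  have hTi : Integrable T (volume.prod volume) := by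
    rw [integrable_prod_iff' hTm]
    constructor
    · filter_upwards [ae_fst_ne_snd hn] with w hw
      exact ((h w.1 w.2 hw).1).const_mul (f w.1 * f w.2)
    · refine (hen.norm.const_mul C).congr ?_
      filter_upwards [ae_fst_ne_snd hn] with w hw
      have h1 : ∀ x : V, ‖T (x, w)‖ = ‖f w.1 * f w.2‖ *
          (‖x - w.1‖ ^ (-(n - s : ℝ)) * ‖x - w.2‖ ^ (-(n - s : ℝ))) := by
        intro x
        simp only [hT]
        rw [norm_mul, Real.norm_of_nonneg (mul_nonneg (Real.rpow_nonneg (norm_nonneg _) _)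
          (Real.rpow_nonneg (norm_nonneg _) _))]
      simp only [h1]
      rw [integral_const_mul, (h w.1 w.2 hw).2, norm_mul, hpow,
        Real.norm_of_nonneg (Real.rpow_nonneg (norm_nonneg _) _)]
      ring
  -- This holds for every `x`: the product formula needs no integrability, thanks to the default
  -- value zero of the integral.
  have hsec : ∀ x : V, ∫ w, T (x, w) = (∫ y, f y / ‖x - y‖ ^ ((n : ℝ) - s)) ^ 2 := by
    intro x
    rw [sq, ← integral_prod_mul (μ := (volume : Measure V)) (ν := (volume : Measure V)),
      Measure.volume_eq_prod]
    refine integral_congr_ae (Eventually.of_forall fun w => ?_)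
    simp only [hT, div_eq_mul_inv, Real.rpow_neg (norm_nonneg _)]
    ring
  refine ⟨by simpa only [hsec] using hTi.integral_prod_left, ?_⟩
  calc ∫ x : V, (∫ y, f y / ‖x - y‖ ^ ((n : ℝ) - s)) ^ 2 = ∫ x : V, ∫ w, T (x, w) := by
        simp only [hsec]
    _ = ∫ w : V × V, ∫ x, T (x, w) := integral_integral_swap hTi
    _ = ∫ w : V × V, C * (f w.1 * f w.2 * ‖w.1 - w.2‖ ^ (-(2 * (n / 2 - s)))) := by
        refine integral_congr_ae ?_
        filter_upwards [ae_fst_ne_snd hn] with w hw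
        simp only [hT]
        rw [integral_const_mul, (h w.1 w.2 hw).2, hpow]
        ring
    _ = _ := by rw [integral_const_mul, energy]

lemma exists_negSobolevNorm_eq (hn : 0 < n) {s : ℝ} (hs : 0 < s) (hsn : s < (n : ℝ) / 2) :
    ∃ C : ℝ, 0 < C ∧ ∀ f : V → ℝ, MemLp f (hlsExponent n s) →
      0 ≤ energy (n / 2 - s) f f ∧
      negSobolevNorm n s f = ENNReal.ofReal (C * energy (n / 2 - s) f f) ^ (1 / 2 : ℝ) := by
  obtain ⟨C, hC, h⟩ := exists_integral_potential_sq (n := n) hn hs hsn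
  set c := Real.Gamma ((n - s) / 2) / ((2 : ℝ) ^ s * Real.pi ^ ((n : ℝ) / 2) * Real.Gamma (s / 2))
    with hc
  have hc0 : 0 < c := div_pos (Real.Gamma_pos_of_pos (by linarith))
    (mul_pos (by positivity) (Real.Gamma_pos_of_pos (by linarith)))
  refine ⟨c ^ 2 * C, by positivity, fun f hf => ?_⟩
  obtain ⟨hi, hval⟩ := h f hf
  have hnn : 0 ≤ energy (n / 2 - s) f f := by
    have : 0 ≤ C * energy (n / 2 - s) f f := by
      rw [← hval]
      exact integral_nonneg fun x => sq_nonneg _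
    exact nonneg_of_mul_nonneg_right this hC
  refine ⟨hnn, ?_⟩
  rw [negSobolevNorm, eLpNorm_eq_lintegral_rpow_enorm_toReal (by norm_num) (by norm_num)]
  simp only [ENNReal.toReal_ofNat]
  congr 1
  rw [mul_assoc, ← hval, ← integral_const_mul, ofReal_integral_eq_lintegral_ofReal
    (hi.const_mul _) (Eventually.of_forall fun x => by positivity)]
  refine lintegral_congr fun x => ?_
  rw [rieszPotential, ← hc, ← mul_pow, Real.enorm_eq_ofReal_abs,
    ENNReal.ofReal_rpow_of_nonneg (abs_nonneg _) (by norm_num), Real.rpow_two, sq_abs]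

end NegSobolev

end HLS
namespace HLS

/-! ### Stereographic frames and conformal centring. -/

section Frame

variable {n : ℕ}

local notation "V" => EuclideanSpace ℝ (Fin n)

/-- The conformal factor `(a² + |x - x₀|²) / a`, written with `a = exp τ`. -/
noncomputable def weight {n : ℕ} (x₀ : EuclideanSpace ℝ (Fin n)) (τ : ℝ)
    (x : EuclideanSpace ℝ (Fin n)) : ℝ :=
  Real.exp τ + Real.exp (-τ) * ‖x - x₀‖ ^ 2

/-- The inverse stereographic projection with centre `x₀` and scale `exp τ`. -/
noncomputable def stereo {n : ℕ} (x₀ : EuclideanSpace ℝ (Fin n)) (τ : ℝ)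
    (x : EuclideanSpace ℝ (Fin n)) : Fin (n + 1) → ℝ :=
  Fin.cons (2 * Real.exp τ / weight x₀ τ x - 1) fun i => 2 * (x - x₀) i / weight x₀ τ x

lemma exp_le_weight (x₀ : V) (τ : ℝ) (x : V) : Real.exp τ ≤ weight x₀ τ x :=
  le_add_of_nonneg_right (by positivity)

lemma weight_pos (x₀ : V) (τ : ℝ) (x : V) : 0 < weight x₀ τ x :=
  (Real.exp_pos τ).trans_le (exp_le_weight x₀ τ x)

lemma continuous_weight (x₀ : V) (τ : ℝ) : Continuous (weight x₀ τ) := by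
  unfold weight; fun_prop

/-- The chordal distance formula, which makes the Riesz kernel conformally covariant. -/
lemma stereo_dotProduct (x₀ : V) (τ : ℝ) (x y : V) :
    stereo x₀ τ x ⬝ᵥ stereo x₀ τ y =
      1 - 2 * ‖x - y‖ ^ 2 / (weight x₀ τ x * weight x₀ τ y) := by
  have hx := (weight_pos x₀ τ x).ne'
  have hy := (weight_pos x₀ τ y).ne'
  have hinner : ∑ i, (2 * (x - x₀) i / weight x₀ τ x) * (2 * (y - x₀) i / weight x₀ τ y) =
      2 * (‖x - x₀‖ ^ 2 + ‖y - x₀‖ ^ 2 - ‖x - y‖ ^ 2) / (weight x₀ τ x * weight x₀ τ y) := by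
    simp only [EuclideanSpace.real_norm_sq_eq]
    rw [← Finset.sum_add_distrib, ← Finset.sum_sub_distrib, Finset.mul_sum, Finset.sum_div]
    refine Finset.sum_congr rfl fun i _ => ?_
    simp only [PiLp.sub_apply]
    field_simp
    ring
  simp only [dotProduct, Fin.sum_univ_succ, stereo, Fin.cons_zero, Fin.cons_succ]
  rw [hinner]
  have he : Real.exp τ * Real.exp (-τ) = 1 := by rw [← Real.exp_add]; simp
  have h1 : Real.exp τ * weight x₀ τ x = Real.exp τ ^ 2 + ‖x - x₀‖ ^ 2 := by
    rw [weight]; linear_combination ‖x - x₀‖ ^ 2 * he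
  have h2 : Real.exp τ * weight x₀ τ y = Real.exp τ ^ 2 + ‖y - x₀‖ ^ 2 := by
    rw [weight]; linear_combination ‖y - x₀‖ ^ 2 * he
  field_simp
  linear_combination (-2) * h1 + (-2) * h2

lemma stereo_dotProduct_self (x₀ : V) (τ : ℝ) (x : V) :
    stereo x₀ τ x ⬝ᵥ stereo x₀ τ x = 1 := by
  rw [stereo_dotProduct]; simp

lemma measurable_stereo (x₀ : V) (τ : ℝ) : Measurable (stereo x₀ τ) := by
  have hw := (continuous_weight x₀ τ).measurable
  refine measurable_pi_lambda _ fun j => ?_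
  refine Fin.cases ?_ (fun i => ?_) j
  · simp only [stereo, Fin.cons_zero]
    fun_prop
  · simp only [stereo, Fin.cons_succ]
    have : Measurable fun x : V => (x - x₀) i := by
      simp only [PiLp.sub_apply]
      fun_prop
    fun_prop

lemma abs_stereo_le_one (x₀ : V) (τ : ℝ) (x : V) (j : Fin (n + 1)) : |stereo x₀ τ x j| ≤ 1 :=
  abs_coord_le_one (stereo_dotProduct_self x₀ τ x) j

lemma eq_zero_of_forall_mul_le {A B : ℝ} (hB : 0 ≤ B) (h : ∀ t : ℝ, t * A ≤ t ^ 2 * B) : A = 0 := by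
  have h1 := h (A / (B + 1))
  rw [div_pow, div_mul_eq_mul_div, div_mul_eq_mul_div, div_le_div_iff₀ (by positivity)
    (by positivity)] at h1
  have h2 : 0 ≤ A ^ 2 * (B + 1) := by positivity
  have h3 : A ^ 2 * (B + 1) ≤ 0 := by nlinarith
  have h4 : A ^ 2 * (B + 1) = 0 := le_antisymm h3 h2
  rcases mul_eq_zero.1 h4 with h5 | h5
  · exact pow_eq_zero_iff (two_ne_zero) |>.1 h5
  · linarith

/-- A compactly supported probability measure that charges small balls little can be centred by
a conformal map. -/
theorem exists_stereo_integral_eq_zero (ν : Measure V) [IsProbabilityMeasure ν] {R : ℝ}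
    (hR : ∀ᵐ x ∂ν, x ∈ Metric.closedBall (0 : V) R) {δ : ℝ} (hδ : 0 < δ) (hδ1 : δ ≤ 1)
    (hball : ∀ x : V, ν.real (Metric.ball x δ) ≤ 1 / 4) :
    ∃ (x₀ : V) (τ : ℝ), ∀ j, ∫ x, stereo x₀ τ x j ∂ν = 0 := by
  -- Centring is obtained variationally, without degree theory: the critical points of `ξ ↦ ∫ log
  -- weight` are the centred frames, and a minimum exists by coercivity.
  set ψ : V × ℝ → V → ℝ := fun ξ x => Real.log (weight ξ.1 ξ.2 x) with hψ
  have hψc : Continuous (Function.uncurry ψ) := by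
    simp only [hψ, Function.uncurry_def]
    refine Continuous.log ?_ fun q => (weight_pos _ _ _).ne'
    unfold weight
    fun_prop
  have hs : IsCompact (Metric.closedBall (0 : V) R) := isCompact_closedBall _ _
  have hνs : ν.restrict (Metric.closedBall (0 : V) R) = ν := Measure.restrict_eq_self_of_ae_mem hR
  set Φ : V × ℝ → ℝ := fun ξ => ∫ x, ψ ξ x ∂ν with hΦ
  have hΦc : Continuous Φ := by
    have := continuous_parametric_integral_of_continuous (μ := ν) hψc hs
    rwa [hνs] at this
  have hint : ∀ g : V → ℝ, Continuous g → Integrable g ν := fun g hg => by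
    have := hg.continuousOn.integrableOn_compact (μ := ν) hs
    rwa [IntegrableOn, hνs] at this
  have hψi : ∀ ξ, Integrable (ψ ξ) ν := fun ξ => hint _ (hψc.comp (by fun_prop : Continuous (Prod.mk ξ)))
  set c := Φ (0, 0) with hc
  have hge : ∀ ξ : V × ℝ, ξ.2 ≤ Φ ξ := fun ξ => by
    have : ∫ _x, ξ.2 ∂ν ≤ ∫ x, ψ ξ x ∂ν := by
      refine integral_mono (integrable_const _) (hψi ξ) fun x => ?_
      simp only [hψ]
      rw [Real.le_log_iff_exp_le (weight_pos _ _ _)]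
      exact exp_le_weight _ _ _
    simpa using this
  have hc0 : 0 ≤ c := hge (0, 0)
  have hlogδ : Real.log δ ≤ 0 := Real.log_nonpos hδ.le hδ1
  -- Off the ball of radius `δ` the integrand is at least `-τ + 2 log δ`, on it at least `τ`, and
  -- the ball has mass at most `1/4`. For negative `τ` below the threshold this gives `-τ/2 + (3/2)
  -- log δ`, which is at least `c` once `τ ≤ -T`.
  set T : ℝ := 2 * c - 3 * Real.log δ with hT
  have hcomp : IsCompact (Metric.closedBall (0 : V) (R + Real.exp c) ×ˢ Set.Icc (-T) T) :=
    (isCompact_closedBall _ _).prod isCompact_Icc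
  obtain ⟨⟨x₀, τ⟩, hmin⟩ := hΦc.exists_forall_le' (0, 0) (by
    filter_upwards [hcomp.compl_mem_cocompact] with ξ hξ
    rcases le_or_gt c ξ.2 with h1 | h1
    · exact h1.trans (hge ξ)
    rcases le_or_gt ξ.2 (-T) with h2 | h2
    · have hb := hball ξ.1
      set A := Metric.ball ξ.1 δ with hA
      have hAm : MeasurableSet A := Metric.isOpen_ball.measurableSet
      have hle : ∫ x, (-ξ.2 + 2 * Real.log δ + A.indicator
          (fun _ => 2 * ξ.2 - 2 * Real.log δ) x) ∂ν ≤ ∫ x, ψ ξ x ∂ν := by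
        refine integral_mono ((integrable_const _).add
          ((integrable_const _).indicator hAm)) (hψi ξ) fun x => ?_
        simp only [hψ]
        rw [Real.le_log_iff_exp_le (weight_pos _ _ _)]
        by_cases hx : x ∈ A
        · rw [Set.indicator_of_mem hx]
          refine le_trans (le_of_eq ?_) (exp_le_weight ξ.1 ξ.2 x)
          congr 1
          ring
        · rw [Set.indicator_of_notMem hx, add_zero, Real.exp_add, mul_comm 2, Real.exp_mul,
            Real.exp_log hδ, Real.rpow_two]
          refine le_add_of_nonneg_of_le (Real.exp_pos _).le ?_
          have : δ ≤ ‖x - ξ.1‖ := by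
            rw [← dist_eq_norm]
            exact not_lt.1 hx
          gcongr
      rw [integral_add (integrable_const _) ((integrable_const _).indicator hAm),
        integral_indicator_const _ hAm] at hle
      simp only [integral_const, probReal_univ, smul_eq_mul, one_mul] at hle
      have h3 : 2 * ξ.2 - 2 * Real.log δ ≤ 0 := by rw [hT] at h2; linarith
      have h4 := mul_le_mul_of_nonpos_right hb h3
      rw [hT] at h2
      linarith
    · have hx : R + Real.exp c < ‖ξ.1‖ := by
        by_contra hcon
        refine hξ ⟨by simpa using hcon, h2.le, ?_⟩
        rw [hT]; linarith
      have : ∫ _x, c ∂ν ≤ ∫ x, ψ ξ x ∂ν := by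
        refine integral_mono_ae (integrable_const _) (hψi ξ) ?_
        filter_upwards [hR] with x hxR
        rw [mem_closedBall_zero_iff] at hxR
        simp only [hψ]
        rw [Real.le_log_iff_exp_le (weight_pos _ _ _), weight]
        have hd : Real.exp c ≤ ‖x - ξ.1‖ := by
          have := norm_sub_norm_le ξ.1 x
          rw [norm_sub_rev] at this
          linarith
        have he : Real.exp ξ.2 * Real.exp (-ξ.2) = 1 := by rw [← Real.exp_add]; simp
        have e1 := Real.exp_pos ξ.2
        have e2 := Real.exp_pos (-ξ.2)
        have e3 := Real.exp_pos c
        have h5 : Real.exp c ^ 2 ≤ ‖x - ξ.1‖ ^ 2 := pow_le_pow_left₀ e3.le hd 2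
        have h6 := mul_le_mul_of_nonneg_left h5 e2.le
        have h7 : 0 ≤ Real.exp (-ξ.2) * (Real.exp ξ.2 - Real.exp c) ^ 2 := by positivity
        have h8 : Real.exp (-ξ.2) * (Real.exp ξ.2 - Real.exp c) ^ 2 =
            Real.exp ξ.2 - 2 * Real.exp c + Real.exp (-ξ.2) * Real.exp c ^ 2 := by
          linear_combination (Real.exp ξ.2 - 2 * Real.exp c) * he
        linarith
      simpa using this)
  refine ⟨x₀, τ, ?_⟩
  have hw := continuous_weight x₀ τ
  have hw0 : ∀ x, weight x₀ τ x ≠ 0 := fun x => (weight_pos _ _ _).ne'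
  -- The inequality `log q ≤ q - 1` replaces differentiation under the integral: the quotients of
  -- weights are explicit, and their first-order terms are the coordinates of the sphere.
  have hvar : ∀ ξ : V × ℝ, 0 ≤ ∫ x, (weight ξ.1 ξ.2 x / weight x₀ τ x - 1) ∂ν := fun ξ => by
    have hwξ := continuous_weight ξ.1 ξ.2
    have h1 : 0 ≤ ∫ x, (ψ ξ x - ψ (x₀, τ) x) ∂ν := by
      rw [integral_sub (hψi _) (hψi _)]
      exact sub_nonneg.2 (hmin ξ)
    refine h1.trans (integral_mono ((hψi _).sub (hψi _))
      (hint _ ((hwξ.div hw hw0).sub continuous_const)) fun x => ?_)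
    simp only [hψ]
    rw [← Real.log_div (weight_pos _ _ _).ne' (hw0 x)]
    exact Real.log_le_sub_one_of_pos (div_pos (weight_pos _ _ _) (weight_pos _ _ _))
  refine Fin.cases ?_ fun i => ?_
  · simp only [stereo, Fin.cons_zero]
    have hi : Integrable (fun x => 2 * Real.exp τ / weight x₀ τ x - 1) ν :=
      hint _ ((continuous_const.div hw hw0).sub continuous_const)
    refine eq_zero_of_forall_mul_le zero_le_one fun t => ?_
    -- With the shift `arsinh t` the quotient of weights is exactly affine in the coordinate, with
    -- slope `-t` and an additional constant `√(1+t²) - 1 ≤ t²`.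
    have h1 := hvar (x₀, τ - Real.arsinh t)
    have h2 : ∀ x, weight x₀ (τ - Real.arsinh t) x / weight x₀ τ x - 1 =
        (Real.sqrt (1 + t ^ 2) - 1) - t * (2 * Real.exp τ / weight x₀ τ x - 1) := by
      intro x
      have hx := hw0 x
      have e1 : Real.exp (τ - Real.arsinh t) = Real.exp τ * (Real.sqrt (1 + t ^ 2) - t) := by
        rw [sub_eq_add_neg, Real.exp_add, ← Real.arsinh_neg, Real.exp_arsinh, neg_sq]
        ring
      have e2 : Real.exp (-(τ - Real.arsinh t)) = Real.exp (-τ) * (t + Real.sqrt (1 + t ^ 2)) := by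
        rw [neg_sub, sub_eq_add_neg, add_comm, Real.exp_add, Real.exp_arsinh]
      have e3 : Real.exp (-τ) * ‖x - x₀‖ ^ 2 = weight x₀ τ x - Real.exp τ := by rw [weight]; ring
      have e4 : weight x₀ (τ - Real.arsinh t) x = Real.exp τ * (Real.sqrt (1 + t ^ 2) - t) +
          (t + Real.sqrt (1 + t ^ 2)) * (weight x₀ τ x - Real.exp τ) := by
        rw [← e3, weight, e1, e2]
        ring
      rw [e4]
      field_simp
      ring
    simp only [h2] at h1
    rw [integral_sub (integrable_const _) (hi.const_mul _), integral_const_mul] at h1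
    simp only [integral_const, probReal_univ, smul_eq_mul, one_mul] at h1
    have h3 : Real.sqrt (1 + t ^ 2) ≤ 1 + t ^ 2 := by
      rw [Real.sqrt_le_left (by positivity)]
      nlinarith [sq_nonneg t]
    linarith
  · simp only [stereo, Fin.cons_succ]
    have hxi : Continuous fun x : V => (x - x₀) i := by
      simp only [PiLp.sub_apply]
      fun_prop
    have hi : Integrable (fun x => 2 * (x - x₀) i / weight x₀ τ x) ν :=
      hint _ ((continuous_const.mul hxi).div hw hw0)
    have hi2 : Integrable (fun x => 1 / weight x₀ τ x) ν := hint _ (continuous_const.div hw hw0)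
    refine eq_zero_of_forall_mul_le (B := ∫ x, 1 / weight x₀ τ x ∂ν)
      (integral_nonneg fun x => div_nonneg zero_le_one (weight_pos _ _ _).le) fun t => ?_
    have h1 := hvar (x₀ + t • EuclideanSpace.single i 1, τ)
    have h2 : ∀ x, weight (x₀ + t • EuclideanSpace.single i 1) τ x / weight x₀ τ x - 1 =
        Real.exp (-τ) * (t ^ 2 * (1 / weight x₀ τ x) - t * (2 * (x - x₀) i / weight x₀ τ x)) := by
      intro x
      have hx := hw0 x
      have e1 : ‖x - (x₀ + t • EuclideanSpace.single i (1 : ℝ))‖ ^ 2 =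
          ‖x - x₀‖ ^ 2 - 2 * (t * (x - x₀) i) + t ^ 2 := by
        rw [← sub_sub, norm_sub_sq_real, inner_smul_right, norm_smul]
        simp [EuclideanSpace.inner_single_right]
      have e2 : weight (x₀ + t • EuclideanSpace.single i 1) τ x =
          weight x₀ τ x + Real.exp (-τ) * (t ^ 2 - 2 * (t * (x - x₀) i)) := by
        rw [weight, weight, e1]
        ring
      rw [e2]
      field_simp
      ring
    simp only [h2] at h1
    rw [integral_const_mul, integral_sub (hi2.const_mul _) (hi.const_mul _), integral_const_mul,
      integral_const_mul] at h1
    have := nonneg_of_mul_nonneg_right h1 (Real.exp_pos (-τ))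
    linarith

end Frame

end HLS
namespace HLS

/-! ### Transfer of the sphere inequalities to the energy on Euclidean space. -/

section Bubble

variable {n : ℕ}

local notation "V" => EuclideanSpace ℝ (Fin n)

/-- The common mass `∫ (1 + |x|²)^(-n)` of the measures `weight ^ (-n)`. -/
noncomputable def bubbleMass (n : ℕ) : ℝ :=
  ∫ x : EuclideanSpace ℝ (Fin n), weight 0 0 x ^ (-(n : ℝ))

lemma integrable_weight_zero (hn : 0 < n) : Integrable fun x : V => weight 0 0 x ^ (-(n : ℝ)) := by
  have h := integrable_rpow_neg_one_add_norm_sq (E := V) (μ := volume) (r := 2 * n) (by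
    rw [finrank_euclideanSpace, Fintype.card_fin]
    have : (0 : ℝ) < n := by exact_mod_cast hn
    linarith)
  refine h.congr (Eventually.of_forall fun x => ?_)
  simp only [weight, neg_zero, Real.exp_zero, sub_zero, one_mul]
  congr 1
  ring

lemma weight_eq_zero_frame (x₀ : V) (τ : ℝ) (x : V) :
    weight x₀ τ x = Real.exp τ * weight 0 0 (Real.exp (-τ) • (x - x₀)) := by
  have he : Real.exp τ * Real.exp (-τ) = 1 := by rw [← Real.exp_add]; simp
  simp only [weight, neg_zero, Real.exp_zero, sub_zero, one_mul, norm_smul,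
    Real.norm_of_nonneg (Real.exp_pos _).le]
  linear_combination (-(Real.exp (-τ) * ‖x - x₀‖ ^ 2)) * he

lemma integrable_weight (hn : 0 < n) (x₀ : V) (τ : ℝ) :
    Integrable fun x : V => weight x₀ τ x ^ (-(n : ℝ)) := by
  have h := (((integrable_weight_zero hn).comp_smul (Real.exp_pos (-τ)).ne').comp_sub_right
    x₀).const_mul (Real.exp τ ^ (-(n : ℝ)))
  refine h.congr (Eventually.of_forall fun x => ?_)
  simp only
  rw [weight_eq_zero_frame x₀ τ x, Real.mul_rpow (Real.exp_pos τ).le (weight_pos _ _ _).le]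

lemma integral_weight (x₀ : V) (τ : ℝ) :
    ∫ x : V, weight x₀ τ x ^ (-(n : ℝ)) = bubbleMass n := by
  have h1 : ∀ x : V, weight x₀ τ x ^ (-(n : ℝ)) = Real.exp τ ^ (-(n : ℝ)) *
      weight 0 0 (Real.exp (-τ) • (x - x₀)) ^ (-(n : ℝ)) := fun x => by
    rw [weight_eq_zero_frame, Real.mul_rpow (Real.exp_pos τ).le (weight_pos _ _ _).le]
  simp only [h1]
  rw [integral_const_mul, integral_sub_right_eq_self
    (fun x : V => weight 0 0 (Real.exp (-τ) • x) ^ (-(n : ℝ))) x₀,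
    Measure.integral_comp_smul volume (fun x : V => weight 0 0 x ^ (-(n : ℝ))), bubbleMass]
  simp only [finrank_euclideanSpace, Fintype.card_fin, smul_eq_mul]
  rw [← mul_assoc, abs_of_pos (by positivity), Real.rpow_neg (Real.exp_pos τ).le,
    Real.rpow_natCast, Real.exp_neg, inv_pow, inv_inv, inv_mul_cancel₀ (by positivity), one_mul]

lemma bubbleMass_pos (hn : 0 < n) : 0 < bubbleMass n := by
  rw [bubbleMass, integral_pos_iff_support_of_nonneg
    (fun x => Real.rpow_nonneg (weight_pos _ _ _).le _) (integrable_weight_zero hn)]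
  have : (Function.support fun x : V => weight 0 0 x ^ (-(n : ℝ))) = Set.univ :=
    Set.eq_univ_of_forall fun x => (Real.rpow_pos_of_pos (weight_pos _ _ _) _).ne'
  rw [this]
  exact isOpen_univ.measure_pos _ Set.univ_nonempty

lemma measurable_weight_rpow (x₀ : V) (τ γ : ℝ) : Measurable fun x => weight x₀ τ x ^ γ :=
  (continuous_weight x₀ τ).measurable.pow_const γ

/-- A power of the weight in the Lebesgue space where it has finite norm. -/
lemma memLp_weight_rpow (hn : 0 < n) {γ : ℝ} (hγ : 0 < γ) (x₀ : V) (τ : ℝ) :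
    MemLp (fun x => weight x₀ τ x ^ (-γ)) (ENNReal.ofReal (n / γ)) := by
  have hn' : (0 : ℝ) < n := by exact_mod_cast hn
  rw [← integrable_norm_rpow_iff (measurable_weight_rpow x₀ τ _).aestronglyMeasurable
    (by simpa using div_pos hn' hγ) ENNReal.ofReal_ne_top,
    ENNReal.toReal_ofReal (div_pos hn' hγ).le]
  refine (integrable_weight hn x₀ τ).congr (Eventually.of_forall fun x => ?_)
  simp only
  have hw := (weight_pos x₀ τ x).le
  rw [Real.norm_of_nonneg (Real.rpow_nonneg hw _), ← Real.rpow_mul hw]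
  congr 1
  field_simp

lemma holderConjugate_exponents {α : ℝ} (hα : 0 < α) (hαn : 2 * α < n) :
    Real.HolderConjugate (n / (n - α)) (n / α) := by
  have hβ : 0 < n - α := by linarith
  refine Real.holderConjugate_iff.2 ⟨?_, ?_⟩
  · rw [one_lt_div hβ]; linarith
  · have : (n : ℝ) ≠ 0 := by linarith
    field_simp; ring

lemma integrable_mul_weight (hn : 0 < n) {α : ℝ} (hα : 0 < α) (hαn : 2 * α < n) {f : V → ℝ}
    (hf : MemLp f (ENNReal.ofReal (n / (n - α)))) (x₀ : V) (τ : ℝ) :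
    Integrable fun x => f x * weight x₀ τ x ^ (-α) := by
  have := (holderConjugate_exponents hα hαn).ennrealOfReal
  exact hf.integrable_mul (memLp_weight_rpow hn hα x₀ τ)

lemma integral_mul_weight_le (hn : 0 < n) {α : ℝ} (hα : 0 < α) (hαn : 2 * α < n) {f : V → ℝ}
    (hf : MemLp f (ENNReal.ofReal (n / (n - α)))) (hf0 : ∀ x, 0 ≤ f x) (x₀ : V) (τ : ℝ) :
    (∫ x, f x * weight x₀ τ x ^ (-α)) ^ 2 ≤
      (∫ x, f x ^ (n / (n - α) : ℝ)) ^ (2 * (n - α) / n) * bubbleMass n ^ (2 * α / n) := by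
  have hw0 : ∀ x, 0 ≤ weight x₀ τ x ^ (-α) := fun x => Real.rpow_nonneg (weight_pos _ _ _).le _
  have hn' : (0 : ℝ) < n := by exact_mod_cast hn
  have hZ := bubbleMass_pos hn
  have h := integral_mul_le_Lp_mul_Lq_of_nonneg (holderConjugate_exponents hα hαn)
    (Eventually.of_forall hf0) (Eventually.of_forall hw0) hf (memLp_weight_rpow hn hα x₀ τ)
  have hval : ∫ x, (weight x₀ τ x ^ (-α)) ^ (n / α) = bubbleMass n := by
    rw [← integral_weight x₀ τ]
    refine integral_congr_ae (Eventually.of_forall fun x => ?_)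
    simp only
    rw [← Real.rpow_mul (weight_pos _ _ _).le]
    congr 1
    field_simp
  rw [hval] at h
  have hI : 0 ≤ ∫ x, f x ^ (n / (n - α) : ℝ) := integral_nonneg fun x => Real.rpow_nonneg (hf0 x) _
  have hnn : 0 ≤ ∫ x, f x * weight x₀ τ x ^ (-α) :=
    integral_nonneg fun x => mul_nonneg (hf0 x) (hw0 x)
  refine (pow_le_pow_left₀ hnn h 2).trans (le_of_eq ?_)
  rw [mul_pow, ← Real.rpow_natCast, ← Real.rpow_mul hI, ← Real.rpow_natCast, ← Real.rpow_mul hZ.le]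
  congr 2
  · have : (n : ℝ) - α ≠ 0 := by linarith
    push_cast
    field_simp
  · push_cast
    field_simp

/-- Conformal covariance: the weights in `H = f · weight^(-α)` cancel those in the chordal distance.
Lebesgue measure is kept and `stereo` serves as the map `u`, so no change of variables to the sphere
is needed. -/
lemma sphere_kernel_eq (α : ℝ) (f : V → ℝ) (x₀ : V) (τ : ℝ) (x y : V) :
    f x * weight x₀ τ x ^ (-α) * (f y * weight x₀ τ y ^ (-α)) *
      (1 - stereo x₀ τ x ⬝ᵥ stereo x₀ τ y) ^ (-α) =
      2 ^ (-α) * (f x * f y * ‖x - y‖ ^ (-(2 * α))) := by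
  have hx := weight_pos x₀ τ x
  have hy := weight_pos x₀ τ y
  rw [stereo_dotProduct, sub_sub_cancel, Real.div_rpow (by positivity) (by positivity),
    Real.mul_rpow (by norm_num) (by positivity), Real.mul_rpow hx.le hy.le,
    ← Real.rpow_natCast, ← Real.rpow_mul (norm_nonneg _)]
  have h1 := (Real.rpow_pos_of_pos hx (-α)).ne'
  have h2 := (Real.rpow_pos_of_pos hy (-α)).ne'
  push_cast
  rw [mul_neg]
  field_simp

lemma ae_stereo_dotProduct_lt_one (hn : 0 < n) (x₀ : V) (τ : ℝ) :
    ∀ᵐ z ∂(volume : Measure V).prod volume, stereo x₀ τ z.1 ⬝ᵥ stereo x₀ τ z.2 < 1 := by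
  have := ae_fst_ne_snd (n := n) hn
  rw [Measure.volume_eq_prod] at this
  filter_upwards [this] with z hz
  rw [stereo_dotProduct]
  have h1 := weight_pos x₀ τ z.1
  have h2 := weight_pos x₀ τ z.2
  have h3 : 0 < ‖z.1 - z.2‖ := norm_pos_iff.2 (sub_ne_zero.2 hz)
  have : 0 < 2 * ‖z.1 - z.2‖ ^ 2 / (weight x₀ τ z.1 * weight x₀ τ z.2) := by positivity
  linarith

lemma integrable_sphere_kernel (hn : 0 < n) {α : ℝ} (hα : 0 < α) (hαn : 2 * α < n) {f : V → ℝ}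
    (hf : MemLp f (ENNReal.ofReal (n / (n - α)))) (x₀ : V) (τ : ℝ) :
    Integrable (fun z : V × V => f z.1 * weight x₀ τ z.1 ^ (-α) * (f z.2 * weight x₀ τ z.2 ^ (-α)) *
      (1 - stereo x₀ τ z.1 ⬝ᵥ stereo x₀ τ z.2) ^ (-α)) (volume.prod volume) := by
  simp only [sphere_kernel_eq]
  exact (integrable_energy hn hα hαn hf hf).const_mul _

lemma integral_sphere_kernel (α : ℝ) (f : V → ℝ) (x₀ : V) (τ : ℝ) :
    ∫ z : V × V, f z.1 * weight x₀ τ z.1 ^ (-α) * (f z.2 * weight x₀ τ z.2 ^ (-α)) *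
      (1 - stereo x₀ τ z.1 ⬝ᵥ stereo x₀ τ z.2) ^ (-α) ∂(volume.prod volume) =
      2 ^ (-α) * energy α f f := by
  simp only [sphere_kernel_eq]
  rw [integral_const_mul]
  rfl

lemma memLp_mul_stereo {p : ENNReal} {f : V → ℝ} (hf : MemLp f p) (x₀ : V) (τ : ℝ)
    (j : Fin (n + 1)) : MemLp (fun x => f x * stereo x₀ τ x j) p := by
  refine hf.mono (hf.1.mul (((measurable_pi_apply j).comp
    (measurable_stereo x₀ τ)).aestronglyMeasurable)) (Eventually.of_forall fun x => ?_)
  rw [norm_mul]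
  exact mul_le_of_le_one_right (norm_nonneg _) (abs_stereo_le_one x₀ τ x j)

/-- A lower bound of the energy, attained by the bubbles. -/
lemma uniformEnergy_mul_le_energy (hn : 0 < n) {α : ℝ} (hα : 0 < α) (hαn : 2 * α < n) {f : V → ℝ}
    (hf : MemLp f (ENNReal.ofReal (n / (n - α)))) (x₀ : V) (τ : ℝ) :
    2 ^ α * uniformEnergy n α * (∫ x, f x * weight x₀ τ x ^ (-α)) ^ 2 ≤ energy α f f := by
  have h := uniformEnergy_mul_le volume (integrable_mul_weight hn hα hαn hf x₀ τ)
    (measurable_stereo x₀ τ) (stereo_dotProduct_self x₀ τ) hα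
    (ae_stereo_dotProduct_lt_one hn x₀ τ) (integrable_sphere_kernel hn hα hαn hf x₀ τ)
  rw [integral_sphere_kernel, Real.rpow_neg (by norm_num)] at h
  have h2 : (0 : ℝ) < 2 ^ α := by positivity
  have := mul_le_mul_of_nonneg_left h h2.le
  rwa [← mul_assoc, ← mul_assoc, mul_inv_cancel₀ h2.ne', one_mul] at this

/-- An upper bound of the energy through the energies of the products with the coordinates of the
sphere. -/
lemma exists_energy_le_coordinates (hn : 0 < n) {α : ℝ} (hα : 0 < α) (hαn : 2 * α < n) :
    ∃ A : ℝ, 0 ≤ A ∧ ∀ {f : V → ℝ}, MemLp f (ENNReal.ofReal (n / (n - α))) → ∀ (x₀ : V) (τ : ℝ),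
      energy α f f ≤ 2 ^ α * uniformEnergy n α * (∫ x, f x * weight x₀ τ x ^ (-α)) ^ 2 +
        A * ((n - α) * ∑ j, energy α (fun x => f x * stereo x₀ τ x j)
          (fun x => f x * stereo x₀ τ x j) - α * energy α f f) := by
  obtain ⟨A, hA, h⟩ := exists_sphereEnergy_bound hα hαn
  refine ⟨A, hA, fun {f} hf x₀ τ => ?_⟩
  have key := h volume (integrable_mul_weight hn hα hαn hf x₀ τ)
    (measurable_stereo x₀ τ) (stereo_dotProduct_self x₀ τ)
    (ae_stereo_dotProduct_lt_one hn x₀ τ) (integrable_sphere_kernel hn hα hαn hf x₀ τ)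
  have h1 : ∫ z : V × V, f z.1 * weight x₀ τ z.1 ^ (-α) * (f z.2 * weight x₀ τ z.2 ^ (-α)) *
      (stereo x₀ τ z.1 ⬝ᵥ stereo x₀ τ z.2) *
      (1 - stereo x₀ τ z.1 ⬝ᵥ stereo x₀ τ z.2) ^ (-α) ∂(volume.prod volume) =
      2 ^ (-α) * ∑ j, energy α (fun x => f x * stereo x₀ τ x j)
          (fun x => f x * stereo x₀ τ x j) := by
    simp only [energy]
    rw [← integral_finsetSum _ fun j _ => integrable_energy hn hα hαn
      (memLp_mul_stereo hf x₀ τ j) (memLp_mul_stereo hf x₀ τ j), ← integral_const_mul]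
    refine integral_congr_ae (Eventually.of_forall fun z => ?_)
    simp only
    rw [mul_right_comm, sphere_kernel_eq, dotProduct, mul_assoc, Finset.mul_sum]
    congr 1
    refine Finset.sum_congr rfl fun j _ => ?_
    ring
  rw [h1, integral_sphere_kernel, Real.rpow_neg (by norm_num)] at key
  have h2 : (0 : ℝ) < 2 ^ α := by positivity
  have := mul_le_mul_of_nonneg_left key h2.le
  rw [← mul_assoc, mul_inv_cancel₀ h2.ne', one_mul] at this
  refine this.trans (le_of_eq ?_)
  field_simp

/-- The sharp constant of the Hardy-Littlewood-Sobolev inequality. -/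
noncomputable def sharpConst (n : ℕ) (α : ℝ) : ℝ :=
  2 ^ α * uniformEnergy n α * bubbleMass n ^ (2 * α / n)

lemma sharpConst_nonneg (hn : 0 < n) {α : ℝ} (hα : 0 < α) : 0 ≤ sharpConst n α :=
  mul_nonneg (mul_nonneg (by positivity) (uniformEnergy_nonneg n hα))
    (Real.rpow_nonneg (bubbleMass_pos hn).le _)

/-- In its own frame the bubble has `f · weight^(-α) = weight^(-n)`, whose integral is `bubbleMass`.
The lower bound through the mean then matches the sharp upper bound, so extremality follows without
evaluating the constant. -/
lemma le_energy_bubble (hn : 0 < n) {α : ℝ} (hα : 0 < α) (hαn : 2 * α < n) (x₀ : V) (τ : ℝ) :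
    sharpConst n α * bubbleMass n ^ (2 * (n - α) / n) ≤
      energy α (fun x => weight x₀ τ x ^ (-(n - α))) (fun x => weight x₀ τ x ^ (-(n - α))) := by
  have hn' : (0 : ℝ) < n := by exact_mod_cast hn
  have h := uniformEnergy_mul_le_energy hn hα hαn
    (memLp_weight_rpow hn (show 0 < n - α by linarith) x₀ τ) x₀ τ
  have h1 : ∀ x, weight x₀ τ x ^ (-(n - α)) * weight x₀ τ x ^ (-α) = weight x₀ τ x ^ (-(n : ℝ)) := by
    intro x
    rw [← Real.rpow_add (weight_pos _ _ _)]
    congr 1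
    ring
  simp only [h1, integral_weight] at h
  refine le_trans (le_of_eq ?_) h
  rw [sharpConst, mul_assoc, ← Real.rpow_add (bubbleMass_pos hn), ← Real.rpow_two]
  congr 2
  field_simp
  ring

end Bubble

end HLS
namespace HLS

/-! ### Elementary expansions of powers. -/

section Taylor

/-- A quadratic upper bound of a power with exponent between one and two. -/
lemma one_add_rpow_le {γ y : ℝ} (hγ : 1 ≤ γ) (hγ2 : γ ≤ 2) (hy : 0 ≤ y) :
    (1 + y) ^ γ ≤ 1 + γ * y + y ^ 2 := by
  have h := rpow_one_add_le_one_add_mul_self (s := y) (by linarith) (p := γ - 1) (by linarith)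
    (by linarith)
  have e : (1 + y) ^ γ = (1 + y) * (1 + y) ^ (γ - 1) := by
    rw [Real.rpow_sub_one (by positivity)]
    field_simp
  rw [e]
  have := mul_le_mul_of_nonneg_left h (show 0 ≤ 1 + y by linarith)
  nlinarith [mul_nonneg (show 0 ≤ 2 - γ by linarith) (sq_nonneg y)]

/-- A second-order Taylor bound with the sharp quadratic coefficient in the limit `t → 0`. -/
lemma one_add_rpow_le_taylor {p t z : ℝ} (hp : 1 < p) (hp2 : p < 2) (ht : t < 1) (hz : |z| ≤ t) :
    (1 + z) ^ p ≤ 1 + p * z + p * (p - 1) / 2 * (1 - t) ^ (p - 2) * z ^ 2 := by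
  have ht0 : 0 ≤ t := (abs_nonneg z).trans hz
  set c := (1 - t) ^ (p - 2) with hc
  have hc1 : 1 ≤ c := Real.one_le_rpow_of_pos_of_le_one_of_nonpos (by linarith) (by linarith)
    (by linarith)
  set φ : ℝ → ℝ := fun z => 1 + p * z + p * (p - 1) / 2 * c * z ^ 2 - (1 + z) ^ p with hφ
  have hd : ∀ z, HasDerivAt φ (p * (1 + (p - 1) * c * z - (1 + z) ^ (p - 1))) z := by
    intro z
    have h1 : HasDerivAt (fun z : ℝ => 1 + z) 1 z := by
      simpa using (hasDerivAt_id z).const_add 1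
    have h2 := h1.rpow_const (p := p) (Or.inr hp.le)
    have h3 := (((hasDerivAt_id z).const_mul p).const_add 1).add
      (((hasDerivAt_id z).pow 2).const_mul (p * (p - 1) / 2 * c))
    refine (h3.sub h2).congr_deriv ?_
    simp
    ring
  have hcont : Continuous φ := continuous_iff_continuousAt.2 fun z => (hd z).continuousAt
  have h0 : φ 0 = 0 := by simp [hφ]
  suffices 0 ≤ φ z by simpa [hφ] using this
  rw [← h0]
  rcases le_total 0 z with h | h
  · have hm : MonotoneOn φ (Set.Icc 0 t) := by
      refine monotoneOn_of_deriv_nonneg (convex_Icc _ _) hcont.continuousOn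
        (fun x _ => (hd x).differentiableAt.differentiableWithinAt) fun x hx => ?_
      rw [interior_Icc] at hx
      rw [(hd x).deriv]
      refine mul_nonneg (by linarith) ?_
      have := rpow_one_add_le_one_add_mul_self (s := x) (by linarith [hx.1]) (p := p - 1)
        (by linarith) (by linarith)
      nlinarith [mul_nonneg (mul_nonneg (show 0 ≤ p - 1 by linarith) hx.1.le)
        (show 0 ≤ c - 1 by linarith)]
    exact hm ⟨le_rfl, ht0⟩ ⟨h, (le_abs_self z).trans hz⟩ h
  -- For negative arguments `(1+x)^(p-1)` is written as `(1+x)^(p-2) (1+x)`; Bernoulli's inequality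
  -- with exponent `2-p` bounds it below, and `(1+x)^(p-2)` is at most its value at `-t`.
  · have hm : AntitoneOn φ (Set.Icc (-t) 0) := by
      refine antitoneOn_of_deriv_nonpos (convex_Icc _ _) hcont.continuousOn
        (fun x _ => (hd x).differentiableAt.differentiableWithinAt) fun x hx => ?_
      rw [interior_Icc] at hx
      rw [(hd x).deriv]
      refine mul_nonpos_of_nonneg_of_nonpos (by linarith) ?_
      have hy : 0 < 1 + x := by linarith [hx.1]
      have h1 := rpow_one_add_le_one_add_mul_self (s := x) (by linarith) (p := 2 - p)
        (by linarith) (by linarith)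
      have h2 : (1 + x) ^ (p - 2) ≤ c :=
        Real.rpow_le_rpow_of_nonpos (by linarith) (by linarith [hx.1]) (by linarith)
      have h3 : (1 + x) ^ (p - 2) * (1 + x) ^ (2 - p) = 1 := by
        rw [← Real.rpow_add hy]; simp
      have h4 : (1 + x) ^ (p - 1) = (1 + x) ^ (p - 2) * (1 + x) := by
        rw [← Real.rpow_add_one hy.ne']; congr 1; ring
      have h5 := Real.rpow_pos_of_pos hy (p - 2)
      rw [h4]
      have h6 := mul_le_mul_of_nonneg_left h1 h5.le
      rw [h3] at h6
      have h7 := mul_nonneg (mul_nonneg (show 0 ≤ p - 1 by linarith) (neg_nonneg.2 hx.2.le))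
        (sub_nonneg.2 h2)
      nlinarith
    exact hm ⟨(abs_le.1 hz).1, h⟩ ⟨by linarith, le_rfl⟩ h

end Taylor

/-! ### Test functions, normalization and centring. -/

section SharpHLS

variable {n : ℕ}

local notation "V" => EuclideanSpace ℝ (Fin n)

/-- Nonnegative measurable functions, bounded by `R` and vanishing outside the ball of
radius `R`. -/
structure IsTestFunction (R : ℝ) (f : EuclideanSpace ℝ (Fin n) → ℝ) : Prop where
  measurable : Measurable f
  nonneg : ∀ x, 0 ≤ f x
  le : ∀ x, f x ≤ R
  eq_zero : ∀ x, R < ‖x‖ → f x = 0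

lemma IsTestFunction.memLp {R : ℝ} {f : V → ℝ} (hf : IsTestFunction R f) (p : ENNReal) :
    MemLp f p := by
  have h : MemLp ((Metric.closedBall (0 : V) R).indicator fun _ => R) p volume :=
    memLp_indicator_const p Metric.isClosed_closedBall.measurableSet R
      (Or.inr measure_closedBall_lt_top.ne)
  refine h.mono hf.measurable.aestronglyMeasurable (Eventually.of_forall fun x => ?_)
  by_cases hx : x ∈ Metric.closedBall (0 : V) R
  · rw [Set.indicator_of_mem hx, Real.norm_of_nonneg (hf.nonneg x)]
    exact (hf.le x).trans (le_abs_self R)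
  · rw [hf.eq_zero x (by simpa using hx)]
    simp

lemma integrable_rpow {p : ℝ} (hp : 0 < p) {f : V → ℝ} (hf : MemLp f (ENNReal.ofReal p))
    (h0 : ∀ x, 0 ≤ f x) : Integrable fun x => f x ^ p := by
  have h := hf.integrable_norm_rpow (by simpa using hp) ENNReal.ofReal_ne_top
  rw [ENNReal.toReal_ofReal hp.le] at h
  simpa only [Real.norm_of_nonneg (h0 _)] using h

lemma energy_congr_ae (α : ℝ) {f f' g g' : V → ℝ} (hf : f =ᵐ[volume] f') (hg : g =ᵐ[volume] g') :
    energy α f g = energy α f' g' := by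
  rw [energy, energy, Measure.volume_eq_prod]
  refine integral_congr_ae ?_
  filter_upwards [Measure.quasiMeasurePreserving_fst.ae_eq_comp hf,
    Measure.quasiMeasurePreserving_snd.ae_eq_comp hg] with z h1 h2
  simp only [Function.comp] at h1 h2
  rw [h1, h2]

lemma IsTestFunction.mul_one_add {R : ℝ} {f : V → ℝ} (hf : IsTestFunction R f) {ω : V → ℝ}
    (hω : Measurable ω) {t : ℝ} (ht : t ≤ 1) (hωt : ∀ x, |ω x| ≤ t) :
    IsTestFunction (2 * R) fun x => f x * (1 + ω x) := by
  have hR : 0 ≤ R := (hf.nonneg 0).trans (hf.le 0)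
  have h1 : ∀ x, 0 ≤ 1 + ω x := fun x => by linarith [(abs_le.1 (hωt x)).1]
  refine ⟨hf.measurable.mul (measurable_const.add hω), fun x => mul_nonneg (hf.nonneg x) (h1 x),
    fun x => ?_, fun x hx => ?_⟩
  · have := mul_le_mul (hf.le x) (show 1 + ω x ≤ 2 by linarith [(abs_le.1 (hωt x)).2]) (h1 x) hR
    linarith
  · rw [hf.eq_zero x (by linarith), zero_mul]

/-- Homogeneity. Only an upper bound `K` on `∫ f^p` is required, as perturbed functions are
estimated by Taylor bounds. -/
lemma energy_le_of_normalized (hn : 0 < n) {α : ℝ} (hα : 0 < α) (hαn : 2 * α < n) {C : ℝ}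
    (hC : 0 ≤ C) (h : ∀ (R : ℝ) (f : V → ℝ), IsTestFunction R f →
      ∫ x, f x ^ (n / (n - α) : ℝ) = 1 → energy α f f ≤ C)
    {R : ℝ} {f : V → ℝ} (hf : IsTestFunction R f) {K : ℝ}
    (hK : ∫ x, f x ^ (n / (n - α) : ℝ) ≤ K) : energy α f f ≤ C * K ^ (2 * (n - α) / n) := by
  have hn' : (0 : ℝ) < n := by exact_mod_cast hn
  have hβ : 0 < n - α := by linarith
  have hp : 0 < n / (n - α) := by positivity
  have hfp0 : ∀ x, 0 ≤ f x ^ (n / (n - α) : ℝ) := fun x => Real.rpow_nonneg (hf.nonneg x) _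
  set J := ∫ x, f x ^ (n / (n - α) : ℝ) with hJ
  have hJ0 : 0 ≤ J := integral_nonneg hfp0
  rcases hJ0.eq_or_lt with h0 | hJpos
  · have hz := (integral_eq_zero_iff_of_nonneg hfp0
      (integrable_rpow hp (hf.memLp _) hf.nonneg)).1 (hJ.symm.trans h0.symm)
    have hfz : f =ᵐ[volume] 0 := by
      filter_upwards [hz] with x hx
      exact ((Real.rpow_eq_zero_iff_of_nonneg (hf.nonneg x)).1 hx).1
    rw [energy_congr_ae α hfz hfz]
    have : energy α (0 : V → ℝ) 0 = 0 := by simp [energy]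
    rw [this]
    exact mul_nonneg hC (Real.rpow_nonneg (hJ0.trans hK) _)
  · set l := J ^ (-(n - α) / n : ℝ) with hl
    have hl0 : 0 < l := Real.rpow_pos_of_pos hJpos _
    have ht : IsTestFunction (max R (l * R)) (l • f) := by
      refine ⟨hf.measurable.const_smul l, fun x => mul_nonneg hl0.le (hf.nonneg x), fun x => ?_,
        fun x hx => ?_⟩
      · exact (mul_le_mul_of_nonneg_left (hf.le x) hl0.le).trans (le_max_right _ _)
      · simp [hf.eq_zero x ((le_max_left _ _).trans_lt hx)]
    have h1 := h _ _ ht (by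
      simp only [Pi.smul_apply, smul_eq_mul]
      simp only [Real.mul_rpow hl0.le (hf.nonneg _)]
      rw [integral_const_mul, ← hJ, hl, ← Real.rpow_mul hJ0]
      rw [show -(n - α) / n * (n / (n - α)) = (-1 : ℝ) by field_simp, Real.rpow_neg_one,
        inv_mul_cancel₀ hJpos.ne'])
    rw [energy_smul_left, energy_comm, energy_smul_left, ← mul_assoc] at h1
    have h2 : l * l * J ^ (2 * (n - α) / n) = 1 := by
      rw [hl, ← Real.rpow_add hJpos, ← Real.rpow_add hJpos]
      rw [show -(n - α) / n + -(n - α) / n + 2 * (n - α) / n = (0 : ℝ) by ring, Real.rpow_zero]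
    have h3 : J ^ (2 * (n - α) / n) ≤ K ^ (2 * (n - α) / n) :=
      Real.rpow_le_rpow hJ0 hK (by positivity)
    have h4 : energy α f f ≤ C * J ^ (2 * (n - α) / n) := by
      have := mul_le_mul_of_nonneg_right h1 (Real.rpow_nonneg hJ0 (2 * (n - α) / n))
      calc energy α f f = l * l * energy α f f * J ^ (2 * (n - α) / n) := by
            linear_combination (-energy α f f) * h2
        _ ≤ _ := this
    exact h4.trans (mul_le_mul_of_nonneg_left h3 hC)

/-- A frame of the sphere in which the centre of mass of `f ^ p` is the origin. -/
lemma exists_centred_frame (hn : 0 < n) {p : ℝ} (hp : 0 < p) {R : ℝ} {f : V → ℝ}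
    (hf : IsTestFunction R f) (h1 : ∫ x, f x ^ p = 1) :
    ∃ (x₀ : V) (τ : ℝ), ∀ j, ∫ x, f x ^ p * stereo x₀ τ x j = 0 := by
  have : Nonempty (Fin n) := ⟨⟨0, hn⟩⟩
  have hfp0 : ∀ x, 0 ≤ f x ^ p := fun x => Real.rpow_nonneg (hf.nonneg x) _
  have hfm : Measurable fun x => ENNReal.ofReal (f x ^ p) := (hf.measurable.pow_const p).ennreal_ofReal
  have hi := integrable_rpow hp (hf.memLp _) hf.nonneg
  have hR : 0 ≤ R := (hf.nonneg 0).trans (hf.le 0)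
  set ν : Measure V := volume.withDensity fun x => ENNReal.ofReal (f x ^ p) with hν
  have hprob : IsProbabilityMeasure ν := ⟨by
    rw [hν, withDensity_apply _ MeasurableSet.univ, setLIntegral_univ,
      ← ofReal_integral_eq_lintegral_ofReal hi (Eventually.of_forall hfp0), h1, ENNReal.ofReal_one]⟩
  -- A ball of radius `δ ≤ 1` has mass at most `K δ^n ≤ K δ`, which is at most `1/4` for `δ =
  -- 1/(4K+4)`.
  set K := R ^ p * (volume : Measure V).real (Metric.ball 0 1) with hK
  have hK0 : 0 ≤ K := by positivity
  have hδ : 0 < 1 / (4 * K + 4) := by positivity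
  have hδ1 : 1 / (4 * K + 4) ≤ 1 := by
    rw [div_le_one (by positivity)]; linarith
  obtain ⟨x₀, τ, h⟩ := exists_stereo_integral_eq_zero ν (R := R) (by
      rw [hν, ae_withDensity_iff hfm]
      refine Eventually.of_forall fun x hx => ?_
      by_contra hc
      rw [hf.eq_zero x (by simpa using hc), Real.zero_rpow hp.ne'] at hx
      simp at hx) hδ hδ1 (by
    intro x
    have hle : ν (Metric.ball x (1 / (4 * K + 4))) ≤
        ENNReal.ofReal (R ^ p) * volume (Metric.ball x (1 / (4 * K + 4))) := by
      rw [hν, withDensity_apply _ measurableSet_ball]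
      refine (setLIntegral_mono measurable_const fun y _ => ENNReal.ofReal_le_ofReal
        (Real.rpow_le_rpow (hf.nonneg y) (hf.le y) hp.le)).trans (le_of_eq ?_)
      rw [setLIntegral_const]
    have h2 : ν.real (Metric.ball x (1 / (4 * K + 4))) ≤ K * (1 / (4 * K + 4)) ^ n := by
      rw [Measure.real]
      refine (ENNReal.toReal_mono (ENNReal.mul_ne_top ENNReal.ofReal_ne_top
        measure_ball_lt_top.ne) hle).trans (le_of_eq ?_)
      rw [Measure.addHaar_ball _ _ hδ.le, ENNReal.toReal_mul, ENNReal.toReal_mul,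
        ENNReal.toReal_ofReal (by positivity), ENNReal.toReal_ofReal (by positivity), hK,
        finrank_euclideanSpace, Fintype.card_fin, Measure.real]
      ring
    have h3 : (1 / (4 * K + 4)) ^ n ≤ 1 / (4 * K + 4) := pow_le_of_le_one hδ.le hδ1 hn.ne'
    refine h2.trans ((mul_le_mul_of_nonneg_left h3 hK0).trans ?_)
    rw [mul_one_div, div_le_div_iff₀ (by positivity) (by norm_num)]
    linarith)
  refine ⟨x₀, τ, fun j => ?_⟩
  have := h j
  rw [hν, integral_withDensity_eq_integral_toReal_smul hfm
    (Eventually.of_forall fun _ => ENNReal.ofReal_lt_top)] at this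
  simpa only [ENNReal.toReal_ofReal (hfp0 _), smul_eq_mul] using this

end SharpHLS

end HLS
namespace HLS

/-! ### The sharp inequality by second variation. -/

section SharpHLS

variable {n : ℕ}

local notation "V" => EuclideanSpace ℝ (Fin n)

lemma exponent_bounds {α : ℝ} (hα : 0 < α) (hαn : 2 * α < n) :
    (1 : ℝ) < n / (n - α) ∧ (n / (n - α) : ℝ) < 2 := by
  have hβ : 0 < n - α := by linarith
  exact ⟨(one_lt_div hβ).2 (by linarith), (div_lt_iff₀ hβ).2 (by linarith)⟩

/-- The centring condition removes the first-order term of `∫ (f(1+tω))^p`. The coefficient of `t²`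
must be exact as `t → 0`, because the spectral inequality leaves no slack; the fourth-order term may
be crude. -/
lemma energy_perturbation_le (hn : 0 < n) {α : ℝ} (hα : 0 < α) (hαn : 2 * α < n) {C : ℝ}
    (hC : 0 ≤ C) (h : ∀ (R : ℝ) (f : V → ℝ), IsTestFunction R f →
      ∫ x, f x ^ (n / (n - α) : ℝ) = 1 → energy α f f ≤ C)
    {R : ℝ} {f : V → ℝ} (hf : IsTestFunction R f) (h1 : ∫ x, f x ^ (n / (n - α) : ℝ) = 1)
    {ω : V → ℝ} (hω : Measurable ω) (hω1 : ∀ x, |ω x| ≤ 1)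
    (hc : ∫ x, f x ^ (n / (n - α) : ℝ) * ω x = 0) {t : ℝ} (ht : 0 < t) (ht2 : t ≤ 1 / 2) :
    energy α (fun x => f x * (1 + t * ω x)) (fun x => f x * (1 + t * ω x)) ≤
      C * (1 + α / (n - α) * (1 - t) ^ (n / (n - α) - 2 : ℝ) *
        (∫ x, f x ^ (n / (n - α) : ℝ) * ω x ^ 2) * t ^ 2 + 4 * t ^ 4) := by
  have hn' : (0 : ℝ) < n := by exact_mod_cast hn
  have hβ : 0 < n - α := by linarith
  obtain ⟨hp1, hp2⟩ := exponent_bounds hα hαn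
  have hpα : (n / (n - α) : ℝ) - 1 = α / (n - α) := by field_simp; ring
  have hγ : (2 * (n - α) / n : ℝ) * (n / (n - α)) = 2 := by field_simp
  have hγ1 : (1 : ℝ) ≤ 2 * (n - α) / n := (one_le_div hn').2 (by linarith)
  have hγ2 : (2 * (n - α) / n : ℝ) ≤ 2 := (div_le_iff₀ hn').2 (by linarith)
  set p : ℝ := n / (n - α) with hp
  set γ : ℝ := 2 * (n - α) / n with hγdef
  set c := (1 - t) ^ (p - 2) with hcdef
  have hfp0 : ∀ x, 0 ≤ f x ^ p := fun x => Real.rpow_nonneg (hf.nonneg x) _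
  have hi : Integrable fun x => f x ^ p := integrable_rpow (by linarith) (hf.memLp _) hf.nonneg
  have hbdd : ∀ {u : V → ℝ}, Measurable u → (∀ x, |u x| ≤ 1) → Integrable fun x => f x ^ p * u x :=
    fun hu hu1 => hi.mul_bdd (c := 1) hu.aestronglyMeasurable (Eventually.of_forall hu1)
  have hω2 : ∀ x, ω x ^ 2 ≤ 1 := fun x => (sq_le_one_iff_abs_le_one _).2 (hω1 x)
  have i1 := hbdd hω hω1
  have i2 := hbdd (hω.pow_const 2) fun x => by
    rw [abs_of_nonneg (sq_nonneg _)]; exact hω2 x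
  set a := ∫ x, f x ^ p * ω x ^ 2 with ha
  have ha0 : 0 ≤ a := integral_nonneg fun x => mul_nonneg (hfp0 x) (sq_nonneg _)
  have ha1 : a ≤ 1 := by
    rw [← h1]
    exact integral_mono i2 hi fun x => mul_le_of_le_one_right (hfp0 x) (hω2 x)
  have hc0 : 0 ≤ c := Real.rpow_nonneg (by linarith) _
  have hc2 : c ≤ 2 := by
    have e : c = ((1 - t) ^ (2 - p))⁻¹ := by rw [hcdef, ← Real.rpow_neg (by linarith)]; ring_nf
    rw [e]
    refine inv_le_of_inv_le₀ (by norm_num) ?_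
    have : (1 - t) ^ (1 : ℝ) ≤ (1 - t) ^ (2 - p) :=
      Real.rpow_le_rpow_of_exponent_ge (by linarith) (by linarith) (by linarith)
    rw [Real.rpow_one] at this
    linarith
  have htω : ∀ x, |t * ω x| ≤ t := fun x => by
    rw [abs_mul, abs_of_pos ht]; exact mul_le_of_le_one_right ht.le (hω1 x)
  have hT := hf.mul_one_add (hω.const_mul t) (show t ≤ 1 by linarith) htω
  set y := p * (p - 1) / 2 * c * t ^ 2 * a with hy
  have hy0 : 0 ≤ y := by
    have : 0 ≤ p * (p - 1) := mul_nonneg (by linarith) (by linarith)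
    positivity
  have hK : ∫ x, (f x * (1 + t * ω x)) ^ p ≤ 1 + y := by
    have i12 : Integrable fun x => f x ^ p + p * t * (f x ^ p * ω x) :=
      hi.add (i1.const_mul (p * t))
    have i3 : Integrable fun x => f x ^ p + p * t * (f x ^ p * ω x) +
        p * (p - 1) / 2 * c * t ^ 2 * (f x ^ p * ω x ^ 2) := i12.add (i2.const_mul _)
    have hint : ∫ x, (f x ^ p + p * t * (f x ^ p * ω x) +
        p * (p - 1) / 2 * c * t ^ 2 * (f x ^ p * ω x ^ 2)) = 1 + y := by
      rw [integral_add i12 (i2.const_mul (p * (p - 1) / 2 * c * t ^ 2)), integral_add hi (i1.const_mul (p * t)),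
        integral_const_mul, integral_const_mul, hc, h1, mul_zero, add_zero]
    rw [← hint]
    refine integral_mono (integrable_rpow (by linarith) (hT.memLp _) hT.nonneg) i3 fun x => ?_
    simp only
    have hx : 0 ≤ 1 + t * ω x := by linarith [(abs_le.1 (htω x)).1]
    rw [Real.mul_rpow (hf.nonneg x) hx]
    refine (mul_le_mul_of_nonneg_left (one_add_rpow_le_taylor hp1 hp2 (by linarith) (htω x))
      (hfp0 x)).trans (le_of_eq ?_)
    ring
  refine (energy_le_of_normalized hn hα hαn hC h hT hK).trans
    (mul_le_mul_of_nonneg_left ?_ hC)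
  refine (one_add_rpow_le hγ1 hγ2 hy0).trans ?_
  have e1 : γ * y = α / (n - α) * c * a * t ^ 2 := by
    rw [← hpα, hy]
    linear_combination ((p - 1) / 2 * c * t ^ 2 * a) * hγ
  have e2 : y ≤ 2 * t ^ 2 := by
    have h3 : p * (p - 1) / 2 ≤ 1 := by nlinarith
    have h4 : 0 ≤ p * (p - 1) / 2 := by
      have : 0 ≤ p * (p - 1) := mul_nonneg (by linarith) (by linarith)
      positivity
    have h5 : p * (p - 1) / 2 * c ≤ 1 * 2 := mul_le_mul h3 hc2 hc0 (by norm_num)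
    calc y ≤ p * (p - 1) / 2 * c * t ^ 2 * 1 := mul_le_mul_of_nonneg_left ha1 (by positivity)
      _ ≤ 2 * t ^ 2 := by nlinarith [sq_nonneg t]
  have e3 : y ^ 2 ≤ 4 * t ^ 4 := (pow_le_pow_left₀ hy0 e2 2).trans (le_of_eq (by ring))
  rw [e1]
  linarith

/-- Averaging the perturbations by `ω` and `-ω` cancels the linear term of the energy, so `f` need
not satisfy an Euler-Lagrange equation. -/
lemma energy_add_energy_mul_le (hn : 0 < n) {α : ℝ} (hα : 0 < α) (hαn : 2 * α < n) {C : ℝ}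
    (hC : 0 ≤ C) (h : ∀ (R : ℝ) (f : V → ℝ), IsTestFunction R f →
      ∫ x, f x ^ (n / (n - α) : ℝ) = 1 → energy α f f ≤ C)
    {R : ℝ} {f : V → ℝ} (hf : IsTestFunction R f) (h1 : ∫ x, f x ^ (n / (n - α) : ℝ) = 1)
    {ω : V → ℝ} (hω : Measurable ω) (hω1 : ∀ x, |ω x| ≤ 1)
    (hc : ∫ x, f x ^ (n / (n - α) : ℝ) * ω x = 0) {t : ℝ} (ht : 0 < t) (ht2 : t ≤ 1 / 2) :
    energy α f f + t ^ 2 * energy α (fun x => f x * ω x) (fun x => f x * ω x) ≤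
      C * (1 + α / (n - α) * (1 - t) ^ (n / (n - α) - 2 : ℝ) *
        (∫ x, f x ^ (n / (n - α) : ℝ) * ω x ^ 2) * t ^ 2 + 4 * t ^ 4) := by
  have hfω : MemLp (fun x => f x * ω x) (ENNReal.ofReal (n / (n - α))) := by
    refine (hf.memLp _).mono (hf.measurable.mul hω).aestronglyMeasurable
      (Eventually.of_forall fun x => ?_)
    rw [norm_mul]
    exact mul_le_of_le_one_right (norm_nonneg _) (hω1 x)
  have k1 := energy_perturbation_le hn hα hαn hC h hf h1 hω hω1 hc ht ht2
  have k2 := energy_perturbation_le hn hα hαn hC h hf h1 hω.neg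
    (fun x => by simpa using hω1 x) (by simpa [integral_neg] using hc) ht ht2
  have q1 := energy_add_smul_self hn hα hαn (hf.memLp _) hfω t
  have q2 := energy_add_smul_self hn hα hαn (hf.memLp _) hfω (-t)
  have r1 : f + t • (fun x => f x * ω x) = fun x => f x * (1 + t * ω x) := by
    ext x; simp only [Pi.add_apply, Pi.smul_apply, smul_eq_mul]; ring
  have r2 : f + (-t) • (fun x => f x * ω x) = fun x => f x * (1 + t * (-ω) x) := by
    ext x; simp only [Pi.add_apply, Pi.smul_apply, smul_eq_mul, Pi.neg_apply]; ring
  rw [r1] at q1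
  rw [r2] at q2
  simp only [Pi.neg_apply, neg_sq] at k2 q2
  linarith

/-- The sharp inequality for normalized test functions. -/
lemma energy_le_sharpConst_of_normalized (hn : 0 < n) {α : ℝ} (hα : 0 < α) (hαn : 2 * α < n)
    {R : ℝ} {f : V → ℝ} (hf : IsTestFunction R f) (h1 : ∫ x, f x ^ (n / (n - α) : ℝ) = 1) :
    energy α f f ≤ sharpConst n α := by
  have hn' : (0 : ℝ) < n := by exact_mod_cast hn
  have hβ : 0 < n - α := by linarith
  have hp : 0 < n / (n - α) := by positivity
  set T : Set ℝ := {E | ∃ (R : ℝ) (f : V → ℝ), IsTestFunction R f ∧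
    ∫ x, f x ^ (n / (n - α) : ℝ) = 1 ∧ energy α f f = E} with hT
  obtain ⟨B, hB, hBle⟩ := exists_energy_le (n := n) hn hα hαn
  have hTb : BddAbove T := by
    refine ⟨B, ?_⟩
    rintro E ⟨R, f, hf, h1, rfl⟩
    exact hBle f hf.measurable hf.nonneg (integrable_rpow hp (hf.memLp _) hf.nonneg) h1.le
  have hTn : T.Nonempty := ⟨_, R, f, hf, h1, rfl⟩
  set C := sSup T with hCdef
  have hCle : ∀ (R : ℝ) (f : V → ℝ), IsTestFunction R f →
      ∫ x, f x ^ (n / (n - α) : ℝ) = 1 → energy α f f ≤ C :=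
    fun R f hf h1 => le_csSup hTb ⟨R, f, hf, h1, rfl⟩
  refine (hCle R f hf h1).trans ?_
  have hC0 : 0 ≤ C := by
    refine le_trans ?_ (hCle R f hf h1)
    exact integral_nonneg fun z => mul_nonneg (mul_nonneg (hf.nonneg _) (hf.nonneg _))
      (Real.rpow_nonneg (norm_nonneg _) _)
  clear hf h1
  obtain ⟨A, hA, hAle⟩ := exists_energy_le_coordinates (n := n) hn hα hαn
  -- The supremum need not be attained: for each `t` a function with energy above `C - t⁴` is used.
  -- This error remains negligible after division by `t²`.
  have key : ∀ t : ℝ, 0 < t → t ≤ 1 / 2 → C ≤ sharpConst n α + A * (α * C *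
      ((1 - t) ^ (n / (n - α) - 2 : ℝ) - 1) + ((n - α) * (n + 1) * (4 * C + 1) + α * t ^ 2) * t ^ 2)
      + t ^ 4 := by
    intro t ht ht2
    obtain ⟨E, ⟨R, f, hf, h1, rfl⟩, hE⟩ := exists_lt_of_lt_csSup hTn
      (show C - t ^ 4 < C by linarith [pow_pos ht 4])
    obtain ⟨x₀, τ, hcen⟩ := exists_centred_frame hn hp hf h1
    have hm : ∀ j, Measurable fun x => stereo x₀ τ x j := fun j =>
      (measurable_pi_apply j).comp (measurable_stereo x₀ τ)
    have hj := fun j => energy_add_energy_mul_le hn hα hαn hC0 hCle hf h1 (hm j)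
      (fun x => abs_stereo_le_one x₀ τ x j) (hcen j) ht ht2
    have hsum := Finset.sum_le_sum fun j (_ : j ∈ Finset.univ) => hj j
    have hi : Integrable fun x => f x ^ (n / (n - α) : ℝ) :=
      integrable_rpow hp (hf.memLp _) hf.nonneg
    have ha : ∑ j, ∫ x, f x ^ (n / (n - α) : ℝ) * stereo x₀ τ x j ^ 2 = 1 := by
      rw [← integral_finsetSum _ fun j _ => hi.mul_bdd (c := 1)
        ((hm j).pow_const 2).aestronglyMeasurable (Eventually.of_forall fun x => by
          rw [Real.norm_of_nonneg (sq_nonneg _)]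
          exact (sq_le_one_iff_abs_le_one _).2 (abs_stereo_le_one x₀ τ x j)), ← h1]
      refine integral_congr_ae (Eventually.of_forall fun x => ?_)
      simp only
      rw [← Finset.mul_sum]
      have := stereo_dotProduct_self x₀ τ x
      simp only [dotProduct, ← sq] at this
      rw [this, mul_one]
    rw [Finset.sum_add_distrib, ← Finset.mul_sum, ← Finset.mul_sum, Finset.sum_add_distrib,
      Finset.sum_add_distrib, ← Finset.sum_mul, ← Finset.mul_sum, ha] at hsum
    simp only [Finset.sum_const, Finset.card_univ, Fintype.card_fin, nsmul_eq_mul, mul_one] at hsum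
    push_cast at hsum
    have hw := integral_mul_weight_le hn hα hαn (hf.memLp _) hf.nonneg x₀ τ
    rw [h1, Real.one_rpow, one_mul] at hw
    have hAf := hAle (hf.memLp _) x₀ τ
    set S1 := ∑ j, energy α (fun x => f x * stereo x₀ τ x j) (fun x => f x * stereo x₀ τ x j)
    set c := (1 - t) ^ (n / (n - α) - 2 : ℝ)
    set E := energy α f f
    have hS : 2 ^ α * uniformEnergy n α * (∫ x, f x * weight x₀ τ x ^ (-α)) ^ 2 ≤
        sharpConst n α :=
      mul_le_mul_of_nonneg_left hw (mul_nonneg (by positivity) (uniformEnergy_nonneg n hα))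
    -- Since `∑ ω_j² = 1`, the quadratic coefficients add up to `α/(n-α)`, while the zeroth-order
    -- terms occur `n+1` times and cancel up to `(n+1) t⁴`.
    have hS1 : S1 ≤ C * (α / (n - α) * c + 4 * (n + 1) * t ^ 2) + (n + 1) * t ^ 2 := by
      have hn1 : (0 : ℝ) < n + 1 := by positivity
      have : t ^ 2 * S1 ≤ t ^ 2 * (C * (α / (n - α) * c + 4 * (n + 1) * t ^ 2) +
          (n + 1) * t ^ 2) := by
        nlinarith [mul_lt_mul_of_pos_left hE hn1]
      exact le_of_mul_le_mul_left this (by positivity)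
    have hdef : (n - α) * S1 - α * E ≤ α * C * (c - 1) +
        ((n - α) * (n + 1) * (4 * C + 1) + α * t ^ 2) * t ^ 2 := by
      have h2 := mul_le_mul_of_nonneg_left hS1 hβ.le
      have h3 := mul_lt_mul_of_pos_left hE hα
      have h4 : (n - α) * (C * (α / (n - α) * c + 4 * (n + 1) * t ^ 2) + (n + 1) * t ^ 2) =
          α * C * c + (n - α) * (n + 1) * (4 * C + 1) * t ^ 2 := by
        field_simp
        ring
      rw [h4] at h2
      linarith
    have := mul_le_mul_of_nonneg_left hdef hA
    linarith
  have hlim : Tendsto (fun t : ℝ => sharpConst n α + A * (α * C *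
      ((1 - t) ^ (n / (n - α) - 2 : ℝ) - 1) + ((n - α) * (n + 1) * (4 * C + 1) + α * t ^ 2) * t ^ 2)
      + t ^ 4) (𝓝[>] 0) (𝓝 (sharpConst n α)) := by
    have hcont : ContinuousAt (fun t : ℝ => sharpConst n α + A * (α * C *
      ((1 - t) ^ (n / (n - α) - 2 : ℝ) - 1) + ((n - α) * (n + 1) * (4 * C + 1) + α * t ^ 2) * t ^ 2)
      + t ^ 4) 0 := by
      have : ContinuousAt (fun t : ℝ => (1 - t) ^ (n / (n - α) - 2 : ℝ)) 0 :=
        ContinuousAt.rpow_const (by fun_prop) (Or.inl (by norm_num))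
      fun_prop
    have := hcont.tendsto
    simp only [sub_zero, Real.one_rpow, sub_self, mul_zero, ne_eq, OfNat.ofNat_ne_zero,
      not_false_eq_true, zero_pow, add_zero] at this
    exact this.mono_left nhdsWithin_le_nhds
  refine ge_of_tendsto hlim ?_
  filter_upwards [Ioc_mem_nhdsGT (show (0 : ℝ) < 1 / 2 by norm_num)] with t ht
  exact key t ht.1 ht.2

/-- The sharp Hardy-Littlewood-Sobolev inequality. -/
theorem energy_le_sharpConst_mul (hn : 0 < n) {α : ℝ} (hα : 0 < α) (hαn : 2 * α < n) {f : V → ℝ}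
    (hf : MemLp f (ENNReal.ofReal (n / (n - α)))) :
    energy α f f ≤ sharpConst n α * (∫ x, |f x| ^ (n / (n - α) : ℝ)) ^ (2 * (n - α) / n) := by
  wlog hm : Measurable f generalizing f with H
  · have hmk := hf.1.ae_eq_mk
    have := H (hf.ae_eq hmk) hf.1.measurable_mk
    rw [energy_congr_ae α hmk hmk]
    refine this.trans (le_of_eq ?_)
    congr 2
    refine integral_congr_ae ?_
    filter_upwards [hmk] with x hx
    rw [hx]
  have hn' : (0 : ℝ) < n := by exact_mod_cast hn
  have hβ : 0 < n - α := by linarith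
  have hp : 0 < n / (n - α) := by positivity
  set F : ℕ → V → ℝ := fun N x => if |f x| ≤ N ∧ ‖x‖ ≤ N then |f x| else 0 with hF
  have hF0 : ∀ N x, 0 ≤ F N x := fun N x => by
    simp only [hF]; split_ifs <;> simp
  have hFle : ∀ N x, F N x ≤ |f x| := fun N x => by
    simp only [hF]; split_ifs <;> simp
  have hFm : ∀ N, Measurable (F N) := fun N =>
    Measurable.ite ((measurableSet_le hm.norm measurable_const).inter
      (measurableSet_le measurable_norm measurable_const)) hm.norm measurable_const
  have hFt : ∀ N : ℕ, IsTestFunction N (F N) := fun N => by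
    refine ⟨hFm N, hF0 N, fun x => ?_, fun x hx => if_neg fun h => absurd h.2 (not_le.2 hx)⟩
    simp only [hF]
    split_ifs with h
    · exact h.1
    · positivity
  have hFlim : ∀ x, Tendsto (fun N => F N x) atTop (𝓝 |f x|) := fun x => by
    refine tendsto_const_nhds.congr' ?_
    obtain ⟨N, hN⟩ := exists_nat_ge (max |f x| ‖x‖)
    filter_upwards [eventually_ge_atTop N] with M hM
    have hNM : (N : ℝ) ≤ M := by exact_mod_cast hM
    exact (if_pos ⟨(le_max_left _ _).trans (hN.trans hNM),
      (le_max_right _ _).trans (hN.trans hNM)⟩).symm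
  have habs : MemLp (fun x => |f x|) (ENNReal.ofReal (n / (n - α))) := hf.norm
  have hE : Tendsto (fun N => energy α (F N) (F N)) atTop
      (𝓝 (energy α (fun x => |f x|) fun x => |f x|)) := by
    refine tendsto_integral_of_dominated_convergence _ (fun N => Measurable.aestronglyMeasurable (by
      have := hFm N; fun_prop)) (integrable_energy hn hα hαn habs habs)
      (fun N => Eventually.of_forall fun z => ?_) (Eventually.of_forall fun z =>
        ((hFlim z.1).mul (hFlim z.2)).mul_const _)
    have hk : 0 ≤ ‖z.1 - z.2‖ ^ (-(2 * α)) := Real.rpow_nonneg (norm_nonneg _) _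
    rw [Real.norm_of_nonneg (mul_nonneg (mul_nonneg (hF0 _ _) (hF0 _ _)) hk)]
    exact mul_le_mul_of_nonneg_right (mul_le_mul (hFle _ _) (hFle _ _) (hF0 _ _) (abs_nonneg _)) hk
  have hle : energy α f f ≤ energy α (fun x => |f x|) fun x => |f x| := by
    refine integral_mono (integrable_energy hn hα hαn hf hf)
      (integrable_energy hn hα hαn habs habs) fun z => ?_
    refine mul_le_mul_of_nonneg_right ?_ (Real.rpow_nonneg (norm_nonneg _) _)
    rw [← abs_mul]
    exact le_abs_self _
  refine hle.trans (le_of_tendsto' hE fun N => ?_)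
  refine energy_le_of_normalized hn hα hαn (sharpConst_nonneg hn hα)
    (fun R f hf h1 => energy_le_sharpConst_of_normalized hn hα hαn hf h1) (hFt N) ?_
  exact integral_mono (integrable_rpow hp ((hFt N).memLp _) (hF0 N))
    (integrable_rpow hp habs fun x => abs_nonneg _)
    fun x => Real.rpow_le_rpow (hF0 N x) (hFle N x) hp.le

end SharpHLS

end HLS
namespace HLS

/-! ### Quantitative monotonicity of the duality map of `L^p`. -/

section Convexity

/-- The remainder is `y^p` instead of `y²`, so that the expansion around one bubble stays integrable
when the other one is not dominated by it. -/
lemma one_add_rpow_le_add_rpow {p y : ℝ} (hp : 1 < p) (hp2 : p < 2) (hy : 0 ≤ y) :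
    (1 + y) ^ p ≤ 1 + p * y + y ^ p := by
  have h1 := rpow_one_add_le_one_add_mul_self (s := y) (by linarith) (p := p - 1) (by linarith)
    (by linarith)
  have h2 := Real.rpow_add_le_add_rpow (p := p - 1) zero_le_one hy (by linarith) (by linarith)
  rw [Real.one_rpow] at h2
  have e1 : (1 + y) ^ p = (1 + y) ^ (p - 1) + y * (1 + y) ^ (p - 1) := by
    rw [Real.rpow_sub_one (by positivity)]
    field_simp
  have e2 : y ^ p = y * y ^ (p - 1) := by
    conv_rhs => rw [← Real.rpow_one_add' hy (by linarith)]
    congr 1; ring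
  have h3 := mul_le_mul_of_nonneg_left h2 hy
  rw [e1, e2]
  linarith

lemma add_rpow_le {p a b : ℝ} (hp : 1 < p) (hp2 : p < 2) (ha : 0 < a) (hb : 0 ≤ b) :
    (a + b) ^ p ≤ a ^ p + p * (a ^ (p - 1) * b) + b ^ p := by
  have h := mul_le_mul_of_nonneg_left (one_add_rpow_le_add_rpow hp hp2 (div_nonneg hb ha.le))
    (Real.rpow_nonneg ha.le p)
  rw [← Real.mul_rpow ha.le (by positivity), Real.div_rpow hb ha.le] at h
  have e : a * (1 + b / a) = a + b := by field_simp
  rw [e] at h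
  refine h.trans (le_of_eq ?_)
  have := (Real.rpow_pos_of_pos ha p).ne'
  rw [Real.rpow_sub_one ha.ne']
  field_simp

/-- The power `p - 1` lies in `(0,1)`, so `x^(p-1)` is concave and lies below its tangent at the
larger of the two points. -/
lemma sq_sub_mul_rpow_le {p a b : ℝ} (hp : 1 < p) (hp2 : p < 2) (ha : 0 < a) (hb : 0 < b) :
    (p - 1) * (a - b) ^ 2 * max a b ^ (p - 2) ≤ (a - b) * (a ^ (p - 1) - b ^ (p - 1)) := by
  wlog hab : b ≤ a generalizing a b with H
  · have := H hb ha (le_of_not_ge hab)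
    rw [max_comm] at this
    linarith
  rw [max_eq_left hab]
  have h := rpow_one_add_le_one_add_mul_self (s := (b - a) / a)
    (by rw [le_div_iff₀ ha]; linarith) (p := p - 1) (by linarith) (by linarith)
  have h2 := mul_le_mul_of_nonneg_left h (Real.rpow_nonneg ha.le (p - 1))
  have e : 1 + (b - a) / a = b / a := by field_simp; ring
  rw [e, ← Real.mul_rpow ha.le (by positivity), mul_div_cancel₀ _ ha.ne'] at h2
  have e2 : a ^ (p - 1) = a ^ (p - 2) * a := by
    rw [← Real.rpow_add_one ha.ne']; congr 1; ring
  have e3 : a ^ (p - 1) * (1 + (p - 1) * ((b - a) / a)) =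
      a ^ (p - 1) - (p - 1) * (a - b) * a ^ (p - 2) := by
    rw [e2]; field_simp; ring
  rw [e3] at h2
  have := mul_le_mul_of_nonneg_left (show (p - 1) * (a - b) * a ^ (p - 2) ≤
    a ^ (p - 1) - b ^ (p - 1) by linarith) (sub_nonneg.2 hab)
  linarith

lemma abs_sub_rpow_le {p a b : ℝ} (hp : 1 < p) (hp2 : p < 2) (ha : 0 < a) (hb : 0 < b) :
    |a - b| ^ p ≤ ((a - b) * (a ^ (p - 1) - b ^ (p - 1)) / (p - 1)) ^ (p / 2) *
      (a ^ p + b ^ p) ^ (1 - p / 2) := by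
  have hm : 0 < max a b := lt_max_of_lt_left ha
  have hmp : 0 < max a b ^ (p - 2) := Real.rpow_pos_of_pos hm _
  have h1 : (a - b) ^ 2 ≤ (a - b) * (a ^ (p - 1) - b ^ (p - 1)) / (p - 1) *
      max a b ^ (2 - p) := by
    have h := sq_sub_mul_rpow_le hp hp2 ha hb
    have e : max a b ^ (2 - p) = (max a b ^ (p - 2))⁻¹ := by
      rw [← Real.rpow_neg hm.le]; congr 1; ring
    rw [e, ← div_eq_mul_inv, div_div, le_div_iff₀ (mul_pos (by linarith) hmp)]
    linarith
  have h0 : 0 ≤ (a - b) * (a ^ (p - 1) - b ^ (p - 1)) / (p - 1) := by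
    have := (mul_nonneg (mul_nonneg (show 0 ≤ p - 1 by linarith) (sq_nonneg (a - b))) hmp.le).trans
      (sq_sub_mul_rpow_le hp hp2 ha hb)
    exact div_nonneg this (by linarith)
  have h2 : max a b ^ p ≤ a ^ p + b ^ p := by
    rcases max_cases a b with h | h <;> rw [h.1]
    · linarith [Real.rpow_nonneg hb.le p]
    · linarith [Real.rpow_nonneg ha.le p]
  have e : |a - b| ^ p = ((a - b) ^ 2) ^ (p / 2) := by
    rw [← sq_abs, ← Real.rpow_natCast, ← Real.rpow_mul (abs_nonneg _)]
    congr 1; push_cast; ring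
  rw [e]
  refine (Real.rpow_le_rpow (sq_nonneg _) h1 (by linarith)).trans ?_
  rw [Real.mul_rpow h0 (Real.rpow_nonneg hm.le _)]
  refine mul_le_mul_of_nonneg_left ?_ (Real.rpow_nonneg h0 _)
  rw [← Real.rpow_mul hm.le, show (2 - p) * (p / 2) = p * (1 - p / 2) by ring, Real.rpow_mul hm.le]
  exact Real.rpow_le_rpow (Real.rpow_nonneg hm.le _) h2 (by linarith)

/-- A quantitative strict monotonicity of the duality map of `L^p` for `1 < p < 2`. -/
lemma integral_abs_sub_rpow_le {X : Type*} [MeasurableSpace X] {μ : Measure X} {p : ℝ} (hp : 1 < p)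
    (hp2 : p < 2) {a b : X → ℝ} (ha : Measurable a) (hb : Measurable b) (ha0 : ∀ x, 0 < a x)
    (hb0 : ∀ x, 0 < b x) (hai : Integrable (fun x => a x ^ p) μ)
    (hbi : Integrable (fun x => b x ^ p) μ)
    (hab : Integrable (fun x => (a x - b x) * (a x ^ (p - 1) - b x ^ (p - 1))) μ) :
    (∫ x, |a x - b x| ^ p ∂μ) ^ (2 / p) ≤
      (∫ x, (a x - b x) * (a x ^ (p - 1) - b x ^ (p - 1)) ∂μ) / (p - 1) *
        ((∫ x, a x ^ p ∂μ) + ∫ x, b x ^ p ∂μ) ^ (2 / p - 1) := by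
  set u : X → ℝ := fun x => (a x - b x) * (a x ^ (p - 1) - b x ^ (p - 1)) / (p - 1) with hu
  set v : X → ℝ := fun x => a x ^ p + b x ^ p with hv
  have hu0 : ∀ x, 0 ≤ u x := fun x => by
    have := (mul_nonneg (mul_nonneg (show 0 ≤ p - 1 by linarith) (sq_nonneg (a x - b x)))
      (Real.rpow_nonneg (lt_max_of_lt_left (ha0 x)).le _)).trans
      (sq_sub_mul_rpow_le hp hp2 (ha0 x) (hb0 x))
    exact div_nonneg this (by linarith)
  have hv0 : ∀ x, 0 ≤ v x := fun x =>
    add_nonneg (Real.rpow_nonneg (ha0 x).le _) (Real.rpow_nonneg (hb0 x).le _)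
  have hui : Integrable u μ := hab.div_const _
  have hvi : Integrable v μ := hai.add hbi
  have hI : 0 ≤ ∫ x, u x ∂μ := integral_nonneg hu0
  have hJ : 0 ≤ ∫ x, v x ∂μ := integral_nonneg hv0
  have key : ∫ x, |a x - b x| ^ p ∂μ ≤ (∫ x, u x ∂μ) ^ (p / 2) * (∫ x, v x ∂μ) ^ (1 - p / 2) := by
    rw [integral_eq_lintegral_of_nonneg_ae
      (Eventually.of_forall fun x => Real.rpow_nonneg (abs_nonneg _) _)
      (Measurable.aestronglyMeasurable (by fun_prop))]
    refine ENNReal.toReal_le_of_le_ofReal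
      (mul_nonneg (Real.rpow_nonneg hI _) (Real.rpow_nonneg hJ _)) ?_
    rw [ENNReal.ofReal_mul (Real.rpow_nonneg hI _),
      ← ENNReal.ofReal_rpow_of_nonneg hI (by linarith),
      ← ENNReal.ofReal_rpow_of_nonneg hJ (by linarith),
      ofReal_integral_eq_lintegral_ofReal hui (Eventually.of_forall hu0),
      ofReal_integral_eq_lintegral_ofReal hvi (Eventually.of_forall hv0)]
    -- Hölder's inequality with the weights `p/2` and `1 - p/2`, after the pointwise bound.
    refine le_trans (lintegral_mono fun x => ?_) (ENNReal.lintegral_mul_norm_pow_le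
      hui.1.aemeasurable.ennreal_ofReal hvi.1.aemeasurable.ennreal_ofReal
      (by linarith) (by linarith) (by ring))
    rw [ENNReal.ofReal_rpow_of_nonneg (hu0 x) (by linarith),
      ENNReal.ofReal_rpow_of_nonneg (hv0 x) (by linarith),
      ← ENNReal.ofReal_mul (Real.rpow_nonneg (hu0 x) _)]
    exact ENNReal.ofReal_le_ofReal (abs_sub_rpow_le hp hp2 (ha0 x) (hb0 x))
  have h0 : 0 ≤ ∫ x, |a x - b x| ^ p ∂μ :=
    integral_nonneg fun x => Real.rpow_nonneg (abs_nonneg _) _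
  refine (Real.rpow_le_rpow h0 key (by positivity)).trans (le_of_eq ?_)
  rw [Real.mul_rpow (Real.rpow_nonneg hI _) (Real.rpow_nonneg hJ _), ← Real.rpow_mul hI,
    ← Real.rpow_mul hJ, show p / 2 * (2 / p) = 1 by field_simp, Real.rpow_one,
    show (1 - p / 2) * (2 / p) = 2 / p - 1 by field_simp, hu, integral_div, hv,
    integral_add hai hbi]

end Convexity

/-! ### Extremality of the bubbles and the reverse inequality for their differences. -/

section Bubbles

variable {n : ℕ}

local notation "V" => EuclideanSpace ℝ (Fin n)

/-- The bubbles, normalized to have the same norm. -/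
noncomputable def conformalBubble (α : ℝ) (x₀ : EuclideanSpace ℝ (Fin n)) (τ : ℝ)
    (x : EuclideanSpace ℝ (Fin n)) : ℝ :=
  weight x₀ τ x ^ (-(n - α))

lemma conformalBubble_pos (α : ℝ) (x₀ : V) (τ : ℝ) (x : V) : 0 < conformalBubble α x₀ τ x :=
  Real.rpow_pos_of_pos (weight_pos _ _ _) _

lemma measurable_conformalBubble (α : ℝ) (x₀ : V) (τ : ℝ) : Measurable (conformalBubble α x₀ τ) :=
  measurable_weight_rpow x₀ τ _

lemma memLp_conformalBubble (hn : 0 < n) {α : ℝ} (hα : 0 < α) (hαn : 2 * α < n) (x₀ : V) (τ : ℝ) :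
    MemLp (conformalBubble α x₀ τ) (ENNReal.ofReal (n / (n - α))) :=
  memLp_weight_rpow hn (by linarith) x₀ τ

lemma conformalBubble_rpow {α : ℝ} (hα : 0 < α) (hαn : 2 * α < n) (x₀ : V) (τ : ℝ) (x : V) :
    conformalBubble α x₀ τ x ^ (n / (n - α) : ℝ) = weight x₀ τ x ^ (-(n : ℝ)) := by
  have hβ : (n : ℝ) - α ≠ 0 := by linarith
  rw [conformalBubble, ← Real.rpow_mul (weight_pos _ _ _).le]
  congr 1
  field_simp

lemma conformalBubble_rpow_sub_one {α : ℝ} (hα : 0 < α) (hαn : 2 * α < n) (x₀ : V) (τ : ℝ) (x : V) :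
    conformalBubble α x₀ τ x ^ (n / (n - α) - 1 : ℝ) = weight x₀ τ x ^ (-α) := by
  have hβ : (n : ℝ) - α ≠ 0 := by linarith
  rw [conformalBubble, ← Real.rpow_mul (weight_pos _ _ _).le]
  congr 1
  field_simp
  ring

lemma integral_conformalBubble_rpow {α : ℝ} (hα : 0 < α) (hαn : 2 * α < n) (x₀ : V) (τ : ℝ) :
    ∫ x, conformalBubble α x₀ τ x ^ (n / (n - α) : ℝ) = bubbleMass n := by
  simp only [conformalBubble_rpow hα hαn, integral_weight]

/-- The bubbles are extremal in the sharp Hardy-Littlewood-Sobolev inequality. -/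
lemma energy_conformalBubble (hn : 0 < n) {α : ℝ} (hα : 0 < α) (hαn : 2 * α < n) (x₀ : V) (τ : ℝ) :
    energy α (conformalBubble α x₀ τ) (conformalBubble α x₀ τ) =
      sharpConst n α * bubbleMass n ^ (2 * (n - α) / n) := by
  refine le_antisymm ?_ (le_energy_bubble hn hα hαn x₀ τ)
  have h := energy_le_sharpConst_mul hn hα hαn (memLp_conformalBubble hn hα hαn x₀ τ)
  simp only [abs_of_pos (conformalBubble_pos α x₀ τ _)] at h
  rwa [integral_conformalBubble_rpow hα hαn] at h

/-- The constant contains a `tsum`, which would be zero if it diverged. Positivity is read off from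
the energy of a bubble instead, whose integrand is positive almost everywhere. -/
lemma sharpConst_pos (hn : 0 < n) {α : ℝ} (hα : 0 < α) (hαn : 2 * α < n) : 0 < sharpConst n α := by
  refine (sharpConst_nonneg hn hα).lt_of_ne' fun h => ?_
  have hE := energy_conformalBubble hn hα hαn 0 0
  have hb := memLp_conformalBubble (n := n) hn hα hαn 0 0
  have hnn : ∀ z : V × V, 0 ≤ conformalBubble α 0 0 z.1 * conformalBubble α 0 0 z.2 *
      ‖z.1 - z.2‖ ^ (-(2 * α)) := fun z =>
    mul_nonneg (mul_pos (conformalBubble_pos _ _ _ _) (conformalBubble_pos _ _ _ _)).le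
      (Real.rpow_nonneg (norm_nonneg _) _)
  rw [h, zero_mul, energy, integral_eq_zero_iff_of_nonneg hnn (integrable_energy hn hα hαn hb hb)]
    at hE
  have hF : ∀ᵐ _ : V × V, False := by
    filter_upwards [hE, ae_fst_ne_snd hn] with z hz hne
    have : 0 < ‖z.1 - z.2‖ := norm_pos_iff.2 (sub_ne_zero.2 hne)
    exact (mul_pos (mul_pos (conformalBubble_pos α 0 0 z.1) (conformalBubble_pos α 0 0 z.2))
      (Real.rpow_pos_of_pos this _)).ne' hz
  rw [eventually_false_iff_eq_bot, ae_eq_bot] at hF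
  exact (NeZero.ne (volume : Measure (V × V))) hF

lemma integrable_conformalBubble_mul (hn : 0 < n) {α : ℝ} (hα : 0 < α) (hαn : 2 * α < n)
    (x₁ x₂ : V) (τ₁ τ₂ : ℝ) :
    Integrable fun x => conformalBubble α x₁ τ₁ x ^ (n / (n - α) - 1 : ℝ) *
      conformalBubble α x₂ τ₂ x := by
  simp only [conformalBubble_rpow_sub_one hα hαn]
  simpa only [mul_comm] using
    integrable_mul_weight hn hα hαn (memLp_conformalBubble hn hα hαn x₂ τ₂) x₁ τ₁

/-- The first variation of the sharp inequality at a bubble in the direction of another one. -/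
lemma energy_conformalBubble_le (hn : 0 < n) {α : ℝ} (hα : 0 < α) (hαn : 2 * α < n)
    (x₁ x₂ : V) (τ₁ τ₂ : ℝ) :
    energy α (conformalBubble α x₁ τ₁) (conformalBubble α x₂ τ₂) ≤
      sharpConst n α * bubbleMass n ^ (2 * (n - α) / n) / bubbleMass n *
        ∫ x, conformalBubble α x₁ τ₁ x ^ (n / (n - α) - 1 : ℝ) * conformalBubble α x₂ τ₂ x := by
  have hn' : (0 : ℝ) < n := by exact_mod_cast hn
  have hβ : 0 < n - α := by linarith
  have hE1 := energy_conformalBubble hn hα hαn x₁ τ₁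
  have hE2 := energy_conformalBubble hn hα hαn x₂ τ₂
  have hZ := bubbleMass_pos hn
  have hS := sharpConst_pos hn hα hαn
  have hm1 := memLp_conformalBubble hn hα hαn x₁ τ₁
  have hm2 := memLp_conformalBubble hn hα hαn x₂ τ₂
  have hb1 := conformalBubble_pos α x₁ τ₁
  have hb2 := conformalBubble_pos α x₂ τ₂
  have hI1 := integral_conformalBubble_rpow hα hαn x₁ τ₁
  have hI2 := integral_conformalBubble_rpow hα hαn x₂ τ₂
  have hY := integrable_conformalBubble_mul hn hα hαn x₁ x₂ τ₁ τ₂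
  have hexp := fun t => energy_add_smul_self hn hα hαn hm1 hm2 t
  have hsharp := fun t : ℝ => energy_le_sharpConst_mul hn hα hαn (hm1.add (hm2.const_smul t))
  obtain ⟨hp1, hp2⟩ := exponent_bounds hα hαn
  have hγ : (2 * (n - α) / n : ℝ) * (n / (n - α)) = 2 := by field_simp
  have hγ1 : (1 : ℝ) ≤ 2 * (n - α) / n := (one_le_div hn').2 (by linarith)
  have hγ2 : (2 * (n - α) / n : ℝ) ≤ 2 := (div_le_iff₀ hn').2 (by linarith)
  set p : ℝ := n / (n - α) with hp
  set γ : ℝ := 2 * (n - α) / n with hγdef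
  set b₁ := conformalBubble α x₁ τ₁
  set b₂ := conformalBubble α x₂ τ₂
  set Z := bubbleMass n
  set S := sharpConst n α
  set Y := ∫ x, b₁ x ^ (p - 1) * b₂ x
  have hY0 : 0 ≤ Y := integral_nonneg fun x =>
    mul_nonneg (Real.rpow_nonneg (hb1 x).le _) (hb2 x).le
  have i1 : Integrable fun x => b₁ x ^ p := integrable_rpow (by linarith) hm1 fun x => (hb1 x).le
  have i2 : Integrable fun x => b₂ x ^ p := integrable_rpow (by linarith) hm2 fun x => (hb2 x).le
  have hε : 0 < S * Z ^ γ := mul_pos hS (Real.rpow_pos_of_pos hZ _)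
  -- The sharp inequality for `b₁ + t b₂` with its zeroth-order terms cancelled, divided by `2t`.
  -- The errors vanish as `t → 0+` because `p > 1`; positive `t` suffices for the one-sided bound.
  have key : ∀ t : ℝ, 0 < t → energy α b₁ b₂ ≤ S * Z ^ γ / 2 *
      (2 * Y / Z + γ * t ^ (p - 1) + t * (p * Y / Z + t ^ (p - 1)) ^ 2) := by
    intro t ht
    have hle : energy α (b₁ + t • b₂) (b₁ + t • b₂) ≤
        S * (Z + p * t * Y + t ^ p * Z) ^ γ := by
      refine (hsharp t).trans (mul_le_mul_of_nonneg_left ?_ hS.le)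
      refine Real.rpow_le_rpow (integral_nonneg fun x => Real.rpow_nonneg (abs_nonneg _) _) ?_
        (by linarith)
      have i12 : Integrable fun x => b₁ x ^ p + p * t * (b₁ x ^ (p - 1) * b₂ x) :=
        i1.add (hY.const_mul _)
      have i3 : Integrable fun x => b₁ x ^ p + p * t * (b₁ x ^ (p - 1) * b₂ x) +
          t ^ p * b₂ x ^ p := i12.add (i2.const_mul _)
      have hint : ∫ x, (b₁ x ^ p + p * t * (b₁ x ^ (p - 1) * b₂ x) + t ^ p * b₂ x ^ p) =
          Z + p * t * Y + t ^ p * Z := by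
        rw [integral_add i12 (i2.const_mul _), integral_add i1 (hY.const_mul _),
          integral_const_mul, integral_const_mul, hI1, hI2]
      rw [← hint]
      refine integral_mono_of_nonneg
        (Eventually.of_forall fun x => Real.rpow_nonneg (abs_nonneg _) _) i3
        (Eventually.of_forall fun x => ?_)
      have h0 : 0 ≤ t * b₂ x := (mul_pos ht (hb2 x)).le
      simp only [Pi.add_apply, Pi.smul_apply, smul_eq_mul]
      rw [abs_of_pos (by linarith [hb1 x])]
      refine (add_rpow_le hp1 hp2 (hb1 x) h0).trans (le_of_eq ?_)
      rw [Real.mul_rpow ht.le (hb2 x).le]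
      ring
    have e : Z + p * t * Y + t ^ p * Z = Z * (1 + (p * t * Y / Z + t ^ p)) := by
      field_simp
      ring
    have hy0 : 0 ≤ p * t * Y / Z + t ^ p := by positivity
    rw [hexp t, e, Real.mul_rpow hZ.le (by linarith), hE1, hE2] at hle
    have h3 := mul_le_mul_of_nonneg_left (one_add_rpow_le hγ1 hγ2 hy0) hε.le
    have e2 : t ^ p = t * t ^ (p - 1) := by
      rw [Real.rpow_sub_one ht.ne']; field_simp
    have h4 := hle.trans ((mul_assoc _ _ _).symm.le.trans h3)
    have h5 : 0 ≤ t ^ 2 * (S * Z ^ γ) := by positivity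
    have e3 : S * Z ^ γ * (1 + γ * (p * t * Y / Z + t ^ p) + (p * t * Y / Z + t ^ p) ^ 2) =
        S * Z ^ γ + 2 * t * (S * Z ^ γ / 2 *
          (2 * Y / Z + γ * t ^ (p - 1) + t * (p * Y / Z + t ^ (p - 1)) ^ 2)) := by
      rw [e2]
      linear_combination (S * Z ^ γ * t * Y / Z) * hγ
    rw [e3] at h4
    have h6 : 2 * t * energy α b₁ b₂ ≤ 2 * t * (S * Z ^ γ / 2 *
          (2 * Y / Z + γ * t ^ (p - 1) + t * (p * Y / Z + t ^ (p - 1)) ^ 2)) := by linarith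
    exact le_of_mul_le_mul_left h6 (by linarith)
  have hcont : ContinuousAt (fun t : ℝ => S * Z ^ γ / 2 *
      (2 * Y / Z + γ * t ^ (p - 1) + t * (p * Y / Z + t ^ (p - 1)) ^ 2)) 0 := by
    have : ContinuousAt (fun t : ℝ => t ^ (p - 1)) 0 :=
      continuousAt_id.rpow_const (Or.inr (by linarith))
    fun_prop
  have hlim := hcont.tendsto
  simp only [Real.zero_rpow (show p - 1 ≠ 0 by linarith), mul_zero, zero_mul, add_zero] at hlim
  refine (ge_of_tendsto (hlim.mono_left nhdsWithin_le_nhds) (b := energy α b₁ b₂)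
    (x := 𝓝[>] 0) ?_).trans (le_of_eq ?_)
  · filter_upwards [self_mem_nhdsWithin] with t ht
    exact key t ht
  · field_simp

/-- A reverse form of the sharp inequality for differences of bubbles. -/
lemma integral_sub_conformalBubble_le (hn : 0 < n) {α : ℝ} (hα : 0 < α) (hαn : 2 * α < n)
    (x₁ x₂ : V) (τ₁ τ₂ : ℝ) :
    sharpConst n α * (∫ x, |conformalBubble α x₁ τ₁ x - conformalBubble α x₂ τ₂ x| ^
        (n / (n - α) : ℝ)) ^ (2 * (n - α) / n) ≤
      2 ^ (2 * (n - α) / n - 1 : ℝ) * ((n - α) / α) *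
        energy α (conformalBubble α x₁ τ₁ - conformalBubble α x₂ τ₂)
          (conformalBubble α x₁ τ₁ - conformalBubble α x₂ τ₂) := by
  have hn' : (0 : ℝ) < n := by exact_mod_cast hn
  have hβ : 0 < n - α := by linarith
  have hE1 := energy_conformalBubble hn hα hαn x₁ τ₁
  have hE2 := energy_conformalBubble hn hα hαn x₂ τ₂
  have hZ := bubbleMass_pos hn
  have hS := sharpConst_pos hn hα hαn
  have hm1 := memLp_conformalBubble hn hα hαn x₁ τ₁
  have hm2 := memLp_conformalBubble hn hα hαn x₂ τ₂
  have hb1 := conformalBubble_pos α x₁ τ₁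
  have hb2 := conformalBubble_pos α x₂ τ₂
  have hI1 := integral_conformalBubble_rpow hα hαn x₁ τ₁
  have hI2 := integral_conformalBubble_rpow hα hαn x₂ τ₂
  have hY12 := integrable_conformalBubble_mul hn hα hαn x₁ x₂ τ₁ τ₂
  have hY21 := integrable_conformalBubble_mul hn hα hαn x₂ x₁ τ₂ τ₁
  have hY11 := integrable_conformalBubble_mul hn hα hαn x₁ x₁ τ₁ τ₁
  have hY22 := integrable_conformalBubble_mul hn hα hαn x₂ x₂ τ₂ τ₂
  have hV12 := energy_conformalBubble_le hn hα hαn x₁ x₂ τ₁ τ₂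
  have hV21 := energy_conformalBubble_le hn hα hαn x₂ x₁ τ₂ τ₁
  have hq1 := measurable_conformalBubble α x₁ τ₁
  have hq2 := measurable_conformalBubble α x₂ τ₂
  have hexp := energy_add_smul_self hn hα hαn hm1 hm2 (-1)
  rw [energy_comm] at hV21
  obtain ⟨hp1, hp2⟩ := exponent_bounds hα hαn
  have hpα : (n / (n - α) : ℝ) - 1 = α / (n - α) := by field_simp; ring
  have hγ : (2 / (n / (n - α)) : ℝ) = 2 * (n - α) / n := by field_simp
  set p : ℝ := n / (n - α) with hp
  set γ : ℝ := 2 * (n - α) / n with hγdef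
  set b₁ := conformalBubble α x₁ τ₁
  set b₂ := conformalBubble α x₂ τ₂
  set Z := bubbleMass n
  set S := sharpConst n α
  have hself : ∀ {b : V → ℝ}, (∀ x, 0 < b x) → ∀ x, b x ^ (p - 1) * b x = b x ^ p := by
    intro b hb x
    rw [← Real.rpow_add_one (hb x).ne', sub_add_cancel]
  simp only [hself hb1] at hY11
  simp only [hself hb2] at hY22
  have hD : ∀ x, (b₁ x - b₂ x) * (b₁ x ^ (p - 1) - b₂ x ^ (p - 1)) = b₁ x ^ p + b₂ x ^ p -
      (b₁ x ^ (p - 1) * b₂ x + b₂ x ^ (p - 1) * b₁ x) := fun x => by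
    rw [← hself hb1, ← hself hb2]; ring
  have i1 : Integrable fun x => b₁ x ^ p + b₂ x ^ p := hY11.add hY22
  have i2 : Integrable fun x => b₁ x ^ (p - 1) * b₂ x + b₂ x ^ (p - 1) * b₁ x := hY12.add hY21
  have iD : Integrable fun x => (b₁ x - b₂ x) * (b₁ x ^ (p - 1) - b₂ x ^ (p - 1)) := by
    simp only [hD]
    exact i1.sub i2
  have hX := integral_abs_sub_rpow_le hp1 hp2 hq1 hq2 hb1 hb2 hY11 hY22 iD
  have hXval : ∫ x, (b₁ x - b₂ x) * (b₁ x ^ (p - 1) - b₂ x ^ (p - 1)) = 2 * Z -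
      ((∫ x, b₁ x ^ (p - 1) * b₂ x) + ∫ x, b₂ x ^ (p - 1) * b₁ x) := by
    simp only [hD]
    rw [integral_sub i1 i2, integral_add hY11 hY22, integral_add hY12 hY21, hI1, hI2]
    ring
  rw [hXval, hI1, hI2, hγ, ← two_mul, Real.mul_rpow (by norm_num) hZ.le] at hX
  set Y₁ := ∫ x, b₁ x ^ (p - 1) * b₂ x
  set Y₂ := ∫ x, b₂ x ^ (p - 1) * b₁ x
  rw [hpα] at hX
  have hdiff : energy α (b₁ - b₂) (b₁ - b₂) = 2 * (S * Z ^ γ) - 2 * energy α b₁ b₂ := by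
    rw [hE1, hE2, neg_one_smul, ← sub_eq_add_neg] at hexp
    rw [hexp]; ring
  -- The first variation is used at both bubbles, which symmetrizes the pairing into `∫ (b₁ -
  -- b₂)(b₁^(p-1) - b₂^(p-1))`.
  have hlow : S * Z ^ γ / Z * (2 * Z - (Y₁ + Y₂)) ≤ energy α (b₁ - b₂) (b₁ - b₂) := by
    rw [hdiff]
    have : S * Z ^ γ / Z * (2 * Z) = 2 * (S * Z ^ γ) := by field_simp
    linarith
  have h1 := mul_le_mul_of_nonneg_left hX hS.le
  refine h1.trans (le_trans (le_of_eq ?_) (mul_le_mul_of_nonneg_left hlow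
    (show (0 : ℝ) ≤ 2 ^ (γ - 1) * ((n - α) / α) by positivity)))
  rw [Real.rpow_sub_one hZ.ne']
  field_simp

end Bubbles

end HLS
namespace HLS

/-! ### Nearest points and comparison of the remainders. -/

section Decomposition

variable {n : ℕ}

local notation "V" => EuclideanSpace ℝ (Fin n)

lemma bubble_comp_eq (s : ℝ) (x₀ : V) (τ : ℝ) (x : V) :
    bubble n s ((Real.exp τ)⁻¹ • (x - x₀)) =
      Real.exp τ ^ ((n + 2 * s) / 2) * conformalBubble (n / 2 - s) x₀ τ x := by
  have h1 : 1 + ‖(Real.exp τ)⁻¹ • (x - x₀)‖ ^ 2 = weight 0 0 ((Real.exp τ)⁻¹ • (x - x₀)) := by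
    simp [weight]
  have he := Real.exp_pos τ
  rw [bubble, h1, conformalBubble, weight_eq_zero_frame x₀ τ x, Real.exp_neg,
    Real.mul_rpow he.le (weight_pos _ _ _).le, ← mul_assoc, ← Real.rpow_add he,
    show ((n : ℝ) + 2 * s) / 2 + -(n - (n / 2 - s)) = 0 by ring, Real.rpow_zero, one_mul]
  congr 1
  ring

lemma exists_eq_smul_conformalBubble {s : ℝ} {h : V → ℝ} (hh : h ∈ optimizers n s) :
    ∃ (c : ℝ) (x₀ : V) (τ : ℝ), h = c • conformalBubble (n / 2 - s) x₀ τ := by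
  obtain ⟨c, x₀, a, ha, rfl⟩ := hh
  refine ⟨c * Real.exp (Real.log a) ^ ((n + 2 * s) / 2), x₀, Real.log a, ?_⟩
  ext x
  have := bubble_comp_eq s x₀ (Real.log a) x
  rw [Real.exp_log ha] at this ⊢
  rw [this, Pi.smul_apply, smul_eq_mul, mul_assoc]

lemma smul_conformalBubble_mem_optimizers (s c : ℝ) (x₀ : V) (τ : ℝ) :
    c • conformalBubble (n / 2 - s) x₀ τ ∈ optimizers n s := by
  refine ⟨c * (Real.exp τ ^ ((n + 2 * s) / 2))⁻¹, x₀, Real.exp τ, Real.exp_pos τ, ?_⟩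
  ext x
  have h0 := (Real.rpow_pos_of_pos (Real.exp_pos τ) ((n + 2 * s) / 2)).ne'
  simp only [bubble_comp_eq, Pi.smul_apply, smul_eq_mul]
  field_simp

/-- The parallelogram law, with the energy of `u + v` discarded. -/
lemma energy_sub_self_le (hn : 0 < n) {α : ℝ} (hα : 0 < α) (hαn : 2 * α < n)
    (hpos : ∀ f : V → ℝ, MemLp f (ENNReal.ofReal (n / (n - α))) → 0 ≤ energy α f f) {u v : V → ℝ}
    (hu : MemLp u (ENNReal.ofReal (n / (n - α)))) (hv : MemLp v (ENNReal.ofReal (n / (n - α)))) :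
    energy α (u - v) (u - v) ≤ 2 * energy α u u + 2 * energy α v v := by
  have h1 := energy_add_smul_self hn hα hαn hu hv (-1)
  have h2 := energy_add_smul_self hn hα hαn hu hv 1
  rw [neg_one_smul, ← sub_eq_add_neg] at h1
  have h3 := hpos _ (hu.add (hv.const_smul (1 : ℝ)))
  linarith

/-- The energies of two differences compare as the negative Sobolev norms do. -/
lemma energy_le_energy_of_negSobolevNorm_le (hn : 0 < n) {s : ℝ} (hs : 0 < s) (hsn : s < (n : ℝ) / 2)
    {u v : V → ℝ} (hu : MemLp u (hlsExponent n s)) (hv : MemLp v (hlsExponent n s))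
    (h : negSobolevNorm n s u ≤ negSobolevNorm n s v) :
    energy (n / 2 - s) u u ≤ energy (n / 2 - s) v v := by
  obtain ⟨C, hC, hN⟩ := exists_negSobolevNorm_eq hn hs hsn
  rw [(hN u hu).2, (hN v hv).2, ENNReal.rpow_le_rpow_iff (by norm_num),
    ENNReal.ofReal_le_ofReal_iff (mul_nonneg hC.le (hN v hv).1)] at h
  exact le_of_mul_le_mul_left h hC

/-- A nearest point is a nonnegative multiple of a bubble, and the coefficient determines the
distance. -/
lemma IsDecomposition.exists_eq_smul (hn : 0 < n) {s : ℝ} (hs : 0 < s) (hsn : s < (n : ℝ) / 2)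
    {g φ r : V → ℝ} (hg : MemLp g (hlsExponent n s)) (hg0 : 0 ≤ᵐ[volume] g)
    (h : IsDecomposition n s g φ r) :
    ∃ (c : ℝ) (x₀ : V) (τ : ℝ), 0 ≤ c ∧ φ = c • conformalBubble (n / 2 - s) x₀ τ ∧
      energy (n / 2 - s) (g - φ) (g - φ) = energy (n / 2 - s) g g - c ^ 2 *
        (sharpConst n (n / 2 - s) * bubbleMass n ^ (2 * (n - (n / 2 - s)) / n)) := by
  obtain ⟨c, x₀, τ, rfl⟩ := exists_eq_smul_conformalBubble h.mem_optimizers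
  have hα : 0 < (n : ℝ) / 2 - s := by linarith
  have hαn : 2 * ((n : ℝ) / 2 - s) < n := by linarith
  have hdist := h.dist_eq_iInf
  have hmin : ∀ t : ℝ, energy (n / 2 - s) (g - c • conformalBubble (n / 2 - s) x₀ τ)
      (g - c • conformalBubble (n / 2 - s) x₀ τ) ≤
      energy (n / 2 - s) (g - (c - t) • conformalBubble (n / 2 - s) x₀ τ)
      (g - (c - t) • conformalBubble (n / 2 - s) x₀ τ) := fun t => by
    have hb : MemLp (conformalBubble (n / 2 - s) x₀ τ) (hlsExponent n s) := by
      rw [hlsExponent_eq]; exact memLp_conformalBubble hn hα hαn x₀ τ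
    refine energy_le_energy_of_negSobolevNorm_le hn hs hsn (hg.sub (hb.const_smul c))
      (hg.sub (hb.const_smul (c - t))) ?_
    rw [hdist]
    exact iInf₂_le _ (smul_conformalBubble_mem_optimizers s (c - t) x₀ τ)
  rw [hlsExponent_eq] at hg
  have hE := energy_conformalBubble hn hα hαn x₀ τ
  have hε : 0 < sharpConst n (n / 2 - s) * bubbleMass n ^ (2 * (n - (n / 2 - s)) / n : ℝ) :=
    mul_pos (sharpConst_pos hn hα hαn) (Real.rpow_pos_of_pos (bubbleMass_pos hn) _)
  have hb := memLp_conformalBubble hn hα hαn x₀ τ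
  have hbpos := conformalBubble_pos ((n : ℝ) / 2 - s) x₀ τ
  set α := (n : ℝ) / 2 - s
  set b := conformalBubble α x₀ τ
  set ε := sharpConst n α * bubbleMass n ^ (2 * (n - α) / n : ℝ)
  have hexp : ∀ t : ℝ, energy α (g - t • b) (g - t • b) =
      energy α g g - 2 * t * energy α g b + t ^ 2 * ε := fun t => by
    have := energy_add_smul_self hn hα hαn hg hb (-t)
    rw [neg_smul, ← sub_eq_add_neg, hE] at this
    rw [this]
    ring
  -- Stationarity in the coefficient: the competitors `(c - t) • b` stay in the set, and the energy
  -- is quadratic in `t`.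
  have hzero : c * ε - energy α g b = 0 := by
    refine eq_zero_of_forall_mul_le (B := ε / 2) (by positivity) fun t => ?_
    have := hmin t
    rw [hexp, hexp] at this
    nlinarith
  have hgb : energy α g b = c * ε := by linarith
  refine ⟨c, x₀, τ, ?_, rfl, ?_⟩
  -- The one place where the sign of `g` enters. Without it the coefficients of two nearest points
  -- would agree only up to sign.
  · have : 0 ≤ energy α g b := by
      rw [energy, Measure.volume_eq_prod]
      refine integral_nonneg_of_ae ?_
      filter_upwards [Measure.quasiMeasurePreserving_fst.ae hg0] with z hz
      exact mul_nonneg (mul_nonneg hz (hbpos _).le) (Real.rpow_nonneg (norm_nonneg _) _)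
    rw [hgb] at this
    exact nonneg_of_mul_nonneg_left this hε
  · rw [hexp, hgb]
    ring

lemma IsDecomposition.remainder_ae_eq {s : ℝ} {g φ r : V → ℝ} (h : IsDecomposition n s g φ r) :
    g - φ =ᵐ[volume] r := by
  filter_upwards [h.eq_add] with x hx
  simp [hx]

lemma sq_stability_const (hn : 0 < n) {s : ℝ} (hs : 0 < s) (hsn : s < (n : ℝ) / 2) :
    ((2 : ℝ) ^ (1 + s / n) * Real.sqrt ((n + 2 * s) / (n - 2 * s))) ^ 2 =
      4 * (2 ^ (2 * (n - (n / 2 - s)) / n - 1 : ℝ) *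
        ((n - (n / 2 - s)) / (n / 2 - s))) := by
  have hn' : (0 : ℝ) < n := by exact_mod_cast hn
  have h2 : (0 : ℝ) < n - 2 * s := by linarith
  have h3 : (n : ℝ) / 2 - s ≠ 0 := by linarith
  rw [mul_pow, Real.sq_sqrt (by positivity), Real.rpow_one_add' (by norm_num) (by positivity),
    mul_pow, ← Real.rpow_natCast (2 ^ (s / n)), ← Real.rpow_mul (by norm_num), ← mul_assoc]
  congr 1
  · congr 1
    · norm_num
    · congr 1
      push_cast
      field_simp
      ring
  · rw [div_eq_div_iff h2.ne' h3]
    ring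

/-- The distance of two nearest points is controlled by the remainder. -/
lemma IsDecomposition.eLpNorm_sub_le (hn : 0 < n) {s : ℝ} (hs : 0 < s) (hsn : s < (n : ℝ) / 2)
    {g φ₁ r₁ φ₂ r₂ : V → ℝ} (hg : MemLp g (hlsExponent n s)) (hg0 : 0 ≤ᵐ[volume] g)
    (h₁ : IsDecomposition n s g φ₁ r₁) (h₂ : IsDecomposition n s g φ₂ r₂) :
    eLpNorm (φ₁ - φ₂) (hlsExponent n s) volume ≤
      ENNReal.ofReal (2 ^ (1 + s / n) * Real.sqrt ((n + 2 * s) / (n - 2 * s))) *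
        eLpNorm r₁ (hlsExponent n s) volume := by
  have hn' : (0 : ℝ) < n := by exact_mod_cast hn
  have hα : 0 < (n : ℝ) / 2 - s := by linarith
  have hαn : 2 * ((n : ℝ) / 2 - s) < n := by linarith
  have hβ : 0 < (n : ℝ) - (n / 2 - s) := by linarith
  have hpos : ∀ f : V → ℝ, MemLp f (ENNReal.ofReal (n / (n - (n / 2 - s)))) →
      0 ≤ energy (n / 2 - s) f f := fun f hf => by
    obtain ⟨C, hC, hN⟩ := exists_negSobolevNorm_eq hn hs hsn
    rw [hlsExponent_eq] at hN
    exact (hN f hf).1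
  have hconst := sq_stability_const hn hs hsn
  have hr := h₁.remainder_ae_eq
  obtain ⟨c₁, x₁, τ₁, hc₁, hφ₁, hE₁⟩ := h₁.exists_eq_smul hn hs hsn hg hg0
  obtain ⟨c₂, x₂, τ₂, hc₂, hφ₂, hE₂⟩ := h₂.exists_eq_smul hn hs hsn hg hg0
  have hb₁ := memLp_conformalBubble hn hα hαn x₁ τ₁
  have hb₂ := memLp_conformalBubble hn hα hαn x₂ τ₂
  have hε : 0 < sharpConst n (n / 2 - s) * bubbleMass n ^ (2 * (n - (n / 2 - s)) / n : ℝ) :=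
    mul_pos (sharpConst_pos hn hα hαn) (Real.rpow_pos_of_pos (bubbleMass_pos hn) _)
  have hdist : energy (n / 2 - s) (g - φ₁) (g - φ₁) = energy (n / 2 - s) (g - φ₂) (g - φ₂) := by
    have hm₁ : MemLp (g - φ₁) (hlsExponent n s) := by
      rw [hφ₁, hlsExponent_eq]; rw [hlsExponent_eq] at hg; exact hg.sub (hb₁.const_smul c₁)
    have hm₂ : MemLp (g - φ₂) (hlsExponent n s) := by
      rw [hφ₂, hlsExponent_eq]; rw [hlsExponent_eq] at hg; exact hg.sub (hb₂.const_smul c₂)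
    have heq := h₁.dist_eq_iInf.trans h₂.dist_eq_iInf.symm
    exact le_antisymm (energy_le_energy_of_negSobolevNorm_le hn hs hsn hm₁ hm₂ heq.le)
      (energy_le_energy_of_negSobolevNorm_le hn hs hsn hm₂ hm₁ heq.ge)
  have hcc : c₁ = c₂ := by
    rw [hE₁, hE₂] at hdist
    have : c₁ ^ 2 = c₂ ^ 2 := mul_right_cancel₀ hε.ne' (by linarith)
    exact (sq_eq_sq₀ hc₁ hc₂).1 this
  subst hcc
  rw [hlsExponent_eq] at hg ⊢
  have hrev := integral_sub_conformalBubble_le hn hα hαn x₁ x₂ τ₁ τ₂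
  have hS := sharpConst_pos hn hα hαn
  set α := (n : ℝ) / 2 - s
  set p : ℝ := n / (n - α) with hp
  set γ : ℝ := 2 * (n - α) / n with hγ
  set κ := (2 : ℝ) ^ (1 + s / n) * Real.sqrt ((n + 2 * s) / (n - 2 * s))
  have hκ : 0 ≤ κ := by positivity
  have hp0 : 0 < p := by positivity
  have hm₁ : MemLp (g - φ₁) (ENNReal.ofReal p) := by rw [hφ₁]; exact hg.sub (hb₁.const_smul c₁)
  have hm₂ : MemLp (g - φ₂) (ENNReal.ofReal p) := by rw [hφ₂]; exact hg.sub (hb₂.const_smul c₁)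
  have hmφ : MemLp (φ₁ - φ₂) (ENNReal.ofReal p) := by
    rw [hφ₁, hφ₂]; exact (hb₁.const_smul c₁).sub (hb₂.const_smul c₁)
  have hupper := energy_sub_self_le hn hα hαn hpos hm₂ hm₁
  rw [← hdist, sub_sub_sub_cancel_left] at hupper
  have hsharp := energy_le_sharpConst_mul hn hα hαn hm₁
  have hsub : φ₁ - φ₂ = c₁ • (conformalBubble α x₁ τ₁ - conformalBubble α x₂ τ₂) := by
    rw [hφ₁, hφ₂, smul_sub]
  have hscale : energy α (φ₁ - φ₂) (φ₁ - φ₂) = c₁ ^ 2 * energy α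
      (conformalBubble α x₁ τ₁ - conformalBubble α x₂ τ₂)
      (conformalBubble α x₁ τ₁ - conformalBubble α x₂ τ₂) := by
    rw [hsub, energy_smul_left, energy_comm, energy_smul_left]
    ring
  have hpγ : p * γ = 2 := by rw [hp, hγ]; field_simp
  have hI0 : ∀ f : V → ℝ, 0 ≤ ∫ x, |f x| ^ p := fun f =>
    integral_nonneg fun x => Real.rpow_nonneg (abs_nonneg _) _
  have hIφ : (∫ x, |(φ₁ - φ₂) x| ^ p) ^ γ = c₁ ^ 2 *
      (∫ x, |conformalBubble α x₁ τ₁ x - conformalBubble α x₂ τ₂ x| ^ p) ^ γ := by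
    rw [hsub]
    simp only [Pi.smul_apply, Pi.sub_apply, smul_eq_mul, abs_mul, abs_of_nonneg hc₁]
    simp only [Real.mul_rpow hc₁ (abs_nonneg _)]
    rw [integral_const_mul, Real.mul_rpow (Real.rpow_nonneg hc₁ _) (integral_nonneg fun x =>
      Real.rpow_nonneg (abs_nonneg _) _), ← Real.rpow_mul hc₁, hpγ, Real.rpow_two]
  -- The factor 4 in `κ²` comes from `2 + 2` in the parallelogram bound with equal distances, the
  -- rest from the reverse inequality. The sharp constant cancels.
  have hmain : (∫ x, |(φ₁ - φ₂) x| ^ p) ^ γ ≤ κ ^ 2 * (∫ x, |(g - φ₁) x| ^ p) ^ γ := by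
    rw [hconst, hIφ]
    have hK : 0 ≤ 2 ^ (γ - 1) * ((n - α) / α) := by positivity
    refine le_of_mul_le_mul_left ?_ hS
    have h1 := mul_le_mul_of_nonneg_left hrev (sq_nonneg c₁)
    have h2 := mul_le_mul_of_nonneg_left (hupper.trans (show _ ≤ 4 * (sharpConst n α *
      (∫ x, |(g - φ₁) x| ^ p) ^ γ) by linarith)) hK
    rw [hscale] at h2
    linarith
  have hsq : ∀ f : V → ℝ, (∫ x, |f x| ^ p) ^ γ = ((∫ x, |f x| ^ p) ^ p⁻¹) ^ 2 := fun f => by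
    rw [← Real.rpow_natCast, ← Real.rpow_mul (hI0 f)]
    congr 1
    push_cast
    field_simp
    linarith
  rw [hsq, hsq, ← mul_pow] at hmain
  have hroot := (pow_le_pow_iff_left₀ (Real.rpow_nonneg (hI0 _) _)
    (mul_nonneg hκ (Real.rpow_nonneg (hI0 _) _)) two_ne_zero).1 hmain
  have hp0' : ENNReal.ofReal p ≠ 0 := by simpa using hp0
  rw [← eLpNorm_congr_ae hr, hmφ.eLpNorm_eq_integral_rpow_norm hp0' ENNReal.ofReal_ne_top,
    hm₁.eLpNorm_eq_integral_rpow_norm hp0' ENNReal.ofReal_ne_top, ENNReal.toReal_ofReal hp0.le,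
    ← ENNReal.ofReal_mul hκ]
  exact ENNReal.ofReal_le_ofReal hroot

lemma IsDecomposition.eLpNorm_remainder_le (hn : 0 < n) {s : ℝ} (hs : 0 < s)
    (hsn : s < (n : ℝ) / 2) {g φ₁ r₁ φ₂ r₂ : V → ℝ} (hg : MemLp g (hlsExponent n s))
    (hg0 : 0 ≤ᵐ[volume] g) (h₁ : IsDecomposition n s g φ₁ r₁) (h₂ : IsDecomposition n s g φ₂ r₂) :
    eLpNorm r₂ (hlsExponent n s) volume ≤
      ENNReal.ofReal (1 + 2 ^ (1 + s / n) * Real.sqrt ((n + 2 * s) / (n - 2 * s))) *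
        eLpNorm r₁ (hlsExponent n s) volume := by
  have hdiff := h₁.eLpNorm_sub_le hn hs hsn hg hg0 h₂
  have hα : 0 < (n : ℝ) / 2 - s := by linarith
  have hαn : 2 * ((n : ℝ) / 2 - s) < n := by linarith
  have hmem : ∀ {φ r : V → ℝ}, IsDecomposition n s g φ r → AEStronglyMeasurable φ volume := by
    intro φ r h
    obtain ⟨c, x₀, τ, rfl⟩ := exists_eq_smul_conformalBubble h.mem_optimizers
    exact ((measurable_conformalBubble _ x₀ τ).const_smul c).aestronglyMeasurable
  have h1 : (1 : ENNReal) ≤ hlsExponent n s := by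
    rw [hlsExponent_eq, ENNReal.one_le_ofReal]
    exact (exponent_bounds hα hαn).1.le
  have hsplit : g - φ₂ = (g - φ₁) + (φ₁ - φ₂) := by abel
  rw [← eLpNorm_congr_ae h₂.remainder_ae_eq, hsplit]
  refine (eLpNorm_add_le (hg.1.sub (hmem h₁)) ((hmem h₁).sub (hmem h₂)) h1).trans ?_
  rw [eLpNorm_congr_ae h₁.remainder_ae_eq, ENNReal.ofReal_add zero_le_one (by positivity), add_mul,
    ENNReal.ofReal_one, one_mul]
  gcongr

end Decomposition

end HLS

theorem mainTheorem7 (n : ℕ) (s : ℝ) (hs : 0 < s) (hsn : s < (n : ℝ) / 2)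
    (g φ₁ r₁ φ₂ r₂ : EuclideanSpace ℝ (Fin n) → ℝ)
    (hg : MeasureTheory.MemLp g (HLS.hlsExponent n s) MeasureTheory.volume)
    (hg0 : 0 ≤ᵐ[MeasureTheory.volume] g)
    (h₁ : HLS.IsDecomposition n s g φ₁ r₁) (h₂ : HLS.IsDecomposition n s g φ₂ r₂)
    (b : ℝ) (hb : b = 1 + (2 : ℝ) ^ (1 + s / n) * Real.sqrt ((n + 2 * s) / (n - 2 * s))) :
    ENNReal.ofReal b⁻¹ * MeasureTheory.eLpNorm r₁ (HLS.hlsExponent n s) MeasureTheory.volume ≤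
        MeasureTheory.eLpNorm r₂ (HLS.hlsExponent n s) MeasureTheory.volume ∧
      MeasureTheory.eLpNorm r₂ (HLS.hlsExponent n s) MeasureTheory.volume ≤
        ENNReal.ofReal b * MeasureTheory.eLpNorm r₁ (HLS.hlsExponent n s) MeasureTheory.volume := by
  have hn : 0 < n := by
    have : (0 : ℝ) < n := by linarith
    exact_mod_cast this
  have hb0 : 0 < b := by rw [hb]; positivity
  refine ⟨?_, hb ▸ h₁.eLpNorm_remainder_le hn hs hsn hg hg0 h₂⟩
  -- The lower bound is the upper bound with the two decompositions exchanged.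
  have h := h₂.eLpNorm_remainder_le hn hs hsn hg hg0 h₁
  rw [← hb] at h
  calc _ ≤ ENNReal.ofReal b⁻¹ * (ENNReal.ofReal b * _) := by gcongr
    _ = _ := by
      rw [← mul_assoc, ← ENNReal.ofReal_mul (inv_pos.2 hb0).le, inv_mul_cancel₀ hb0.ne',
        ENNReal.ofReal_one, one_mul]
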